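/- Let $k$ be a field and let $A=\bigoplus_{i\ge 0}A^i$ be a positively graded associative unital $k$-algebra of finite type, i.e. with every $A^i$ finite-dimensional. All modules and comodules below are $\mathbb Z$-graded, with cohomological indexing, and $\otimes=\otimes_k$. Let $C=DA=\bigoplus_{i\ge0}\operatorname{Hom}_k(A^i,k)$ be the graded dual coalgebra ($\operatorname{Hom}_k(A^i,k)$ in degree $-i$), with comultiplication dual to multiplication, i.e. $f(ab)=\sum f'(a)f''(b)$ if $\Delta f=\sum f'\otimes f''$, and counit $f\mapsto f(1)$. A graded module $M$ is bounded above if $M^p=0$ for $p\gg0$. A bounded-above graded left $A$-module $M$ is a graded right $C$-comodule through $\Delta_M\colon M\to M\otimes C\subseteq\operatorname{Hom}_k(A,M)$, $\Delta_M(m)(a)=am$, and a bounded-above graded right $A$-module $N$ is a graded left $C$-comodule through $\Delta_N\colon N\to C\otimes N\subseteq\operatorname{Hom}_k(A,N)$, $\Delta_N(n)(a)=na$. For a graded right comodule $X$ and a graded left comodule $Y$ let $X\,\square_C\,Y$ be the kernel of $x\otimes y\mapsto\Delta_X(x)\otimes y-x\otimes\Delta_Y(y)$ on $X\otimes Y$,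 with the grading induced from $X\otimes Y$. Define $$\mathrm{Cotor}_C^n(M,N)=H^n(I^*\,\square_C\,J^*),$$ the cohomology of the total complex, as a graded vector space, where $M\to I^*$ and $N\to J^*$ are injective resolutions in the categories of graded right and left $C$-comodules (morphisms of degree $0$). Consider $M\otimes N$ as a graded $A$-bimodule with $a(m\otimes n)b=am\otimes nb$. For a graded bimodule $B$ let $\hom_{A^e}(A,B)$ be the graded vector space whose degree-$p$ part consists of the linear maps $f\colon A\to B$ with $f(A^i)\subseteq B^{i+p}$ and $f(axb)=\varepsilon^{p|a|}\,a f(x) b$ for all homogeneous $a\in A$ and all $x,b\in A$, where $\varepsilon\in\{1,-1\}$ is a fixed sign convention ($\varepsilon=-1$: Koszul signs; $\varepsilon=1$: no signs). Define the graded Hochschild cohomology $$H^n_{gr}(A,B)=H^n(\hom_{A^e}(A,E^*)),$$ a graded vector space, where $B\to E^*$ is an injective resolution in the category of graded $A$-bimodules (morphisms of degree $0$). Theorem. If $M$ is a bounded-above graded left $A$-module and $N$ a bounded-above graded right $A$-module, then the injective resolutions of $M$, $N$ and $M\otimes N$ used above exist, and for each $n\ge0$ and either choice of $\varepsilon$ there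 is an isomorphism of graded vector spaces $$\mathrm{Cotor}_C^n(M,N)\;\cong\;H_{gr}^n(A,M\otimes N),$$ natural in $M$ and $N$. Precisely: there are such isomorphisms for all choices of the resolutions $I^*,J^*,E^*$, and they commute with the maps induced by module homomorphisms $f\colon M\to M'$, $g\colon N\to N'$ (of degree $0$) through any morphisms of resolutions lifting $f$, $g$ and $f\otimes g$. -/

import Mathlib

open TensorProduct CategoryTheory

universe u

namespace GrCotor

section Tensor

variable {k : Type u} [Field k]
  {V : Type u} [AddCommMonoid V] [Module k V] {W : Type u} [AddCommMonoid W] [Module k W]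

/-- The degree `p` part of the tensor product of two graded vector spaces: it is spanned by the
tensors `v ⊗ w` of homogeneous elements with `deg v + deg w = p`. -/
def tensorGr (𝓥 : ℤ → Submodule k V) (𝓦 : ℤ → Submodule k W) (p : ℤ) :
    Submodule k (V ⊗[k] W) :=
  Submodule.span k {t | ∃ i j : ℤ, i + j = p ∧ ∃ v ∈ 𝓥 i, ∃ w ∈ 𝓦 j, v ⊗ₜ[k] w = t}

theorem tmul_mem_tensorGr {𝓥 : ℤ → Submodule k V} {𝓦 : ℤ → Submodule k W} {i j p : ℤ}
    (h : i + j = p) {v : V} (hv : v ∈ 𝓥 i) {w : W} (hw : w ∈ 𝓦 j) :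
    v ⊗ₜ[k] w ∈ tensorGr 𝓥 𝓦 p :=
  Submodule.subset_span ⟨i, j, h, v, hv, w, hw, rfl⟩

/-- Linear maps preserving degrees have a tensor product preserving degrees. -/
theorem map_mem_tensorGr {V' : Type u} [AddCommMonoid V'] [Module k V']
    {W' : Type u} [AddCommMonoid W'] [Module k W']
    {𝓥 : ℤ → Submodule k V} {𝓦 : ℤ → Submodule k W}
    {𝓥' : ℤ → Submodule k V'} {𝓦' : ℤ → Submodule k W'}
    {f : V →ₗ[k] V'} {g : W →ₗ[k] W'} {a b : ℤ}
    (hf : ∀ i, ∀ v ∈ 𝓥 i, f v ∈ 𝓥' (a + i)) (hg : ∀ i, ∀ w ∈ 𝓦 i, g w ∈ 𝓦' (b + i))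
    {p q : ℤ} (hq : a + b + p = q) {t : V ⊗[k] W} (ht : t ∈ tensorGr 𝓥 𝓦 p) :
    TensorProduct.map f g t ∈ tensorGr 𝓥' 𝓦' q := by
  induction ht using Submodule.span_induction with
  | mem t ht =>
    obtain ⟨i, j, hij, v, hv, w, hw, rfl⟩ := ht
    rw [TensorProduct.map_tmul]
    exact tmul_mem_tensorGr (by omega) (hf i v hv) (hg j w hw)
  | zero => simp
  | add x y _ _ hx hy => rw [map_add]; exact add_mem hx hy
  | smul c x _ hx => rw [map_smul]; exact Submodule.smul_mem _ c hx

theorem comm_mem_tensorGr {𝓥 : ℤ → Submodule k V} {𝓦 : ℤ → Submodule k W} {p : ℤ}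
    {t : V ⊗[k] W} (ht : t ∈ tensorGr 𝓥 𝓦 p) :
    TensorProduct.comm k V W t ∈ tensorGr 𝓦 𝓥 p := by
  induction ht using Submodule.span_induction with
  | mem t ht =>
    obtain ⟨i, j, hij, v, hv, w, hw, rfl⟩ := ht
    exact tmul_mem_tensorGr (by omega) hw hv
  | zero => simp
  | add x y _ _ hx hy => rw [map_add]; exact add_mem hx hy
  | smul c x _ hx => rw [map_smul]; exact Submodule.smul_mem _ c hx

theorem tensorGr_isInternal {𝓥 : ℤ → Submodule k V} {𝓦 : ℤ → Submodule k W}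
    (h𝓥 : DirectSum.IsInternal 𝓥) (h𝓦 : DirectSum.IsInternal 𝓦) :
    DirectSum.IsInternal (tensorGr 𝓥 𝓦) := by
  classical
  let _ := h𝓥.chooseDecomposition
  let _ := h𝓦.chooseDecomposition
  let b : ∀ i j : ℤ, 𝓥 i →ₗ[k] 𝓦 j →ₗ[k] DirectSum ℤ (fun p => tensorGr 𝓥 𝓦 p) := fun i j =>
    LinearMap.mk₂ k (fun v w => DirectSum.lof k ℤ (fun p => tensorGr 𝓥 𝓦 p) (i + j)
        ⟨(v : V) ⊗ₜ[k] (w : W), tmul_mem_tensorGr rfl v.2 w.2⟩)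
      (fun v v' w => by
        rw [← map_add]; congr 1; ext; simp [TensorProduct.add_tmul])
      (fun c v w => by
        rw [← map_smul]; congr 1)
      (fun v w w' => by
        rw [← map_add]; congr 1; ext; simp [TensorProduct.tmul_add])
      (fun c v w => by
        rw [← map_smul]; congr 1; ext; simp)
  let g : DirectSum ℤ (fun i => 𝓥 i) →ₗ[k] DirectSum ℤ (fun j => 𝓦 j) →ₗ[k]
      DirectSum ℤ (fun p => tensorGr 𝓥 𝓦 p) :=
    DirectSum.toModule k ℤ _ fun i => LinearMap.flip (DirectSum.toModule k ℤ _ fun j => (b i j).flip)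
  let D : V ⊗[k] W →ₗ[k] DirectSum ℤ (fun p => tensorGr 𝓥 𝓦 p) :=
    TensorProduct.lift (g.compl₁₂ (DirectSum.decomposeLinearEquiv 𝓥).toLinearMap
      (DirectSum.decomposeLinearEquiv 𝓦).toLinearMap)
  have key : ∀ i j : ℤ, ∀ v (hv : v ∈ 𝓥 i) w (hw : w ∈ 𝓦 j), D (v ⊗ₜ w) =
      DirectSum.lof k ℤ (fun p => tensorGr 𝓥 𝓦 p) (i + j)
        ⟨v ⊗ₜ[k] w, tmul_mem_tensorGr rfl hv hw⟩ := by
    intro i j v hv w hw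
    simp only [D, TensorProduct.lift.tmul, LinearMap.compl₁₂_apply, LinearEquiv.coe_coe,
      DirectSum.decomposeLinearEquiv_apply]
    rw [DirectSum.decompose_of_mem _ hv, DirectSum.decompose_of_mem _ hw]
    simp only [g, ← DirectSum.lof_eq_of k, DirectSum.toModule_lof, LinearMap.flip_apply]
    simp only [b, LinearMap.mk₂_apply]
  have hl : DirectSum.coeLinearMap (tensorGr 𝓥 𝓦) ∘ₗ D = LinearMap.id := by
    refine TensorProduct.ext' fun v w => ?_
    induction v using DirectSum.Decomposition.inductionOn 𝓥 with
    | zero => simp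
    | add v v' hv hv' => simp only [TensorProduct.add_tmul, map_add, hv, hv']
    | homogeneous v =>
      induction w using DirectSum.Decomposition.inductionOn 𝓦 with
      | zero => simp
      | add v v' hv hv' => simp only [TensorProduct.tmul_add, map_add, hv, hv']
      | homogeneous w =>
        rw [LinearMap.comp_apply, key _ _ _ v.2 _ w.2]
        simp
  have hr' : ∀ p t (ht : t ∈ tensorGr 𝓥 𝓦 p), D t =
      DirectSum.lof k ℤ (fun p => tensorGr 𝓥 𝓦 p) p ⟨t, ht⟩ := by
    intro p t ht
    induction ht using Submodule.span_induction with
    | mem t ht =>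
      obtain ⟨i, j, rfl, v, hv, w, hw, rfl⟩ := ht
      exact key _ _ _ hv _ hw
    | zero => rw [map_zero]; exact (map_zero _).symm
    | add x y _ _ hx hy => rw [map_add, hx, hy, ← map_add]; rfl
    | smul c x _ hx => rw [map_smul, hx, ← map_smul]; rfl
  have hr : D ∘ₗ DirectSum.coeLinearMap (tensorGr 𝓥 𝓦) = LinearMap.id := by
    ext p t : 2
    simp [hr' p t.1 t.2]
  let _ := DirectSum.Decomposition.ofLinearMap (tensorGr 𝓥 𝓦) D hl hr
  exact DirectSum.Decomposition.isInternal _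

end Tensor

section Dual

variable {k : Type u} [Field k] {A : Type u} [Ring A] [Algebra k A]

/-- A `ℤ`-indexed grading is positive and of finite type: it is concentrated in degrees `≥ 0` and
every homogeneous part is finite-dimensional. -/
class PosFiniteType (𝓐 : ℤ → Submodule k A) : Prop where
  eq_bot_of_neg : ∀ n < 0, 𝓐 n = ⊥
  finiteDimensional : ∀ n, FiniteDimensional k (𝓐 n)

/-- The degree `p` part of the graded dual: functionals vanishing on `A^i` for all `i ≠ -p`,
that is, the dual of `A^{-p}`. -/
def dualPiece (𝓐 : ℤ → Submodule k A) (p : ℤ) : Submodule k (Module.Dual k A) where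
  carrier := {f | ∀ i : ℤ, i ≠ -p → ∀ a ∈ 𝓐 i, f a = 0}
  add_mem' := fun hf hg i hi a ha => by simp [hf i hi a ha, hg i hi a ha]
  zero_mem' := fun _ _ _ _ => rfl
  smul_mem' := fun c f hf i hi a ha => by simp [hf i hi a ha]

/-- The graded dual `DA`, the sum of the duals of the homogeneous parts of `A`. -/
def grDual (𝓐 : ℤ → Submodule k A) : Submodule k (Module.Dual k A) :=
  ⨆ p, dualPiece 𝓐 p

/-- The grading of the graded dual; `DA` lives in (cohomological) degrees `≤ 0`. -/
def dualGr (𝓐 : ℤ → Submodule k A) (p : ℤ) : Submodule k (grDual 𝓐) :=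
  (dualPiece 𝓐 p).comap (grDual 𝓐).subtype

variable (𝓐 : ℤ → Submodule k A)
variable {V : Type u} [AddCommMonoid V] [Module k V]

/-- The canonical map `V ⊗ DA → Hom(A, V)`, `(v ⊗ f)(a) = f(a) v`. -/
noncomputable def canHom (V : Type u) [AddCommMonoid V] [Module k V] :
    V ⊗[k] grDual 𝓐 →ₗ[k] A →ₗ[k] V :=
  TensorProduct.lift <| LinearMap.mk₂ k (fun v f => LinearMap.smulRight (f : Module.Dual k A) v)
    (fun v v' f => by ext; simp) (fun c v f => by ext; simp only [LinearMap.smulRight_apply, LinearMap.smul_apply]; rw [smul_comm])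
    (fun v f f' => by ext; simp [add_smul]) (fun c v f => by ext; simp [mul_smul])

@[simp]
theorem canHom_tmul (v : V) (f : grDual 𝓐) (a : A) :
    canHom 𝓐 V (v ⊗ₜ f) a = (f : Module.Dual k A) a • v := by
  simp [canHom]

theorem canHom_injective : Function.Injective (canHom 𝓐 V) := by
  classical
  intro s t hst
  let _ : AddCommGroup V := Module.addCommMonoidToAddCommGroup k
  let b := Module.Basis.ofVectorSpace k V
  have key : ∀ (t : V ⊗[k] grDual 𝓐) i a,
      b.repr (canHom 𝓐 V t a) i =
        (TensorProduct.equivFinsuppOfBasisLeft b t i : Module.Dual k A) a := by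
    intro t i a
    induction t with
    | zero => simp
    | add x y hx hy => simp [hx, hy]
    | tmul v f =>
      rw [TensorProduct.equivFinsuppOfBasisLeft_apply_tmul_apply]
      simp [mul_comm]
  apply (TensorProduct.equivFinsuppOfBasisLeft (N := grDual 𝓐) b).injective
  ext i a
  rw [← key, ← key, hst]

theorem canHom_map {W : Type u} [AddCommMonoid W] [Module k W] (g : V →ₗ[k] W)
    (t : V ⊗[k] grDual 𝓐) (a : A) :
    canHom 𝓐 W (g.rTensor _ t) a = g (canHom 𝓐 V t a) := by
  induction t with
  | zero => simp
  | add x y hx hy => simp [hx, hy]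
  | tmul v f => simp

theorem grDual_bounded (f : grDual 𝓐) :
    ∃ b : ℤ, ∀ i > b, ∀ a ∈ 𝓐 i, (f : Module.Dual k A) a = 0 := by
  obtain ⟨f, hf⟩ := f
  dsimp only
  induction hf using Submodule.iSup_induction' with
  | mem p f hf => exact ⟨-p, fun i hi a ha => hf i hi.ne' a ha⟩
  | zero => exact ⟨0, fun _ _ _ _ => rfl⟩
  | add f g _ _ hf hg =>
    obtain ⟨b, hb⟩ := hf
    obtain ⟨c, hc⟩ := hg
    refine ⟨max b c, fun i hi a ha => ?_⟩
    rw [LinearMap.add_apply, hb i (lt_of_le_of_lt (le_max_left _ _) hi) a ha,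
      hc i (lt_of_le_of_lt (le_max_right _ _) hi) a ha, add_zero]

theorem eq_zero_of_neg [PosFiniteType 𝓐] {n : ℤ} (hn : n < 0) {a : A} (ha : a ∈ 𝓐 n) : a = 0 := by
  rwa [PosFiniteType.eq_bot_of_neg (𝓐 := 𝓐) n hn, Submodule.mem_bot] at ha

variable [GradedAlgebra 𝓐]

/-- The projection of `A` onto its degree `i` part. -/
noncomputable def projGr (i : ℤ) : A →ₗ[k] 𝓐 i :=
  DirectSum.component k ℤ (fun i => 𝓐 i) i ∘ₗ (DirectSum.decomposeLinearEquiv 𝓐).toLinearMap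

theorem projGr_of_mem {i : ℤ} {a : A} (ha : a ∈ 𝓐 i) : projGr 𝓐 i a = ⟨a, ha⟩ := by
  ext
  have h := DirectSum.decompose_of_mem_same 𝓐 ha
  rw [← DirectSum.decomposeLinearEquiv_apply (R := k)] at h
  exact h

theorem projGr_of_mem_ne {i j : ℤ} (hij : j ≠ i) {a : A} (ha : a ∈ 𝓐 j) : projGr 𝓐 i a = 0 := by
  ext
  have h := DirectSum.decompose_of_mem_ne 𝓐 ha hij
  rw [← DirectSum.decomposeLinearEquiv_apply (R := k)] at h
  exact h

/-- Extend a functional on `A^i` by zero to an element of the graded dual. -/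
noncomputable def extDual (i : ℤ) (f : Module.Dual k (𝓐 i)) : grDual 𝓐 :=
  ⟨f ∘ₗ projGr 𝓐 i, Submodule.mem_iSup_of_mem (-i) fun j hj a ha => by
    rw [LinearMap.comp_apply, projGr_of_mem_ne 𝓐 (by simpa using hj) ha, map_zero]⟩

theorem extDual_mem (i : ℤ) (f : Module.Dual k (𝓐 i)) : extDual 𝓐 i f ∈ dualGr 𝓐 (-i) :=
  fun j hj a ha => by
    change f (projGr 𝓐 i a) = 0
    rw [projGr_of_mem_ne 𝓐 (by simpa using hj) ha, map_zero]

/-- The bilinear map `(f, b) ↦ f(- b)`. -/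
noncomputable def dualAct : grDual 𝓐 →ₗ[k] A →ₗ[k] grDual 𝓐 :=
  LinearMap.mk₂ k (fun f b => ⟨(f : Module.Dual k A) ∘ₗ LinearMap.mulRight k b, by
    classical
    obtain ⟨f, hf⟩ := f
    dsimp only
    induction b using DirectSum.Decomposition.inductionOn 𝓐 with
    | zero => simp
    | add x y hx hy =>
      have : f ∘ₗ LinearMap.mulRight k (x + y) =
          f ∘ₗ LinearMap.mulRight k x + f ∘ₗ LinearMap.mulRight k y := by
        ext; simp [mul_add]
      rw [this]; exact add_mem hx hy
    | @homogeneous j b =>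
      induction hf using Submodule.iSup_induction' with
      | mem p f hf =>
        refine Submodule.mem_iSup_of_mem (p + j) fun i hi a ha => ?_
        exact hf (i + j) (by omega) _ (SetLike.mul_mem_graded ha b.2)
      | zero => simp
      | add f g _ _ hf hg => rw [LinearMap.add_comp]; exact add_mem hf hg⟩)
    (fun f f' b => by ext; simp) (fun c f b => by ext; simp)
    (fun f b b' => by ext; simp [mul_add]) (fun c f b => by ext; simp)

@[simp]
theorem dualAct_apply (f : grDual 𝓐) (a b : A) :
    (dualAct 𝓐 f b : Module.Dual k A) a = (f : Module.Dual k A) (a * b) := rfl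

variable [PosFiniteType 𝓐]

/-- A linear map `g : A → V` that vanishes in high degrees comes from `V ⊗ DA`. -/
theorem exists_canHom_eq (g : A →ₗ[k] V) (hg : ∃ b : ℤ, ∀ i > b, ∀ a ∈ 𝓐 i, g a = 0)
    (S : Submodule k (V ⊗[k] grDual 𝓐))
    (hS : ∀ i : ℤ, ∀ a ∈ 𝓐 i, ∀ f ∈ dualGr 𝓐 (-i), g a ⊗ₜ[k] f ∈ S) :
    ∃ t ∈ S, canHom 𝓐 V t = g := by
  classical
  obtain ⟨b, hb⟩ := hg
  have hfin : ∀ n, FiniteDimensional k (𝓐 n) := PosFiniteType.finiteDimensional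
  let B := fun i => Module.finBasis k (𝓐 i)
  refine ⟨∑ i ∈ Finset.Icc 0 b, ∑ e, g (B i e : A) ⊗ₜ[k] extDual 𝓐 i ((B i).coord e), ?_, ?_⟩
  · exact sum_mem fun i _ => sum_mem fun e _ => hS i _ (B i e).2 _ (extDual_mem 𝓐 i _)
  · have inner : ∀ i a, canHom 𝓐 V (∑ e, g (B i e : A) ⊗ₜ[k] extDual 𝓐 i ((B i).coord e)) a =
        g (projGr 𝓐 i a) := by
      intro i a
      have h := congrArg (fun z : 𝓐 i => g (z : A)) ((B i).sum_repr (projGr 𝓐 i a))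
      simp only [Submodule.coe_sum, map_sum, Submodule.coe_smul, map_smul] at h
      rw [← h]
      simp [extDual, map_sum]
    ext a
    rw [map_sum, LinearMap.sum_apply]
    simp only [inner]
    induction a using DirectSum.Decomposition.inductionOn 𝓐 with
    | zero => simp
    | add x y hx hy => simp only [map_add, Submodule.coe_add, Finset.sum_add_distrib, hx, hy]
    | @homogeneous j a =>
      have hz : ∀ i ∈ Finset.Icc 0 b, i ≠ j → g (projGr 𝓐 i (a : A)) = 0 := by
        intro i _ hij
        rw [projGr_of_mem_ne 𝓐 hij.symm a.2]
        simp
      rw [Finset.sum_eq_single j hz]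
      · rw [projGr_of_mem 𝓐 a.2]
      · intro hj
        rw [projGr_of_mem 𝓐 a.2]
        rw [Finset.mem_Icc, not_and_or, not_le, not_le] at hj
        rcases hj with hj | hj
        · have h0 := eq_zero_of_neg 𝓐 hj a.2
          simp [h0]
        · exact hb j hj a a.2

/-- The map `ρ : V → V ⊗ DA` with `ρ(v)(a) = φ v a`, for a bilinear map `φ : V × A → V` such that
every `φ v` vanishes in high degrees. -/
noncomputable def coactOf (φ : V →ₗ[k] A →ₗ[k] V)
    (hφ : ∀ v, ∃ b : ℤ, ∀ i > b, ∀ a ∈ 𝓐 i, φ v a = 0) : V →ₗ[k] V ⊗[k] grDual 𝓐 :=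
  (LinearEquiv.ofInjective (canHom 𝓐 V) (canHom_injective 𝓐)).symm.toLinearMap ∘ₗ
    φ.codRestrict (LinearMap.range (canHom 𝓐 V)) fun v => by
      obtain ⟨t, -, ht⟩ := exists_canHom_eq 𝓐 (φ v) (hφ v) ⊤ fun _ _ _ _ _ => trivial
      exact ⟨t, ht⟩

theorem canHom_coactOf {φ : V →ₗ[k] A →ₗ[k] V}
    (hφ : ∀ v, ∃ b : ℤ, ∀ i > b, ∀ a ∈ 𝓐 i, φ v a = 0) (v : V) :
    canHom 𝓐 V (coactOf 𝓐 φ hφ v) = φ v := by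
  have := LinearEquiv.ofInjective_symm_apply (f := canHom 𝓐 V) (h := canHom_injective 𝓐)
    (φ.codRestrict (LinearMap.range (canHom 𝓐 V)) (fun v => by
      obtain ⟨t, -, ht⟩ := exists_canHom_eq 𝓐 (φ v) (hφ v) ⊤ fun _ _ _ _ _ => trivial
      exact ⟨t, ht⟩) v)
  exact this

theorem coactOf_mem {φ : V →ₗ[k] A →ₗ[k] V}
    (hφ : ∀ v, ∃ b : ℤ, ∀ i > b, ∀ a ∈ 𝓐 i, φ v a = 0) {𝓥 : ℤ → Submodule k V}
    (h : ∀ i j, ∀ v ∈ 𝓥 j, ∀ a ∈ 𝓐 i, φ v a ∈ 𝓥 (i + j)) {j : ℤ} {v : V} (hv : v ∈ 𝓥 j) :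
    coactOf 𝓐 φ hφ v ∈ tensorGr 𝓥 (dualGr 𝓐) j := by
  obtain ⟨t, ht, h'⟩ := exists_canHom_eq 𝓐 (φ v) (hφ v) (tensorGr 𝓥 (dualGr 𝓐) j)
    fun i a ha f hf => tmul_mem_tensorGr (by omega) (h i j v hv a ha) hf
  rw [← canHom_coactOf 𝓐 hφ v] at h'
  exact canHom_injective 𝓐 h' ▸ ht

theorem coactOf_map {W : Type u} [AddCommMonoid W] [Module k W]
    {φ : V →ₗ[k] A →ₗ[k] V} (hφ : ∀ v, ∃ b : ℤ, ∀ i > b, ∀ a ∈ 𝓐 i, φ v a = 0)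
    {ψ : W →ₗ[k] A →ₗ[k] W} (hψ : ∀ v, ∃ b : ℤ, ∀ i > b, ∀ a ∈ 𝓐 i, ψ v a = 0)
    (f : V →ₗ[k] W) (h : ∀ v a, f (φ v a) = ψ (f v) a) (v : V) :
    coactOf 𝓐 ψ hψ (f v) = f.rTensor _ (coactOf 𝓐 φ hφ v) := by
  apply canHom_injective 𝓐
  ext a
  rw [canHom_map, canHom_coactOf, canHom_coactOf, h]

theorem coactOf_map_left {W : Type u} [AddCommMonoid W] [Module k W]
    {φ : V →ₗ[k] A →ₗ[k] V} (hφ : ∀ v, ∃ b : ℤ, ∀ i > b, ∀ a ∈ 𝓐 i, φ v a = 0)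
    {ψ : W →ₗ[k] A →ₗ[k] W} (hψ : ∀ v, ∃ b : ℤ, ∀ i > b, ∀ a ∈ 𝓐 i, ψ v a = 0)
    (f : V →ₗ[k] W) (h : ∀ v a, f (φ v a) = ψ (f v) a) (v : V) :
    TensorProduct.comm k W (grDual 𝓐) (coactOf 𝓐 ψ hψ (f v)) =
      f.lTensor _ (TensorProduct.comm k V (grDual 𝓐) (coactOf 𝓐 φ hφ v)) := by
  rw [coactOf_map 𝓐 hφ hψ f h]
  generalize coactOf 𝓐 φ hφ v = x
  induction x with
  | zero => simp
  | add x y hx hy => simp only [map_add, hx, hy]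
  | tmul v c => simp

theorem dualAct_bounded (f : grDual 𝓐) :
    ∃ b : ℤ, ∀ i > b, ∀ a ∈ 𝓐 i, dualAct 𝓐 f a = 0 := by
  classical
  obtain ⟨c, hc⟩ := grDual_bounded 𝓐 f
  refine ⟨c, fun i hi a ha => ?_⟩
  ext x
  rw [dualAct_apply]
  induction x using DirectSum.Decomposition.inductionOn 𝓐 with
  | zero => simp
  | add x y hx hy => rw [add_mul, map_add, hx, hy]; simp
  | @homogeneous j x =>
    by_cases hj : j < 0
    · simp [eq_zero_of_neg 𝓐 hj x.2]
    · exact hc (j + i) (by omega) _ (SetLike.mul_mem_graded x.2 ha)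

/-- The comultiplication of `DA`, dual to the multiplication of `A`:
if `Δ f = ∑ f' ⊗ f''` then `f (a * b) = ∑ f' a * f'' b`. -/
noncomputable def comulDual : grDual 𝓐 →ₗ[k] grDual 𝓐 ⊗[k] grDual 𝓐 :=
  coactOf 𝓐 (dualAct 𝓐) (dualAct_bounded 𝓐)

/-- The counit of `DA`, dual to the unit of `A`: evaluation at `1`. -/
noncomputable def counitDual : grDual 𝓐 →ₗ[k] k :=
  Module.Dual.eval k A 1 ∘ₗ (grDual 𝓐).subtype

theorem canHom_comul (f : grDual 𝓐) (a b : A) :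
    (canHom 𝓐 _ (comulDual 𝓐 f) b : Module.Dual k A) a = (f : Module.Dual k A) (a * b) := by
  rw [comulDual, canHom_coactOf, dualAct_apply]

theorem comulDual_mem {p : ℤ} {f : grDual 𝓐} (hf : f ∈ dualGr 𝓐 p) :
    comulDual 𝓐 f ∈ tensorGr (dualGr 𝓐) (dualGr 𝓐) p :=
  coactOf_mem 𝓐 (dualAct_bounded 𝓐) (𝓥 := dualGr 𝓐) (fun i j f hf b hb l hl a ha => by
    exact hf (l + i) (by omega) _ (SetLike.mul_mem_graded ha hb)) hf

/-- Coassociativity of the coaction attached to an action. -/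
theorem coactOf_coassoc {φ : V →ₗ[k] A →ₗ[k] V}
    (hφ : ∀ v, ∃ b : ℤ, ∀ i > b, ∀ a ∈ 𝓐 i, φ v a = 0)
    (h : ∀ v a b, φ (φ v b) a = φ v (a * b)) :
    TensorProduct.assoc k V (grDual 𝓐) (grDual 𝓐) ∘ₗ
        (coactOf 𝓐 φ hφ).rTensor (grDual 𝓐) ∘ₗ coactOf 𝓐 φ hφ =
      (comulDual 𝓐).lTensor V ∘ₗ coactOf 𝓐 φ hφ := by
  have key : ∀ (x : V ⊗[k] grDual 𝓐) (a b : A),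
      canHom 𝓐 V (canHom 𝓐 _ ((TensorProduct.assoc k V (grDual 𝓐) (grDual 𝓐)).symm
        ((comulDual 𝓐).lTensor V x)) b) a = canHom 𝓐 V x (a * b) := by
    intro x a b
    induction x with
    | zero => simp
    | add x y hx hy => simp only [map_add, LinearMap.add_apply, hx, hy]
    | tmul v f =>
      rw [LinearMap.lTensor_tmul, canHom_tmul, ← canHom_comul]
      generalize comulDual 𝓐 f = t
      induction t with
      | zero => simp
      | add x y hx hy =>
        simp only [map_add, LinearMap.add_apply, hx, hy, TensorProduct.tmul_add,
          Submodule.coe_add, add_smul]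
      | tmul f g =>
        simp only [TensorProduct.assoc_symm_tmul, canHom_tmul, map_smul, LinearMap.smul_apply,
          Submodule.coe_smul, smul_eq_mul, mul_smul]
  ext v
  simp only [LinearMap.comp_apply, LinearEquiv.coe_coe]
  apply (TensorProduct.assoc k V (grDual 𝓐) (grDual 𝓐)).symm.injective
  rw [LinearEquiv.symm_apply_apply]
  apply canHom_injective 𝓐
  ext b : 1
  apply canHom_injective 𝓐
  ext a
  rw [key, canHom_map, canHom_coactOf, canHom_coactOf, h]

theorem coactOf_counit {φ : V →ₗ[k] A →ₗ[k] V}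
    (hφ : ∀ v, ∃ b : ℤ, ∀ i > b, ∀ a ∈ 𝓐 i, φ v a = 0) (h : ∀ v, φ v 1 = v) :
    (counitDual 𝓐).lTensor V ∘ₗ coactOf 𝓐 φ hφ = (TensorProduct.mk k V k).flip 1 := by
  have key : ∀ x : V ⊗[k] grDual 𝓐,
      (counitDual 𝓐).lTensor V x = canHom 𝓐 V x 1 ⊗ₜ 1 := by
    intro x
    induction x with
    | zero => simp
    | add x y hx hy => simp only [map_add, LinearMap.add_apply, hx, hy, TensorProduct.add_tmul]
    | tmul v f =>
      rw [LinearMap.lTensor_tmul, canHom_tmul, TensorProduct.smul_tmul]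
      simp [counitDual]
  ext v
  rw [LinearMap.comp_apply, key, canHom_coactOf, h]
  rfl

/-- The graded dual of a positively graded algebra of finite type, as a coalgebra. -/
noncomputable instance instCoalgebraGrDual : Coalgebra k (grDual 𝓐) where
  comul := comulDual 𝓐
  counit := counitDual 𝓐
  coassoc := coactOf_coassoc 𝓐 _ fun f a b => by
    ext x; simp [mul_assoc]
  rTensor_counit_comp_comul := by
    have key : ∀ (x : grDual 𝓐 ⊗[k] grDual 𝓐),
        ((counitDual 𝓐).rTensor (grDual 𝓐) x) =
          1 ⊗ₜ[k] TensorProduct.lid k _ ((counitDual 𝓐).rTensor (grDual 𝓐) x) := by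
      intro x
      generalize (counitDual 𝓐).rTensor (grDual 𝓐) x = y
      apply (TensorProduct.lid k _).injective
      simp
    have key' : ∀ (x : grDual 𝓐 ⊗[k] grDual 𝓐) a,
        ((TensorProduct.lid k _ ((counitDual 𝓐).rTensor (grDual 𝓐) x) : grDual 𝓐) :
          Module.Dual k A) a = (canHom 𝓐 _ x a : Module.Dual k A) 1 := by
      intro x a
      induction x with
      | zero => simp
      | add x y hx hy => simp only [map_add, LinearMap.add_apply, hx, hy, Submodule.coe_add]
      | tmul f g => simp [counitDual, mul_comm]
    ext f : 1
    rw [LinearMap.comp_apply, key, TensorProduct.mk_apply]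
    congr 1
    ext a
    rw [key', canHom_comul, one_mul]
  lTensor_counit_comp_comul := coactOf_counit 𝓐 _ fun f => by
    ext x; simp

/-- Coassociativity of the left coaction attached to a right action. -/
theorem coactOf_coassoc_left {φ : V →ₗ[k] A →ₗ[k] V}
    (hφ : ∀ v, ∃ b : ℤ, ∀ i > b, ∀ a ∈ 𝓐 i, φ v a = 0)
    (h : ∀ v a b, φ (φ v a) b = φ v (a * b)) :
    TensorProduct.assoc k (grDual 𝓐) (grDual 𝓐) V ∘ₗ (comulDual 𝓐).rTensor V ∘ₗ
        ((TensorProduct.comm k V (grDual 𝓐)).toLinearMap ∘ₗ coactOf 𝓐 φ hφ) =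
      ((TensorProduct.comm k V (grDual 𝓐)).toLinearMap ∘ₗ coactOf 𝓐 φ hφ).lTensor (grDual 𝓐) ∘ₗ
        ((TensorProduct.comm k V (grDual 𝓐)).toLinearMap ∘ₗ coactOf 𝓐 φ hφ) := by
  let ev : grDual 𝓐 ⊗[k] V →ₗ[k] A →ₗ[k] V :=
    canHom 𝓐 V ∘ₗ (TensorProduct.comm k (grDual 𝓐) V).toLinearMap
  let ev₂ : grDual 𝓐 ⊗[k] (grDual 𝓐 ⊗[k] V) →ₗ[k] A →ₗ[k] grDual 𝓐 ⊗[k] V :=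
    canHom 𝓐 _ ∘ₗ (TensorProduct.comm k (grDual 𝓐) _).toLinearMap
  have hev : Function.Injective ev :=
    (canHom_injective 𝓐).comp (TensorProduct.comm k (grDual 𝓐) V).injective
  have hev₂ : Function.Injective ev₂ :=
    (canHom_injective 𝓐).comp (TensorProduct.comm k (grDual 𝓐) _).injective
  have key : ∀ (x : V ⊗[k] grDual 𝓐) (a b : A),
      ev (ev₂ (TensorProduct.assoc k (grDual 𝓐) (grDual 𝓐) V
        ((comulDual 𝓐).rTensor V (TensorProduct.comm k V (grDual 𝓐) x))) a) b =
      canHom 𝓐 V x (a * b) := by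
    intro x a b
    induction x with
    | zero => simp
    | add x y hx hy => simp only [map_add, LinearMap.add_apply, hx, hy]
    | tmul v f =>
      rw [TensorProduct.comm_tmul, LinearMap.rTensor_tmul, canHom_tmul, ← canHom_comul]
      generalize comulDual 𝓐 f = t
      induction t with
      | zero => simp
      | add x y hx hy =>
        simp only [map_add, LinearMap.add_apply, hx, hy, TensorProduct.add_tmul,
          Submodule.coe_add, add_smul]
      | tmul f g =>
        simp only [ev, ev₂, LinearMap.comp_apply, LinearEquiv.coe_coe, TensorProduct.assoc_tmul,
          TensorProduct.comm_tmul, canHom_tmul, map_smul, LinearMap.smul_apply,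
          Submodule.coe_smul, smul_eq_mul, smul_smul]
        rw [mul_comm]
  have key' : ∀ (x : V ⊗[k] grDual 𝓐) (a b : A),
      ev (ev₂ (((TensorProduct.comm k V (grDual 𝓐)).toLinearMap ∘ₗ
        coactOf 𝓐 φ hφ).lTensor (grDual 𝓐) (TensorProduct.comm k V (grDual 𝓐) x)) a) b =
      φ (canHom 𝓐 V x a) b := by
    intro x a b
    induction x with
    | zero => simp
    | add x y hx hy => simp only [map_add, LinearMap.add_apply, hx, hy]
    | tmul v f =>
      simp only [ev, ev₂, LinearMap.comp_apply, LinearEquiv.coe_coe, TensorProduct.comm_tmul,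
        LinearMap.lTensor_tmul, canHom_tmul, map_smul, LinearMap.smul_apply,
        TensorProduct.comm_comm, canHom_coactOf]
  ext v : 1
  apply hev₂
  ext a : 1
  apply hev
  ext b
  simp only [LinearMap.comp_apply, LinearEquiv.coe_coe] at key' ⊢
  rw [key, key', canHom_coactOf, h]

theorem coactOf_counit_left {φ : V →ₗ[k] A →ₗ[k] V}
    (hφ : ∀ v, ∃ b : ℤ, ∀ i > b, ∀ a ∈ 𝓐 i, φ v a = 0) (h : ∀ v, φ v 1 = v) :
    (counitDual 𝓐).rTensor V ∘ₗ
      ((TensorProduct.comm k V (grDual 𝓐)).toLinearMap ∘ₗ coactOf 𝓐 φ hφ) =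
      TensorProduct.mk k k V 1 := by
  have key : ∀ x : V ⊗[k] grDual 𝓐,
      (counitDual 𝓐).rTensor V (TensorProduct.comm k V (grDual 𝓐) x) = 1 ⊗ₜ canHom 𝓐 V x 1 := by
    intro x
    induction x with
    | zero => simp
    | add x y hx hy => simp only [map_add, LinearMap.add_apply, hx, hy, TensorProduct.tmul_add]
    | tmul v f =>
      rw [TensorProduct.comm_tmul, LinearMap.rTensor_tmul, canHom_tmul, ← TensorProduct.smul_tmul]
      simp [counitDual]
  ext v
  rw [LinearMap.comp_apply, LinearMap.comp_apply, LinearEquiv.coe_coe, key, canHom_coactOf, h]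
  rfl

end Dual

section Objects

/-- A `ℤ`-graded vector space, with cohomological indexing. -/
structure GrVect (k : Type u) [Field k] where
  carrier : Type u
  [addCommGroup : AddCommGroup carrier]
  [module : Module k carrier]
  gr : ℤ → Submodule k carrier
  isInternal : DirectSum.IsInternal gr

attribute [instance] GrVect.addCommGroup GrVect.module

variable {k : Type u} [Field k]

/-- A graded vector space is bounded above if `V^p = 0` for `p ≫ 0`. -/
def GrVect.IsBddAbove (V : GrVect k) : Prop :=
  ∃ b : ℤ, ∀ p > b, V.gr p = ⊥

section Modules

variable {A : Type u} [Ring A] [Algebra k A]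

/-- A graded left module; the action is given as an algebra map `A → End(M)`. -/
structure GrLMod (𝓐 : ℤ → Submodule k A) extends GrVect k where
  act : A →ₐ[k] Module.End k carrier
  act_mem : ∀ i j, ∀ a ∈ 𝓐 i, ∀ m ∈ gr j, act a m ∈ gr (i + j)

/-- A graded right module; the action is given as an algebra map `Aᵒᵖ → End(N)`. -/
structure GrRMod (𝓐 : ℤ → Submodule k A) extends GrVect k where
  act : Aᵐᵒᵖ →ₐ[k] Module.End k carrier
  act_mem : ∀ i j, ∀ a ∈ 𝓐 i, ∀ n ∈ gr j, act (MulOpposite.op a) n ∈ gr (i + j)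

/-- A graded bimodule. -/
structure GrBimod (𝓐 : ℤ → Submodule k A) extends GrVect k where
  lact : A →ₐ[k] Module.End k carrier
  ract : Aᵐᵒᵖ →ₐ[k] Module.End k carrier
  lact_mem : ∀ i j, ∀ a ∈ 𝓐 i, ∀ x ∈ gr j, lact a x ∈ gr (i + j)
  ract_mem : ∀ i j, ∀ a ∈ 𝓐 i, ∀ x ∈ gr j, ract (MulOpposite.op a) x ∈ gr (i + j)
  lact_ract : ∀ a b x, lact a (ract b x) = ract b (lact a x)

variable {𝓐 : ℤ → Submodule k A}

/-- Homomorphisms of graded left modules (of degree `0`). -/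
@[ext]
structure GrLMod.Hom (M M' : GrLMod 𝓐) where
  lin : M.carrier →ₗ[k] M'.carrier
  map_gr : ∀ i, ∀ m ∈ M.gr i, lin m ∈ M'.gr i
  map_act : ∀ a m, lin (M.act a m) = M'.act a (lin m)

/-- Homomorphisms of graded right modules (of degree `0`). -/
@[ext]
structure GrRMod.Hom (N N' : GrRMod 𝓐) where
  lin : N.carrier →ₗ[k] N'.carrier
  map_gr : ∀ i, ∀ n ∈ N.gr i, lin n ∈ N'.gr i
  map_act : ∀ a n, lin (N.act a n) = N'.act a (lin n)

/-- Homomorphisms of graded bimodules (of degree `0`). -/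
@[ext]
structure GrBimod.Hom (B B' : GrBimod 𝓐) where
  lin : B.carrier →ₗ[k] B'.carrier
  map_gr : ∀ i, ∀ x ∈ B.gr i, lin x ∈ B'.gr i
  map_lact : ∀ a x, lin (B.lact a x) = B'.lact a (lin x)
  map_ract : ∀ a x, lin (B.ract a x) = B'.ract a (lin x)

instance : Category (GrLMod 𝓐) where
  Hom := GrLMod.Hom
  id M := ⟨LinearMap.id, fun _ _ h => h, fun _ _ => rfl⟩
  comp f g := ⟨g.lin ∘ₗ f.lin, fun i m h => g.map_gr i _ (f.map_gr i m h), fun a m => by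
    simp [f.map_act, g.map_act]⟩

instance : Category (GrRMod 𝓐) where
  Hom := GrRMod.Hom
  id M := ⟨LinearMap.id, fun _ _ h => h, fun _ _ => rfl⟩
  comp f g := ⟨g.lin ∘ₗ f.lin, fun i m h => g.map_gr i _ (f.map_gr i m h), fun a m => by
    simp [f.map_act, g.map_act]⟩

instance : Category (GrBimod 𝓐) where
  Hom := GrBimod.Hom
  id M := ⟨LinearMap.id, fun _ _ h => h, fun _ _ => rfl, fun _ _ => rfl⟩
  comp f g := ⟨g.lin ∘ₗ f.lin, fun i m h => g.map_gr i _ (f.map_gr i m h),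
    fun a m => by simp [f.map_lact, g.map_lact], fun a m => by simp [f.map_ract, g.map_ract]⟩

/-- The underlying vector space of a graded bimodule. -/
def GrBimod.forget (𝓐 : ℤ → Submodule k A) : GrBimod 𝓐 ⥤ ModuleCat.{u} k where
  obj B := ModuleCat.of k B.carrier
  map f := ModuleCat.ofHom f.lin

/-- The graded bimodule `M ⊗ N`, with `a (m ⊗ n) b = a m ⊗ n b`. -/
noncomputable def tensorBimod (M : GrLMod 𝓐) (N : GrRMod 𝓐) : GrBimod 𝓐 where
  carrier := M.carrier ⊗[k] N.carrier
  gr := tensorGr M.gr N.gr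
  isInternal := tensorGr_isInternal M.isInternal N.isInternal
  lact := (Module.End.rTensorAlgHom k M.carrier N.carrier).comp M.act
  ract := (Module.End.lTensorAlgHom k N.carrier M.carrier).comp N.act
  lact_mem i j a ha x hx := map_mem_tensorGr (a := i) (b := 0) (M.act_mem i · a ha)
    (fun l n hn => by simpa using hn) (by omega) hx
  ract_mem i j a ha x hx := map_mem_tensorGr (a := 0) (b := i)
    (fun l n hn => by simpa using hn) (N.act_mem i · a ha) (by omega) hx
  lact_ract a b x := by
    change (M.act a).rTensor _ ((N.act b).lTensor _ x) = (N.act b).lTensor _ ((M.act a).rTensor _ x)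
    rw [← LinearMap.comp_apply, LinearMap.rTensor_comp_lTensor, ← LinearMap.comp_apply,
      LinearMap.lTensor_comp_rTensor]

/-- The bimodule homomorphism `f ⊗ g`. -/
noncomputable def tensorBimodMap {M M' : GrLMod 𝓐} {N N' : GrRMod 𝓐} (f : M ⟶ M') (g : N ⟶ N') :
    tensorBimod M N ⟶ tensorBimod M' N' where
  lin := TensorProduct.map f.lin g.lin
  map_gr i x hx := map_mem_tensorGr (a := 0) (b := 0) (fun l m hm => by
    simpa using f.map_gr l m hm) (fun l n hn => by simpa using g.map_gr l n hn) (by omega) hx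
  map_lact a x := by
    have key : ∀ x, TensorProduct.map f.lin g.lin ((M.act a).rTensor N.carrier x) =
        (M'.act a).rTensor _ (TensorProduct.map f.lin g.lin x) := by
      intro x
      induction x with
      | zero => simp
      | add x y hx hy => simp only [map_add, hx, hy]
      | tmul m n => simp [f.map_act]
    exact key x
  map_ract a x := by
    have key : ∀ x, TensorProduct.map f.lin g.lin ((N.act a).lTensor M.carrier x) =
        (N'.act a).lTensor _ (TensorProduct.map f.lin g.lin x) := by
      intro x
      induction x with
      | zero => simp
      | add x y hx hy => simp only [map_add, hx, hy]
      | tmul m n => simp [g.map_act]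
    exact key x

end Modules

section Comodules

variable {C : Type u} [AddCommMonoid C] [Module k C] [Coalgebra k C]

/-- A graded right comodule over a graded coalgebra. -/
structure GrRComod (𝓒 : ℤ → Submodule k C) extends GrVect k where
  coact : carrier →ₗ[k] carrier ⊗[k] C
  coact_mem : ∀ i, ∀ m ∈ gr i, coact m ∈ tensorGr gr 𝓒 i
  coassoc : TensorProduct.assoc k carrier C C ∘ₗ coact.rTensor C ∘ₗ coact =
    (Coalgebra.comul (R := k) (A := C)).lTensor carrier ∘ₗ coact
  counit : (Coalgebra.counit (R := k) (A := C)).lTensor carrier ∘ₗ coact =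
    (TensorProduct.mk k carrier k).flip 1

/-- A graded left comodule over a graded coalgebra. -/
structure GrLComod (𝓒 : ℤ → Submodule k C) extends GrVect k where
  coact : carrier →ₗ[k] C ⊗[k] carrier
  coact_mem : ∀ i, ∀ n ∈ gr i, coact n ∈ tensorGr 𝓒 gr i
  coassoc : TensorProduct.assoc k C C carrier ∘ₗ
      (Coalgebra.comul (R := k) (A := C)).rTensor carrier ∘ₗ coact =
    coact.lTensor C ∘ₗ coact
  counit : (Coalgebra.counit (R := k) (A := C)).rTensor carrier ∘ₗ coact =
    TensorProduct.mk k k carrier 1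

variable {𝓒 : ℤ → Submodule k C}

/-- Homomorphisms of graded right comodules (of degree `0`). -/
@[ext]
structure GrRComod.Hom (X Y : GrRComod 𝓒) where
  lin : X.carrier →ₗ[k] Y.carrier
  map_gr : ∀ i, ∀ m ∈ X.gr i, lin m ∈ Y.gr i
  map_coact : ∀ m, Y.coact (lin m) = lin.rTensor C (X.coact m)

/-- Homomorphisms of graded left comodules (of degree `0`). -/
@[ext]
structure GrLComod.Hom (X Y : GrLComod 𝓒) where
  lin : X.carrier →ₗ[k] Y.carrier
  map_gr : ∀ i, ∀ m ∈ X.gr i, lin m ∈ Y.gr i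
  map_coact : ∀ m, Y.coact (lin m) = lin.lTensor C (X.coact m)

instance : Category (GrRComod 𝓒) where
  Hom := GrRComod.Hom
  id M := ⟨LinearMap.id, fun _ _ h => h, fun _ => by simp⟩
  comp f g := ⟨g.lin ∘ₗ f.lin, fun i m h => g.map_gr i _ (f.map_gr i m h), fun m => by
    rw [LinearMap.comp_apply, g.map_coact, f.map_coact, LinearMap.rTensor_comp_apply]⟩

instance : Category (GrLComod 𝓒) where
  Hom := GrLComod.Hom
  id M := ⟨LinearMap.id, fun _ _ h => h, fun _ => by simp⟩
  comp f g := ⟨g.lin ∘ₗ f.lin, fun i m h => g.map_gr i _ (f.map_gr i m h), fun m => by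
    rw [LinearMap.comp_apply, g.map_coact, f.map_coact, LinearMap.lTensor_comp_apply]⟩

/-- The underlying vector space of a graded right comodule. -/
def GrRComod.forget (𝓒 : ℤ → Submodule k C) : GrRComod 𝓒 ⥤ ModuleCat.{u} k where
  obj X := ModuleCat.of k X.carrier
  map f := ModuleCat.ofHom f.lin

/-- The underlying vector space of a graded left comodule. -/
def GrLComod.forget (𝓒 : ℤ → Submodule k C) : GrLComod 𝓒 ⥤ ModuleCat.{u} k where
  obj X := ModuleCat.of k X.carrier
  map f := ModuleCat.ofHom f.lin

/-- The map `φ(m ⊗ n) = Δ₁(m) ⊗ n - m ⊗ Δ₂(n)` whose kernel is the cotensor product. -/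
noncomputable def cotensorMap (X : GrRComod 𝓒) (Y : GrLComod 𝓒) :
    X.carrier ⊗[k] Y.carrier →ₗ[k] X.carrier ⊗[k] (C ⊗[k] Y.carrier) :=
  (TensorProduct.assoc k X.carrier C Y.carrier).toLinearMap ∘ₗ X.coact.rTensor Y.carrier -
    Y.coact.lTensor X.carrier

/-- The degree `p` part of the cotensor product `X □ Y`. -/
noncomputable def cotensorGr (X : GrRComod 𝓒) (Y : GrLComod 𝓒) (p : ℤ) :
    Submodule k (X.carrier ⊗[k] Y.carrier) :=
  LinearMap.ker (cotensorMap X Y) ⊓ tensorGr X.gr Y.gr p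

theorem map_mem_cotensorGr {X X' : GrRComod 𝓒} {Y Y' : GrLComod 𝓒} (f : X ⟶ X') (g : Y ⟶ Y')
    {p : ℤ} {t : X.carrier ⊗[k] Y.carrier} (ht : t ∈ cotensorGr X Y p) :
    TensorProduct.map f.lin g.lin t ∈ cotensorGr X' Y' p := by
  refine ⟨?_, map_mem_tensorGr (a := 0) (b := 0) (fun l m hm => by
    simpa using f.map_gr l m hm) (fun l n hn => by simpa using g.map_gr l n hn) (by omega) ht.2⟩
  have key : ∀ t, cotensorMap X' Y' (TensorProduct.map f.lin g.lin t) =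
      TensorProduct.map f.lin (g.lin.lTensor C) (cotensorMap X Y t) := by
    intro t
    induction t with
    | zero => simp
    | add x y hx hy => simp only [map_add, hx, hy]
    | tmul x y =>
      simp only [cotensorMap, TensorProduct.map_tmul, LinearMap.sub_apply, LinearMap.comp_apply,
        LinearEquiv.coe_coe, LinearMap.rTensor_tmul, LinearMap.lTensor_tmul, map_sub,
        f.map_coact, g.map_coact]
      congr 1
      generalize X.coact x = z
      induction z with
      | zero => simp
      | add x y hx hy => simp only [map_add, TensorProduct.add_tmul, hx, hy]
      | tmul x c => simp
  have h0 : cotensorMap X Y t = 0 := ht.1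
  change cotensorMap X' Y' _ = 0
  rw [key, h0, map_zero]

end Comodules

section ModComod

variable {A : Type u} [Ring A] [Algebra k A] {𝓐 : ℤ → Submodule k A}

theorem eventually_zero_of_isBddAbove {V : GrVect k} (hV : V.IsBddAbove)
    (φ : V.carrier →ₗ[k] A →ₗ[k] V.carrier)
    (hφ : ∀ i j, ∀ a ∈ 𝓐 i, ∀ v ∈ V.gr j, φ v a ∈ V.gr (i + j)) (v : V.carrier) :
    ∃ b : ℤ, ∀ i > b, ∀ a ∈ 𝓐 i, φ v a = 0 := by
  classical
  obtain ⟨b, hb⟩ := hV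
  let _ := V.isInternal.chooseDecomposition
  induction v using DirectSum.Decomposition.inductionOn V.gr with
  | zero => exact ⟨0, fun _ _ _ _ => by simp⟩
  | @homogeneous j v =>
    refine ⟨b - j, fun i hi a ha => ?_⟩
    have := hφ i j a ha v v.2
    rwa [hb _ (by omega), Submodule.mem_bot] at this
  | add x y hx hy =>
    obtain ⟨c, hc⟩ := hx
    obtain ⟨d, hd⟩ := hy
    refine ⟨max c d, fun i hi a ha => ?_⟩
    rw [map_add, LinearMap.add_apply, hc i (lt_of_le_of_lt (le_max_left _ _) hi) a ha,
      hd i (lt_of_le_of_lt (le_max_right _ _) hi) a ha, add_zero]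

variable [GradedAlgebra 𝓐] [PosFiniteType 𝓐]

/-- The right `DA`-comodule attached to a bounded-above graded left `A`-module: its coaction is
the map `Δ : M → M ⊗ DA` with `Δ(m)(a) = a m` under `M ⊗ DA ⊆ Hom(A, M)`. -/
noncomputable def GrLMod.toComod (M : GrLMod 𝓐) (hM : M.IsBddAbove) : GrRComod (dualGr 𝓐) where
  toGrVect := M.toGrVect
  coact := coactOf 𝓐 M.act.toLinearMap.flip
    (eventually_zero_of_isBddAbove hM _ M.act_mem)
  coact_mem i m hm := coactOf_mem 𝓐 _ (fun i j v hv a ha => M.act_mem i j a ha v hv) hm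
  coassoc := coactOf_coassoc 𝓐 _ fun v a b => by simp
  counit := coactOf_counit 𝓐 _ fun v => by simp

/-- A homomorphism of modules is a homomorphism of comodules. -/
noncomputable def GrLMod.toComodMap {M M' : GrLMod 𝓐} (hM : M.IsBddAbove) (hM' : M'.IsBddAbove)
    (f : M ⟶ M') : M.toComod hM ⟶ M'.toComod hM' where
  lin := f.lin
  map_gr := f.map_gr
  map_coact m := coactOf_map 𝓐 (eventually_zero_of_isBddAbove hM _ M.act_mem)
    (eventually_zero_of_isBddAbove hM' _ M'.act_mem) f.lin (fun v a => f.map_act a v) m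

/-- The left `DA`-comodule attached to a bounded-above graded right `A`-module: its coaction is
the map `Δ : N → DA ⊗ N` with `Δ(n)(a) = n a` under `DA ⊗ N ⊆ Hom(A, N)`. -/
noncomputable def GrRMod.toComod (N : GrRMod 𝓐) (hN : N.IsBddAbove) : GrLComod (dualGr 𝓐) where
  toGrVect := N.toGrVect
  coact := (TensorProduct.comm k N.carrier (grDual 𝓐)).toLinearMap ∘ₗ
    coactOf 𝓐 (N.act.toLinearMap ∘ₗ (MulOpposite.opLinearEquiv k).toLinearMap).flip
      (eventually_zero_of_isBddAbove hN _ N.act_mem)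
  coact_mem i n hn := comm_mem_tensorGr
    (coactOf_mem 𝓐 _ (fun i j v hv a ha => N.act_mem i j a ha v hv) hn)
  coassoc := coactOf_coassoc_left 𝓐 _ fun v a b => by simp
  counit := coactOf_counit_left 𝓐 _ fun v => by simp

/-- A homomorphism of modules is a homomorphism of comodules. -/
noncomputable def GrRMod.toComodMap {N N' : GrRMod 𝓐} (hN : N.IsBddAbove) (hN' : N'.IsBddAbove)
    (g : N ⟶ N') : N.toComod hN ⟶ N'.toComod hN' where
  lin := g.lin
  map_gr := g.map_gr
  map_coact n := coactOf_map_left 𝓐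
    (eventually_zero_of_isBddAbove hN _ N.act_mem)
    (eventually_zero_of_isBddAbove hN' _ N'.act_mem) g.lin (fun v a => g.map_act (MulOpposite.op a) v) n

end ModComod

end Objects

section Resolutions

variable {k : Type u} [Field k]

/-- An object `I` of a category `𝒟` of vector spaces with additional structure is injective if
every morphism `X ⟶ I` extends along every injective morphism `X ⟶ Y`. -/
def IsInjectiveObj {𝒟 : Type (u + 1)} [Category.{u} 𝒟] (F : 𝒟 ⥤ ModuleCat.{u} k) (I : 𝒟) : Prop :=
  ∀ ⦃X Y : 𝒟⦄ (i : X ⟶ Y) (f : X ⟶ I), Function.Injective (F.map i) → ∃ g : Y ⟶ I, i ≫ g = f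

/-- An injective resolution `0 → M → I⁰ → I¹ → ⋯`. -/
structure InjRes {𝒟 : Type (u + 1)} [Category.{u} 𝒟] (F : 𝒟 ⥤ ModuleCat.{u} k) (M : 𝒟) where
  obj : ℕ → 𝒟
  d : ∀ n, obj n ⟶ obj (n + 1)
  ι : M ⟶ obj 0
  isInjective : ∀ n, IsInjectiveObj F (obj n)
  ι_injective : Function.Injective (F.map ι)
  exact_zero : Function.Exact (F.map ι) (F.map (d 0))
  exact_succ : ∀ n, Function.Exact (F.map (d n)) (F.map (d (n + 1)))

/-- A morphism of resolutions lifting a morphism `f`. -/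
structure InjRes.Lift {𝒟 : Type (u + 1)} [Category.{u} 𝒟] {F : 𝒟 ⥤ ModuleCat.{u} k} {M M' : 𝒟}
    (I : InjRes F M) (I' : InjRes F M') (f : M ⟶ M') where
  app : ∀ n, I.obj n ⟶ I'.obj n
  comm : ∀ n, I.d n ≫ app (n + 1) = app n ≫ I'.d n
  aug : I.ι ≫ app 0 = f ≫ I'.ι

section Cotor

variable {C : Type u} [AddCommMonoid C] [Module k C] [Coalgebra k C] {𝓒 : ℤ → Submodule k C}
variable {M M' : GrRComod 𝓒} {N N' : GrLComod 𝓒}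

/-- The degree `p` part of `⨁_{r + s = n} I^r □ J^s`, realised inside `∏ I^r ⊗ J^s`. -/
noncomputable def totCotensor (I : InjRes (GrRComod.forget 𝓒) M) (J : InjRes (GrLComod.forget 𝓒) N)
    (p : ℤ) (n : ℕ) : Submodule k (∀ r s : ℕ, (I.obj r).carrier ⊗[k] (J.obj s).carrier) where
  carrier := {x | (∀ r s, x r s ∈ cotensorGr (I.obj r) (J.obj s) p) ∧
    ∀ r s, r + s ≠ n → x r s = 0}
  add_mem' hx hy := ⟨fun r s => add_mem (hx.1 r s) (hy.1 r s), fun r s h => by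
    simp [hx.2 r s h, hy.2 r s h]⟩
  zero_mem' := ⟨fun _ _ => zero_mem _, fun _ _ _ => rfl⟩
  smul_mem' c x hx := ⟨fun r s => Submodule.smul_mem _ c (hx.1 r s), fun r s h => by
    simp [hx.2 r s h]⟩

/-- The total differential: on `I^r ⊗ J^s` it is `d ⊗ 1 + (-1)^r (1 ⊗ d)`. -/
noncomputable def totD (I : InjRes (GrRComod.forget 𝓒) M) (J : InjRes (GrLComod.forget 𝓒) N) :
    (∀ r s : ℕ, (I.obj r).carrier ⊗[k] (J.obj s).carrier) →ₗ[k]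
      ∀ r s : ℕ, (I.obj r).carrier ⊗[k] (J.obj s).carrier :=
  LinearMap.pi fun r => LinearMap.pi fun s =>
    (match r with
      | 0 => 0
      | r + 1 => (I.d r).lin.rTensor _ ∘ₗ LinearMap.proj s ∘ₗ LinearMap.proj r) +
    (match s with
      | 0 => 0
      | s + 1 => (-1 : k) ^ r • ((J.d s).lin.lTensor _ ∘ₗ LinearMap.proj s ∘ₗ LinearMap.proj r))

theorem InjRes.d_lin_right (I : InjRes (GrRComod.forget 𝓒) M) (r : ℕ) (x : (I.obj r).carrier) :
    (I.d (r + 1)).lin ((I.d r).lin x) = 0 :=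
  (I.exact_succ r).apply_apply_eq_zero x

theorem InjRes.d_lin_left (J : InjRes (GrLComod.forget 𝓒) N) (s : ℕ) (x : (J.obj s).carrier) :
    (J.d (s + 1)).lin ((J.d s).lin x) = 0 :=
  (J.exact_succ s).apply_apply_eq_zero x

theorem totD_totD (I : InjRes (GrRComod.forget 𝓒) M) (J : InjRes (GrLComod.forget 𝓒) N)
    (x : ∀ r s : ℕ, (I.obj r).carrier ⊗[k] (J.obj s).carrier) : totD I J (totD I J x) = 0 := by
  have h1 : ∀ r, (I.d (r + 1)).lin ∘ₗ (I.d r).lin = 0 := fun r =>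
    LinearMap.ext (I.d_lin_right r)
  have h2 : ∀ s, (J.d (s + 1)).lin ∘ₗ (J.d s).lin = 0 := fun s =>
    LinearMap.ext (J.d_lin_left s)
  have h1' : ∀ r s (t : (I.obj r).carrier ⊗[k] (J.obj s).carrier),
      (I.d (r + 1)).lin.rTensor _ ((I.d r).lin.rTensor _ t) = 0 := fun r s t => by
    rw [← LinearMap.rTensor_comp_apply, h1]; simp
  have h2' : ∀ r s (t : (I.obj r).carrier ⊗[k] (J.obj s).carrier),
      (J.d (s + 1)).lin.lTensor _ ((J.d s).lin.lTensor _ t) = 0 := fun r s t => by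
    rw [← LinearMap.lTensor_comp_apply, h2]; simp
  have h3 : ∀ r s (t : (I.obj r).carrier ⊗[k] (J.obj s).carrier),
      (J.d s).lin.lTensor _ ((I.d r).lin.rTensor _ t) =
        (I.d r).lin.rTensor _ ((J.d s).lin.lTensor _ t) := fun r s t => by
    rw [← LinearMap.comp_apply, LinearMap.lTensor_comp_rTensor, ← LinearMap.comp_apply,
      LinearMap.rTensor_comp_lTensor]
  funext r s
  rcases r with _ | _ | r <;> rcases s with _ | _ | s <;>
    simp [totD, h1', h2', h3, pow_succ]

theorem totD_mem {I : InjRes (GrRComod.forget 𝓒) M} {J : InjRes (GrLComod.forget 𝓒) N}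
    {p : ℤ} {n : ℕ} {x : ∀ r s : ℕ, (I.obj r).carrier ⊗[k] (J.obj s).carrier}
    (hx : x ∈ totCotensor I J p n) : totD I J x ∈ totCotensor I J p (n + 1) := by
  have hd : ∀ r s, (I.d r).lin.rTensor _ (x r s) ∈ cotensorGr (I.obj (r + 1)) (J.obj s) p :=
    fun r s => map_mem_cotensorGr (I.d r) (𝟙 (J.obj s)) (hx.1 r s)
  have hd' : ∀ r s, (J.d s).lin.lTensor _ (x r s) ∈ cotensorGr (I.obj r) (J.obj (s + 1)) p :=
    fun r s => map_mem_cotensorGr (𝟙 (I.obj r)) (J.d s) (hx.1 r s)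
  constructor
  · intro r s
    rcases r with _ | r <;> rcases s with _ | s <;>
      simp only [totD, LinearMap.pi_apply, LinearMap.add_apply, LinearMap.zero_apply,
        LinearMap.comp_apply, LinearMap.proj_apply, LinearMap.smul_apply, add_zero, zero_add]
    · exact zero_mem _
    · exact Submodule.smul_mem _ _ (hd' _ _)
    · exact hd _ _
    · exact add_mem (hd _ _) (Submodule.smul_mem _ _ (hd' _ _))
  · intro r s hrs
    rcases r with _ | r <;> rcases s with _ | s <;>
      simp only [totD, LinearMap.pi_apply, LinearMap.add_apply, LinearMap.zero_apply,
        LinearMap.comp_apply, LinearMap.proj_apply, LinearMap.smul_apply, add_zero, zero_add]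
    · rw [hx.2 0 s (by omega)]; simp
    · rw [hx.2 r 0 (by omega)]; simp
    · rw [hx.2 (r + 1) s (by omega), hx.2 r (s + 1) (by omega)]; simp

/-- The degree `p` part of the total complex of `I^* □ J^*`. -/
noncomputable def cotensorComplex (I : InjRes (GrRComod.forget 𝓒) M)
    (J : InjRes (GrLComod.forget 𝓒) N) (p : ℤ) : CochainComplex (ModuleCat.{u} k) ℕ :=
  CochainComplex.of (fun n => ModuleCat.of k (totCotensor I J p n))
    (fun _ => ModuleCat.ofHom ((totD I J).restrict fun _ hx => totD_mem hx))
    (fun n => by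
      refine ModuleCat.hom_ext (LinearMap.ext fun x => Subtype.ext ?_)
      exact totD_totD I J x.1)

/-- `Cotor_C^n(M, N) = H^n(I^* □ J^*)`, a graded vector space, computed from
injective resolutions `I^*` of `M` and `J^*` of `N` by graded comodules. -/
noncomputable def Cotor (I : InjRes (GrRComod.forget 𝓒) M) (J : InjRes (GrLComod.forget 𝓒) N)
    (n : ℕ) : GradedObject ℤ (ModuleCat.{u} k) :=
  fun p => (cotensorComplex I J p).homology n

variable {I : InjRes (GrRComod.forget 𝓒) M} {J : InjRes (GrLComod.forget 𝓒) N}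
  {I' : InjRes (GrRComod.forget 𝓒) M'} {J' : InjRes (GrLComod.forget 𝓒) N'}
  {f : M ⟶ M'} {g : N ⟶ N'}

/-- The map `φ ⊗ ψ` on total complexes. -/
noncomputable def totMap (φ : I.Lift I' f) (ψ : J.Lift J' g) :
    (∀ r s : ℕ, (I.obj r).carrier ⊗[k] (J.obj s).carrier) →ₗ[k]
      ∀ r s : ℕ, (I'.obj r).carrier ⊗[k] (J'.obj s).carrier :=
  LinearMap.pi fun r => LinearMap.pi fun s =>
    TensorProduct.map (φ.app r).lin (ψ.app s).lin ∘ₗ LinearMap.proj s ∘ₗ LinearMap.proj r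

theorem totMap_mem (φ : I.Lift I' f) (ψ : J.Lift J' g) {p : ℤ} {n : ℕ}
    {x : ∀ r s : ℕ, (I.obj r).carrier ⊗[k] (J.obj s).carrier}
    (hx : x ∈ totCotensor I J p n) : totMap φ ψ x ∈ totCotensor I' J' p n :=
  ⟨fun r s => map_mem_cotensorGr (φ.app r) (ψ.app s) (hx.1 r s), fun r s h => by
    simp [totMap, hx.2 r s h]⟩

theorem totMap_totD (φ : I.Lift I' f) (ψ : J.Lift J' g)
    (x : ∀ r s : ℕ, (I.obj r).carrier ⊗[k] (J.obj s).carrier) :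
    totMap φ ψ (totD I J x) = totD I' J' (totMap φ ψ x) := by
  have h1 : ∀ r s (t : (I.obj r).carrier ⊗[k] (J.obj s).carrier),
      TensorProduct.map (φ.app (r + 1)).lin (ψ.app s).lin ((I.d r).lin.rTensor _ t) =
        (I'.d r).lin.rTensor _ (TensorProduct.map (φ.app r).lin (ψ.app s).lin t) := by
    intro r s t
    have h : (φ.app (r + 1)).lin ∘ₗ (I.d r).lin = (I'.d r).lin ∘ₗ (φ.app r).lin :=
      congrArg GrRComod.Hom.lin (φ.comm r)
    induction t with
    | zero => simp
    | add x y hx hy => simp only [map_add, hx, hy]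
    | tmul a b =>
      simp only [LinearMap.rTensor_tmul, TensorProduct.map_tmul]
      exact congrArg (· ⊗ₜ[k] _) (LinearMap.congr_fun h a)
  have h2 : ∀ r s (t : (I.obj r).carrier ⊗[k] (J.obj s).carrier),
      TensorProduct.map (φ.app r).lin (ψ.app (s + 1)).lin ((J.d s).lin.lTensor _ t) =
        (J'.d s).lin.lTensor _ (TensorProduct.map (φ.app r).lin (ψ.app s).lin t) := by
    intro r s t
    have h : (ψ.app (s + 1)).lin ∘ₗ (J.d s).lin = (J'.d s).lin ∘ₗ (ψ.app s).lin :=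
      congrArg GrLComod.Hom.lin (ψ.comm s)
    induction t with
    | zero => simp
    | add x y hx hy => simp only [map_add, hx, hy]
    | tmul a b =>
      simp only [LinearMap.lTensor_tmul, TensorProduct.map_tmul]
      exact congrArg (_ ⊗ₜ[k] ·) (LinearMap.congr_fun h b)
  funext r s
  rcases r with _ | r <;> rcases s with _ | s <;> simp [totD, totMap, h1, h2]

/-- The morphism of complexes induced by morphisms of resolutions. -/
noncomputable def cotensorComplexMap (φ : I.Lift I' f) (ψ : J.Lift J' g) (p : ℤ) :
    cotensorComplex I J p ⟶ cotensorComplex I' J' p :=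
  CochainComplex.ofHom
    (fun _ => ModuleCat.ofHom ((totMap φ ψ).restrict fun _ hx => totMap_mem φ ψ hx))
    (fun n => by
      simp only [cotensorComplex, CochainComplex.of_d]
      refine ModuleCat.hom_ext (LinearMap.ext fun x => Subtype.ext ?_)
      exact (totMap_totD φ ψ x.1).symm)

/-- Functoriality of `Cotor`. -/
noncomputable def Cotor.map (φ : I.Lift I' f) (ψ : J.Lift J' g) (n : ℕ) :
    Cotor I J n ⟶ Cotor I' J' n :=
  fun p => HomologicalComplex.homologyMap (cotensorComplexMap φ ψ p) n

end Cotor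

section Hochschild

variable {A : Type u} [Ring A] [Algebra k A] {𝓐 : ℤ → Submodule k A}

/-- The degree `p` part of `hom_{A^e}(A, B)`: the linear maps `f : A → B` of degree `p` that are
right linear and satisfy `f(a x) = ε^{p |a|} a f(x)`. With `ε = -1` this is the Koszul sign
convention, with `ε = 1` these are the plain bimodule maps. -/
noncomputable def bimodHom (ε : ℤˣ) (p : ℤ) (B : GrBimod 𝓐) : Submodule k (A →ₗ[k] B.carrier) where
  carrier := {f | (∀ i, ∀ a ∈ 𝓐 i, f a ∈ B.gr (i + p)) ∧
    (∀ i, ∀ a ∈ 𝓐 i, ∀ x, f (a * x) = ε ^ (p * i) • B.lact a (f x)) ∧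
    ∀ x a, f (x * a) = B.ract (MulOpposite.op a) (f x)}
  add_mem' hf hg := ⟨fun i a ha => add_mem (hf.1 i a ha) (hg.1 i a ha),
    fun i a ha x => by simp [hf.2.1 i a ha x, hg.2.1 i a ha x],
    fun x a => by simp [hf.2.2 x a, hg.2.2 x a]⟩
  zero_mem' := ⟨fun _ _ _ => zero_mem _, fun _ _ _ _ => by simp, fun _ _ => by simp⟩
  smul_mem' c f hf := ⟨fun i a ha => Submodule.smul_mem _ c (hf.1 i a ha),
    fun i a ha x => by simp [hf.2.1 i a ha x, smul_comm c],
    fun x a => by simp [hf.2.2 x a]⟩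

theorem comp_mem_bimodHom {ε : ℤˣ} {p : ℤ} {B B' : GrBimod 𝓐} (h : B ⟶ B')
    {f : A →ₗ[k] B.carrier} (hf : f ∈ bimodHom ε p B) : h.lin ∘ₗ f ∈ bimodHom ε p B' :=
  ⟨fun i a ha => h.map_gr _ _ (hf.1 i a ha),
    fun i a ha x => by
      rw [LinearMap.comp_apply, hf.2.1 i a ha x, Units.smul_def, map_zsmul, h.map_lact,
        ← Units.smul_def, LinearMap.comp_apply],
    fun x a => by rw [LinearMap.comp_apply, hf.2.2 x a, h.map_ract, LinearMap.comp_apply]⟩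

/-- Post-composition with a bimodule homomorphism. -/
noncomputable def bimodHomMap (ε : ℤˣ) (p : ℤ) {B B' : GrBimod 𝓐} (h : B ⟶ B') :
    bimodHom ε p B →ₗ[k] bimodHom ε p B' :=
  (LinearMap.compRight k h.lin).restrict fun _ hf => comp_mem_bimodHom h hf

variable {B B' : GrBimod 𝓐}

/-- The degree `p` part of the complex `hom_{A^e}(A, E^*)`. -/
noncomputable def bimodHomComplex (ε : ℤˣ) (E : InjRes (GrBimod.forget 𝓐) B) (p : ℤ) :
    CochainComplex (ModuleCat.{u} k) ℕ :=
  CochainComplex.of (fun n => ModuleCat.of k (bimodHom ε p (E.obj n)))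
    (fun n => ModuleCat.ofHom (bimodHomMap ε p (E.d n)))
    (fun n => by
      refine ModuleCat.hom_ext (LinearMap.ext fun f => Subtype.ext (LinearMap.ext fun a => ?_))
      exact (E.exact_succ n).apply_apply_eq_zero (f.1 a))

/-- Graded Hochschild cohomology `H_gr^n(A, B) = H^n(hom_{A^e}(A, E^*))`, a graded vector space,
computed from an injective resolution `E^*` of `B` by graded bimodules. -/
noncomputable def HochGr (ε : ℤˣ) (E : InjRes (GrBimod.forget 𝓐) B) (n : ℕ) :
    GradedObject ℤ (ModuleCat.{u} k) :=
  fun p => (bimodHomComplex ε E p).homology n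

variable {E : InjRes (GrBimod.forget 𝓐) B} {E' : InjRes (GrBimod.forget 𝓐) B'} {h : B ⟶ B'}

/-- The morphism of complexes induced by a morphism of resolutions. -/
noncomputable def bimodHomComplexMap (ε : ℤˣ) (χ : E.Lift E' h) (p : ℤ) :
    bimodHomComplex ε E p ⟶ bimodHomComplex ε E' p :=
  CochainComplex.ofHom (fun n => ModuleCat.ofHom (bimodHomMap ε p (χ.app n)))
    (fun n => by
      simp only [bimodHomComplex, CochainComplex.of_d]
      refine ModuleCat.hom_ext (LinearMap.ext fun f => Subtype.ext (LinearMap.ext fun a => ?_))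
      exact (LinearMap.congr_fun (congrArg GrBimod.Hom.lin (χ.comm n)) (f.1 a)).symm)

/-- Functoriality of graded Hochschild cohomology in the coefficients. -/
noncomputable def HochGr.map (ε : ℤˣ) (χ : E.Lift E' h) (n : ℕ) : HochGr ε E n ⟶ HochGr ε E' n :=
  fun p => HomologicalComplex.homologyMap (bimodHomComplexMap ε χ p) n

end Hochschild

end Resolutions

end GrCotor

/-! Write C for the graded dual of A. Since X ⊗ C embeds in Hom(A, X), a graded right C-comodule is
a graded left A-module, bounded above or not, and a left comodule is a right module. So for a right
comodule X and a left comodule Y the space X ⊗ Y is a graded bimodule, and both sides of the theorem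
can be read off from it.

On one side, X ⊗ C ⊗ Y embeds in Hom(A, X ⊗ Y) by evaluating the middle factor, and the map defining
the cotensor product becomes t ↦ (a ↦ at - ta). Hence X □ Y is the space of central elements of X ⊗
Y (`mem_cotensorGr_iff`). On the other side, an element f of hom_{A^e}(A, B) is determined by f(1).
Without signs f(1) is an arbitrary central element. With Koszul signs it is central up to a sign,
and multiplying m ⊗ n by ε^{p|m|} removes that sign (`GrBimod.Twist.toHom_surjective`). Together
these identify the complex I □ J with hom_{A^e}(A, I ⊗ J), for all resolutions I and J
(`cotensorToHomComplex_isIso`).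

Over a field, I ⊗ J is a resolution of M ⊗ N by graded bimodules (`totRes`). It remains to know that
it computes Hochschild cohomology. If I^r = V ⊗ C and J^s = C ⊗ W with V and W bounded above, then
the homogeneous elements of I^r ⊗ J^s are exactly the homogeneous bilinear maps A × A → V ⊗ W.
Boundedness and finite type make these finite sums of tensors (`exists_biEval_eq`). So I^r ⊗ J^s is
coinduced from V ⊗ W: bimodule homomorphisms into it are linear maps of degree 0 into V ⊗ W, and
those always extend (`isInjectiveObj_comodBimod_cofree`). Resolutions of this kind exist because
cofree comodules on bounded-above spaces, and their quotients, are again bounded above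
(`GrRComod.exists_cofree_injRes`, `GrLComod.exists_cofree_injRes`).

For arbitrary I, J and E, injectivity of the terms of I ⊗ J is not available. But lifting a morphism
from a resolution to E, uniquely up to homotopy, only needs E to be injective (`Res.exists_lift`,
`Res.Lift.exists_homotopy`). This gives a canonical `comparison` map, which is natural because it
does not depend on the lift (`comparison_eq`). It is an isomorphism because I and J can be replaced
by cofree resolutions without changing Cotor (`Cotor.map_eq`, `comparison_isIso`). -/

namespace GrCotor

/-! ### Resolutions, lifts and homotopies in categories of vector spaces with extra structure. -/

section Generic

variable {k : Type u} [Field k] {𝒟 : Type (u + 1)} [Category.{u} 𝒟]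

/-- The linear map underlying a morphism. -/
abbrev undl (F : 𝒟 ⥤ ModuleCat.{u} k) {X Y : 𝒟} (f : X ⟶ Y) : F.obj X →ₗ[k] F.obj Y :=
  (F.map f).hom

theorem undl_comp (F : 𝒟 ⥤ ModuleCat.{u} k) {X Y Z : 𝒟} (f : X ⟶ Y) (g : Y ⟶ Z) :
    undl F (f ≫ g) = undl F g ∘ₗ undl F f := by
  simp [undl]

theorem undl_comp_apply (F : 𝒟 ⥤ ModuleCat.{u} k) {X Y Z : 𝒟} (f : X ⟶ Y) (g : Y ⟶ Z)
    (x : F.obj X) : undl F (f ≫ g) x = undl F g (undl F f x) := by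
  simp [undl]

/-- A category of vector spaces with additional structure in which the elementary constructions of
homological algebra are available. -/
class HomalgCat (F : 𝒟 ⥤ ModuleCat.{u} k) : Prop where
  exists_sub : ∀ {X Y : 𝒟} (f g : X ⟶ Y), ∃ h : X ⟶ Y, undl F h = undl F f - undl F g
  exists_coimage : ∀ {X Y : 𝒟} (d : X ⟶ Y), ∃ (Q : 𝒟) (p : X ⟶ Q),
    Function.Surjective (undl F p) ∧ LinearMap.ker (undl F p) = LinearMap.ker (undl F d)
  exists_coker : ∀ {X Y : 𝒟} (d : X ⟶ Y), ∃ (Q : 𝒟) (p : Y ⟶ Q),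
    Function.Surjective (undl F p) ∧ LinearMap.ker (undl F p) = LinearMap.range (undl F d)
  exists_factor : ∀ {X Q Z : 𝒟} (p : X ⟶ Q) (g : X ⟶ Z), Function.Surjective (undl F p) →
    LinearMap.ker (undl F p) ≤ LinearMap.ker (undl F g) → ∃ h : Q ⟶ Z, p ≫ h = g

variable {F : 𝒟 ⥤ ModuleCat.{u} k}

/-- Both morphisms factor through the coimage of `d`, which embeds in `Y`; injectivity of `Z`
applies to that embedding. In this form it produces each component of a lift or a homotopy. -/
theorem IsInjectiveObj.exists_extend [HomalgCat F] {X Y Z : 𝒟} (hZ : IsInjectiveObj F Z)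
    (d : X ⟶ Y) (g : X ⟶ Z) (h : ∀ x, undl F d x = 0 → undl F g x = 0) :
    ∃ e : Y ⟶ Z, d ≫ e = g := by
  obtain ⟨Q, p, hp, hker⟩ := HomalgCat.exists_coimage (F := F) d
  obtain ⟨i, rfl⟩ := HomalgCat.exists_factor p d hp hker.le
  obtain ⟨g, rfl⟩ := HomalgCat.exists_factor (F := F) p g hp (hker.le.trans fun x hx => h x hx)
  have hi : Function.Injective (undl F i) := by
    rw [injective_iff_map_eq_zero]
    intro q hq
    obtain ⟨x, rfl⟩ := hp q
    rw [← undl_comp_apply, ← LinearMap.mem_ker, ← hker] at hq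
    exact hq
  obtain ⟨e, rfl⟩ := hZ i g hi
  exact ⟨e, Category.assoc _ _ _⟩

/-- A resolution `0 → M → I⁰ → I¹ → ⋯` by arbitrary objects. -/
structure Res (F : 𝒟 ⥤ ModuleCat.{u} k) (M : 𝒟) where
  obj : ℕ → 𝒟
  d : ∀ n, obj n ⟶ obj (n + 1)
  ι : M ⟶ obj 0
  ι_injective : Function.Injective (undl F ι)
  exact_zero : Function.Exact (undl F ι) (undl F (d 0))
  exact_succ : ∀ n, Function.Exact (undl F (d n)) (undl F (d (n + 1)))

/-- The resolution underlying an injective resolution. -/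
def InjRes.toRes {M : 𝒟} (I : InjRes F M) : Res F M where
  obj := I.obj
  d := I.d
  ι := I.ι
  ι_injective := I.ι_injective
  exact_zero := I.exact_zero
  exact_succ := I.exact_succ

/-- A resolution by injective objects. -/
def Res.toInjRes {M : 𝒟} (I : Res F M) (h : ∀ n, IsInjectiveObj F (I.obj n)) : InjRes F M where
  obj := I.obj
  d := I.d
  ι := I.ι
  isInjective := h
  ι_injective := I.ι_injective
  exact_zero := I.exact_zero
  exact_succ := I.exact_succ

/-- A morphism from a resolution to an injective resolution lifting `f`. -/
structure Res.Lift {M M' : 𝒟} (I : Res F M) (I' : InjRes F M') (f : M ⟶ M') where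
  app : ∀ n, I.obj n ⟶ I'.obj n
  comm : ∀ n, I.d n ≫ app (n + 1) = app n ≫ I'.d n
  aug : I.ι ≫ app 0 = f ≫ I'.ι

/-- Dependent recursion for lifts and homotopies: `ok` is the invariant that makes the next step
possible, and `R` is the relation between consecutive terms that is wanted in the end. -/
theorem exists_seq {P : ℕ → Type*} (ok : ∀ n, P n → Prop) (R : ∀ n, P n → P (n + 1) → Prop)
    (A : P 0 → Prop) (zero : ∃ x, ok 0 x ∧ A x)
    (succ : ∀ n x, ok n x → ∃ y, ok (n + 1) y ∧ R n x y) :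
    ∃ s : ∀ n, P n, A (s 0) ∧ ∀ n, R n (s n) (s (n + 1)) := by
  choose f hf hR using succ
  obtain ⟨x, hx, hA⟩ := zero
  let s : ∀ n, {x : P n // ok n x} := fun n =>
    Nat.rec ⟨x, hx⟩ (fun n y => ⟨f n y.1 y.2, hf n y.1 y.2⟩) n
  exact ⟨fun n => (s n).1, hA, fun n => hR n (s n).1 (s n).2⟩

/-- Only the target has to be injective. The invariant of the recursion is that φ followed by the
differential of `I'` vanishes on the kernel of the differential of `I`, which is what the next
extension requires. -/
theorem Res.exists_lift [HomalgCat F] {M M' : 𝒟} (I : Res F M) (I' : InjRes F M') (f : M ⟶ M') :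
    Nonempty (I.Lift I' f) := by
  have zero : ∃ φ : I.obj 0 ⟶ I'.obj 0, I.ι ≫ φ = f ≫ I'.ι :=
    (I'.isInjective 0).exists_extend _ _ fun x hx => by
      rw [(injective_iff_map_eq_zero _).mp I.ι_injective x hx, map_zero]
  obtain ⟨s, h0, hs⟩ := exists_seq (P := fun n => I.obj n ⟶ I'.obj n)
    (ok := fun n φ => ∀ x, undl F (I.d n) x = 0 → undl F (I'.d n) (undl F φ x) = 0)
    (R := fun n φ φ' => I.d n ≫ φ' = φ ≫ I'.d n) (A := fun φ => I.ι ≫ φ = f ≫ I'.ι)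
    (by
      obtain ⟨φ, hφ⟩ := zero
      refine ⟨φ, fun x hx => ?_, hφ⟩
      obtain ⟨m, rfl⟩ := (I.exact_zero x).mp hx
      rw [← undl_comp_apply F I.ι φ, hφ, undl_comp_apply]
      exact I'.exact_zero.apply_apply_eq_zero _)
    (by
      intro n φ hφ
      obtain ⟨φ', h'⟩ := (I'.isInjective (n + 1)).exists_extend (I.d n) (φ ≫ I'.d n) fun x hx => by
        rw [undl_comp_apply, hφ x hx]
      refine ⟨φ', fun x hx => ?_, h'⟩
      obtain ⟨y, rfl⟩ := (I.exact_succ n x).mp hx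
      rw [← undl_comp_apply F (I.d n) φ', h', undl_comp_apply]
      exact (I'.exact_succ n).apply_apply_eq_zero _)
  exact ⟨⟨s, hs, h0⟩⟩

/-- Let δ be the difference of the two lifts. It kills the image of the augmentation, since both
lift `f`, and this gives `h 0`. Afterwards δ - d'h vanishes on the image of d, that is on the kernel
of the next d, and so extends along that next d. -/
theorem Res.Lift.exists_homotopy [HomalgCat F] {M M' : 𝒟} {I : Res F M} {I' : InjRes F M'}
    {f : M ⟶ M'} (φ φ' : I.Lift I' f) :
    ∃ h : ∀ n, I.obj (n + 1) ⟶ I'.obj n,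
      (undl F (φ.app 0) = undl F (h 0) ∘ₗ undl F (I.d 0) + undl F (φ'.app 0)) ∧
      ∀ n, undl F (φ.app (n + 1)) = undl F (I'.d n) ∘ₗ undl F (h n) +
        undl F (h (n + 1)) ∘ₗ undl F (I.d (n + 1)) + undl F (φ'.app (n + 1)) := by
  choose δ hδ using fun n => HomalgCat.exists_sub (F := F) (φ.app n) (φ'.app n)
  have hcomm : ∀ (ψ : I.Lift I' f) n x, undl F (ψ.app (n + 1)) (undl F (I.d n) x) =
      undl F (I'.d n) (undl F (ψ.app n) x) := fun ψ n x => by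
    rw [← undl_comp_apply, ψ.comm, undl_comp_apply]
  have hδ' : ∀ n x, undl F (δ (n + 1)) (undl F (I.d n) x) =
      undl F (I'.d n) (undl F (δ n) x) := fun n x => by
    rw [hδ, hδ, LinearMap.sub_apply, LinearMap.sub_apply, hcomm, hcomm, map_sub]
  have hδ0 : ∀ x, undl F (I.d 0) x = 0 → undl F (δ 0) x = 0 := fun x hx => by
    obtain ⟨m, rfl⟩ := (I.exact_zero x).mp hx
    rw [hδ, LinearMap.sub_apply, ← undl_comp_apply, ← undl_comp_apply, φ.aug, φ'.aug, sub_self]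
  obtain ⟨s, h0, hs⟩ := exists_seq (P := fun n => I.obj (n + 1) ⟶ I'.obj n)
    (ok := fun n h => ∀ x, undl F (I'.d n) (undl F h (undl F (I.d n) x)) =
        undl F (δ (n + 1)) (undl F (I.d n) x)) (A := fun h => I.d 0 ≫ h = δ 0)
    (R := fun n h h' => ∀ x, undl F (δ (n + 1)) x = undl F (I'.d n) (undl F h x) +
      undl F h' (undl F (I.d (n + 1)) x))
    (by
      obtain ⟨h, hh⟩ := (I'.isInjective 0).exists_extend (I.d 0) (δ 0) hδ0
      refine ⟨h, fun x => ?_, hh⟩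
      rw [← undl_comp_apply F (I.d 0) h, hh, hδ'])
    (by
      intro n h hh
      obtain ⟨γ, hγ⟩ := HomalgCat.exists_sub (F := F) (δ (n + 1)) (h ≫ I'.d n)
      have hγ' : ∀ x, undl F γ x =
          undl F (δ (n + 1)) x - undl F (I'.d n) (undl F h x) := fun x => by
        rw [hγ, LinearMap.sub_apply, undl_comp_apply]
      obtain ⟨h', hh'⟩ := (I'.isInjective (n + 1)).exists_extend (I.d (n + 1)) γ fun x hx => by
        obtain ⟨y, rfl⟩ := (I.exact_succ n x).mp hx
        rw [hγ', hh, sub_self]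
      have hR : ∀ x, undl F h' (undl F (I.d (n + 1)) x) =
          undl F (δ (n + 1)) x - undl F (I'.d n) (undl F h x) := fun x => by
        rw [← undl_comp_apply, hh', hγ']
      refine ⟨h', fun x => ?_, fun x => by rw [hR]; abel⟩
      rw [hR, map_sub, hδ']
      have := (I'.exact_succ n).apply_apply_eq_zero (undl F h x)
      erw [this]
      rw [sub_zero])
  refine ⟨s, ?_, fun n => ?_⟩
  · rw [← undl_comp, h0, hδ, sub_add_cancel]
  · have : undl F (δ (n + 1)) = undl F (I'.d n) ∘ₗ undl F (s n) +
        undl F (s (n + 1)) ∘ₗ undl F (I.d (n + 1)) := LinearMap.ext (hs n)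
    rw [← this, hδ, sub_add_cancel]

/-- Iterated embeddings into injective objects give an injective resolution. -/
theorem exists_injRes {P Q : 𝒟 → Prop} (hQ : ∀ I, Q I → IsInjectiveObj F I)
    (step : ∀ Z, P Z → ∃ (I : 𝒟) (j : Z ⟶ I) (Z' : 𝒟) (q : I ⟶ Z'), Q I ∧
      Function.Injective (undl F j) ∧ Function.Exact (undl F j) (undl F q) ∧
      Function.Surjective (undl F q) ∧ P Z') {M : 𝒟} (hM : P M) :
    ∃ R : InjRes F M, ∀ n, Q (R.obj n) := by
  choose I j Z' q hI hj hjq hq hP using step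
  -- The n-th cosyzygy of `M`; the differential of the resolution is the projection onto the next
  -- cosyzygy followed by its embedding.
  let s : ℕ → {Z : 𝒟 // P Z} := fun n =>
    Nat.rec ⟨M, hM⟩ (fun _ z => ⟨Z' z.1 z.2, hP z.1 z.2⟩) n
  refine ⟨{
    obj := fun n => I (s n).1 (s n).2
    d := fun n => q (s n).1 (s n).2 ≫ j (s (n + 1)).1 (s (n + 1)).2
    ι := j (s 0).1 (s 0).2
    isInjective := fun n => hQ _ (hI _ _)
    ι_injective := hj _ _
    exact_zero := fun x => ?_
    exact_succ := fun n x => ?_ }, fun n => hI _ _⟩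
  · refine Iff.trans ?_ (hjq _ (s 0).2 x)
    change undl F _ x = 0 ↔ _
    rw [undl_comp_apply]
    exact map_eq_zero_iff _ (hj _ (s 1).2)
  · change undl F _ x = 0 ↔ x ∈ Set.range (undl F _)
    rw [undl_comp_apply, undl_comp, LinearMap.coe_comp,
      Set.range_comp, (hq _ _).range_eq, Set.image_univ, ← hjq _ (s (n + 1)).2 x]
    exact map_eq_zero_iff _ (hj _ (s (n + 2)).2)

end Generic

/-! ### Homotopies of cochain complexes. -/

section Complexes

open HomologicalComplex

variable {k : Type u} [Field k]

/-- A homotopy between morphisms of cochain complexes from its components. -/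
noncomputable def homotopyOfComponents {K L : CochainComplex (ModuleCat.{u} k) ℕ} {f g : K ⟶ L}
    (h : ∀ n, K.X (n + 1) ⟶ L.X n) (h0 : f.f 0 = K.d 0 1 ≫ h 0 + g.f 0)
    (hs : ∀ n, f.f (n + 1) = K.d (n + 1) (n + 2) ≫ h (n + 1) + h n ≫ L.d n (n + 1) +
      g.f (n + 1)) : Homotopy f g where
  -- A homotopy has a component for every pair of indices, so the equality of degrees is only
  -- propositional and `h j` has to be transported along it.
  hom i j := if e : j + 1 = i then eqToHom (by rw [e]) ≫ h j else 0
  zero i j hij := dif_neg hij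
  comm i := by
    rcases i with _ | i
    · rw [Homotopy.dNext_cochainComplex, Homotopy.prevD_zero_cochainComplex, h0]
      simp
    · rw [Homotopy.dNext_cochainComplex, Homotopy.prevD_succ_cochainComplex, hs]
      simp

end Complexes

/-! ### Graded vector spaces: homogeneous projections, quotients, extension of maps, boundedness. -/

section GradedSpaces

variable {k : Type u} [Field k]

/-- Independence of the pieces: an element of `gr i` lying in the sum of the other pieces is both
fixed and killed by `π i`. -/
theorem isInternal_of_proj {V : Type u} [AddCommGroup V] [Module k V] {gr : ℤ → Submodule k V}
    (π : ℤ → V →ₗ[k] V) (hπ : ∀ i, ∀ x ∈ gr i, π i x = x)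
    (hπ' : ∀ i j, i ≠ j → ∀ x ∈ gr j, π i x = 0) (htop : ∀ x, x ∈ ⨆ i, gr i) :
    DirectSum.IsInternal gr := by
  refine DirectSum.isInternal_submodule_of_iSupIndep_of_iSup_eq_top (fun i => ?_)
    (eq_top_iff.mpr fun x _ => htop x)
  rw [Submodule.disjoint_def]
  intro x hx hx'
  have : (⨆ j, ⨆ (_ : j ≠ i), gr j) ≤ LinearMap.ker (π i) :=
    iSup₂_le fun j hj y hy => hπ' i j hj.symm y hy
  rw [← hπ i x hx]
  exact this hx'

namespace GrVect

variable (V W : GrVect k)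

/-- The linear map given by `g i` on the degree `i` part. -/
noncomputable def ofFamily {W : Type u} [AddCommGroup W] [Module k W]
    (g : ℤ → V.carrier →ₗ[k] W) : V.carrier →ₗ[k] W :=
  letI := V.isInternal.chooseDecomposition
  DirectSum.toModule k ℤ W (fun i => g i ∘ₗ (V.gr i).subtype) ∘ₗ
    (DirectSum.decomposeLinearEquiv V.gr).toLinearMap

variable {V W}

theorem ofFamily_apply {W : Type u} [AddCommGroup W] [Module k W]
    (g : ℤ → V.carrier →ₗ[k] W) {i : ℤ} {x : V.carrier} (hx : x ∈ V.gr i) :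
    V.ofFamily g x = g i x := by
  let _ := V.isInternal.chooseDecomposition
  simp only [ofFamily, LinearMap.comp_apply, LinearEquiv.coe_coe,
    DirectSum.decomposeLinearEquiv_apply]
  rw [DirectSum.decompose_of_mem _ hx, ← DirectSum.lof_eq_of k, DirectSum.toModule_lof]
  rfl

theorem mem_iSup_gr (x : V.carrier) : x ∈ ⨆ i, V.gr i := by
  rw [V.isInternal.submodule_iSup_eq_top]
  trivial

@[elab_as_elim]
theorem inductionOn {p : V.carrier → Prop} (x : V.carrier) (zero : p 0)
    (homogeneous : ∀ i, ∀ x ∈ V.gr i, p x) (add : ∀ x y, p x → p y → p (x + y)) : p x :=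
  Submodule.iSup_induction V.gr (motive := p) (mem_iSup_gr x) homogeneous zero add

theorem linearMap_ext {W : Type u} [AddCommGroup W] [Module k W] {f g : V.carrier →ₗ[k] W}
    (h : ∀ i, ∀ x ∈ V.gr i, f x = g x) : f = g :=
  LinearMap.ext fun x => inductionOn x (by simp) h fun x y hx hy => by simp [hx, hy]

variable (V) in
/-- The projection onto the degree `i` part. -/
noncomputable def proj (i : ℤ) : V.carrier →ₗ[k] V.carrier :=
  V.ofFamily fun j => if j = i then LinearMap.id else 0

theorem proj_of_mem {i : ℤ} {x : V.carrier} (hx : x ∈ V.gr i) : V.proj i x = x := by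
  simp [proj, ofFamily_apply _ hx]

theorem proj_of_mem_ne {i j : ℤ} (h : i ≠ j) {x : V.carrier} (hx : x ∈ V.gr j) :
    V.proj i x = 0 := by
  simp [proj, ofFamily_apply _ hx, h.symm]

theorem proj_mem (i : ℤ) (x : V.carrier) : V.proj i x ∈ V.gr i := by
  induction x using inductionOn with
  | zero => simp
  | homogeneous j x hx =>
    by_cases h : i = j
    · subst h; rwa [proj_of_mem hx]
    · rw [proj_of_mem_ne h hx]; exact zero_mem _
  | add x y hx hy => rw [map_add]; exact add_mem hx hy

theorem map_proj {f : V.carrier →ₗ[k] W.carrier} (hf : ∀ i, ∀ x ∈ V.gr i, f x ∈ W.gr i) (i : ℤ)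
    (x : V.carrier) : f (V.proj i x) = W.proj i (f x) := by
  induction x using inductionOn with
  | zero => simp
  | homogeneous j x hx =>
    by_cases h : i = j
    · subst h; rw [proj_of_mem hx, proj_of_mem (hf _ _ hx)]
    · rw [proj_of_mem_ne h hx, proj_of_mem_ne h (hf _ _ hx), map_zero]
  | add x y hx hy => simp [hx, hy]

/-- Homogeneous elements lift to homogeneous elements along a surjection of degree `0`. -/
theorem exists_mem_of_surjective {f : V.carrier →ₗ[k] W.carrier}
    (hf : ∀ i, ∀ x ∈ V.gr i, f x ∈ W.gr i) (hs : Function.Surjective f) {i : ℤ} {y : W.carrier}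
    (hy : y ∈ W.gr i) : ∃ x ∈ V.gr i, f x = y := by
  obtain ⟨x, rfl⟩ := hs y
  exact ⟨V.proj i x, proj_mem i x, by rw [map_proj hf, proj_of_mem hy]⟩

theorem IsBddAbove.of_surjective {f : V.carrier →ₗ[k] W.carrier}
    (hf : ∀ i, ∀ x ∈ V.gr i, f x ∈ W.gr i) (hs : Function.Surjective f) (hV : V.IsBddAbove) :
    W.IsBddAbove := by
  obtain ⟨b, hb⟩ := hV
  refine ⟨b, fun p hp => (Submodule.eq_bot_iff _).mpr fun y hy => ?_⟩
  obtain ⟨x, hx, rfl⟩ := exists_mem_of_surjective hf hs hy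
  rw [hb p hp, Submodule.mem_bot] at hx
  rw [hx, map_zero]

/-- Linear maps of degree `0` extend along injective linear maps of degree `0`. -/
theorem exists_extension {X Y V : GrVect k} {i : X.carrier →ₗ[k] Y.carrier}
    (hi : ∀ p, ∀ x ∈ X.gr p, i x ∈ Y.gr p) (hinj : Function.Injective i)
    {g : X.carrier →ₗ[k] V.carrier} (hg : ∀ p, ∀ x ∈ X.gr p, g x ∈ V.gr p) :
    ∃ g' : Y.carrier →ₗ[k] V.carrier, (∀ p, ∀ y ∈ Y.gr p, g' y ∈ V.gr p) ∧ g' ∘ₗ i = g := by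
  obtain ⟨r, hr⟩ := i.exists_leftInverse_of_injective (LinearMap.ker_eq_bot.mpr hinj)
  -- The linear retraction `r` need not respect degrees, so on the degree `p` part only the degree
  -- `p` component of `g ∘ r` is kept. On the image of `i` nothing is lost.
  refine ⟨Y.ofFamily fun p => V.proj p ∘ₗ g ∘ₗ r, fun p y hy => ?_, linearMap_ext fun p x hx => ?_⟩
  · rw [ofFamily_apply _ hy]; exact proj_mem _ _
  · rw [LinearMap.comp_apply, ofFamily_apply _ (hi p x hx)]
    have : r (i x) = x := LinearMap.congr_fun hr x
    simp only [LinearMap.comp_apply, this]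
    exact proj_of_mem (hg p x hx)

/-- The quotient of a graded vector space by a homogeneous subspace. -/
abbrev quot (V : GrVect k) (S : Submodule k V.carrier) (hS : ∀ x ∈ S, ∀ i, V.proj i x ∈ S) :
    GrVect k where
  carrier := V.carrier ⧸ S
  gr i := (V.gr i).map S.mkQ
  isInternal := by
    refine isInternal_of_proj (fun i => S.mapQ S (V.proj i) fun x hx => hS x hx i) ?_ ?_ ?_
    · rintro i _ ⟨x, hx, rfl⟩
      simp [proj_of_mem hx]
    · rintro i j hij _ ⟨x, hx, rfl⟩
      simp [proj_of_mem_ne hij hx]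
    · intro x
      obtain ⟨x, rfl⟩ := S.mkQ_surjective x
      rw [← Submodule.map_iSup]
      exact Submodule.mem_map_of_mem (mem_iSup_gr x)

theorem proj_mem_ker {f : V.carrier →ₗ[k] W.carrier} (hf : ∀ i, ∀ x ∈ V.gr i, f x ∈ W.gr i) :
    ∀ x ∈ LinearMap.ker f, ∀ i, V.proj i x ∈ LinearMap.ker f := by
  intro x hx i
  rw [LinearMap.mem_ker] at hx ⊢
  rw [map_proj hf, hx, map_zero]

theorem proj_mem_range {f : V.carrier →ₗ[k] W.carrier} (hf : ∀ i, ∀ x ∈ V.gr i, f x ∈ W.gr i) :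
    ∀ y ∈ LinearMap.range f, ∀ i, W.proj i y ∈ LinearMap.range f := by
  rintro _ ⟨x, rfl⟩ i
  exact ⟨V.proj i x, map_proj hf i x⟩

/-- If b and c bound the two factors, a generator v ⊗ w of degree above b + c has deg v > b or deg w
> c, hence is zero. -/
theorem isBddAbove_of_tensor {V W T : GrVect k} (hV : V.IsBddAbove) (hW : W.IsBddAbove)
    (e : T.carrier →ₗ[k] V.carrier ⊗[k] W.carrier) (he : Function.Injective e)
    (h : ∀ i, ∀ x ∈ T.gr i, e x ∈ tensorGr V.gr W.gr i) : T.IsBddAbove := by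
  obtain ⟨b, hb⟩ := hV
  obtain ⟨c, hc⟩ := hW
  refine ⟨b + c, fun p hp => (Submodule.eq_bot_iff _).mpr fun x hx => he ?_⟩
  rw [map_zero, ← Submodule.mem_bot k]
  refine (?_ : tensorGr V.gr W.gr p ≤ ⊥) (h p x hx)
  rw [tensorGr, Submodule.span_le]
  rintro _ ⟨i, j, hij, v, hv, w, hw, rfl⟩
  rcases lt_or_ge b i with hi | hi
  · rw [hb i hi, Submodule.mem_bot] at hv
    simp [hv]
  · rw [hc j (by omega), Submodule.mem_bot] at hw
    simp [hw]

end GrVect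

end GradedSpaces

/-! ### Graded comodules over a coalgebra in nonpositive degrees. -/

section Comodules

variable {k : Type u} [Field k] {C : Type u} [AddCommMonoid C] [Module k C] [Coalgebra k C]

/-- A coalgebra with a compatible grading, concentrated in degrees `≤ 0`. -/
class NonposGrCoalg (𝓒 : ℤ → Submodule k C) : Prop where
  isInternal : DirectSum.IsInternal 𝓒
  comul_mem : ∀ p, ∀ c ∈ 𝓒 p, Coalgebra.comul (R := k) c ∈ tensorGr 𝓒 𝓒 p
  counit_eq_zero : ∀ p, p ≠ 0 → ∀ c ∈ 𝓒 p, Coalgebra.counit (R := k) c = 0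
  eq_bot_of_pos : ∀ p > 0, 𝓒 p = ⊥

/-- The graded vector space underlying a graded coalgebra. -/
abbrev coalgGrVect (𝓒 : ℤ → Submodule k C) [NonposGrCoalg 𝓒] : GrVect k where
  carrier := C
  -- Comodules are defined over a coalgebra that is only assumed to be an additive monoid; negatives
  -- come from the scalar -1.
  addCommGroup := Module.addCommMonoidToAddCommGroup k
  gr := 𝓒
  isInternal := NonposGrCoalg.isInternal

theorem coalgGrVect_isBddAbove (𝓒 : ℤ → Submodule k C) [NonposGrCoalg 𝓒] :
    (coalgGrVect 𝓒).IsBddAbove :=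
  ⟨0, NonposGrCoalg.eq_bot_of_pos (𝓒 := 𝓒)⟩

theorem tmul_mem_assoc_tensorGr {V₁ V₂ V₃ : Type u} [AddCommMonoid V₁] [Module k V₁]
    [AddCommMonoid V₂] [Module k V₂] [AddCommMonoid V₃] [Module k V₃]
    {𝓥₁ : ℤ → Submodule k V₁} {𝓥₂ : ℤ → Submodule k V₂} {𝓥₃ : ℤ → Submodule k V₃} {p : ℤ}
    {t : V₁ ⊗[k] (V₂ ⊗[k] V₃)} (ht : t ∈ tensorGr 𝓥₁ (tensorGr 𝓥₂ 𝓥₃) p) :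
    (TensorProduct.assoc k V₁ V₂ V₃).symm t ∈ tensorGr (tensorGr 𝓥₁ 𝓥₂) 𝓥₃ p := by
  induction ht using Submodule.span_induction with
  | zero => simp
  | add x y _ _ hx hy => rw [map_add]; exact add_mem hx hy
  | smul c x _ hx => rw [map_smul]; exact Submodule.smul_mem _ c hx
  | mem t ht =>
    obtain ⟨i, j, rfl, v, hv, w, hw, rfl⟩ := ht
    induction hw using Submodule.span_induction with
    | zero => simp
    | add x y _ _ hx hy => rw [tmul_add, map_add]; exact add_mem hx hy
    | smul c x _ hx => rw [tmul_smul, map_smul]; exact Submodule.smul_mem _ c hx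
    | mem t ht =>
      obtain ⟨i', j', rfl, v', hv', w', hw', rfl⟩ := ht
      rw [assoc_symm_tmul]
      exact tmul_mem_tensorGr (by omega) (tmul_mem_tensorGr rfl hv hv') hw'

theorem tmul_mem_assoc_symm_tensorGr {V₁ V₂ V₃ : Type u} [AddCommMonoid V₁] [Module k V₁]
    [AddCommMonoid V₂] [Module k V₂] [AddCommMonoid V₃] [Module k V₃]
    {𝓥₁ : ℤ → Submodule k V₁} {𝓥₂ : ℤ → Submodule k V₂} {𝓥₃ : ℤ → Submodule k V₃} {p : ℤ}
    {t : (V₁ ⊗[k] V₂) ⊗[k] V₃} (ht : t ∈ tensorGr (tensorGr 𝓥₁ 𝓥₂) 𝓥₃ p) :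
    TensorProduct.assoc k V₁ V₂ V₃ t ∈ tensorGr 𝓥₁ (tensorGr 𝓥₂ 𝓥₃) p := by
  induction ht using Submodule.span_induction with
  | zero => simp
  | add x y _ _ hx hy => rw [map_add]; exact add_mem hx hy
  | smul c x _ hx => rw [map_smul]; exact Submodule.smul_mem _ c hx
  | mem t ht =>
    obtain ⟨i, j, rfl, v, hv, w, hw, rfl⟩ := ht
    induction hv using Submodule.span_induction with
    | zero => simp
    | add x y _ _ hx hy => rw [add_tmul, map_add]; exact add_mem hx hy
    | smul c x _ hx => rw [← smul_tmul', map_smul]; exact Submodule.smul_mem _ c hx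
    | mem t ht =>
      obtain ⟨i', j', rfl, v', hv', w', hw', rfl⟩ := ht
      rw [assoc_tmul]
      exact tmul_mem_tensorGr (by omega) hv' (tmul_mem_tensorGr rfl hw' hw)

variable {𝓒 : ℤ → Submodule k C}

/-! ### Right comodules: quotients, cofree comodules, cofree resolutions. -/

section Right

theorem GrRComod.hom_ext {X Y : GrRComod 𝓒} {f g : X ⟶ Y} (h : f.lin = g.lin) : f = g :=
  GrRComod.Hom.ext h

/-- The difference of two homomorphisms. -/
def GrRComod.homSub {X Y : GrRComod 𝓒} (f g : X ⟶ Y) : X ⟶ Y where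
  lin := f.lin - g.lin
  map_gr i x hx := sub_mem (f.map_gr i x hx) (g.map_gr i x hx)
  map_coact x := by
    rw [LinearMap.sub_apply, map_sub, f.map_coact, g.map_coact, LinearMap.rTensor_sub,
      LinearMap.sub_apply]

-- Over a field the embedding of V / ker f into W splits, so the quotient map is `r ∘ f` for a
-- linear `r`. This shows that the kernel of a comodule homomorphism is a subcomodule.
omit [Coalgebra k C] in
theorem rTensor_mkQ_ker_eq_zero {V W : Type u} [AddCommGroup V] [Module k V] [AddCommGroup W]
    [Module k W] (f : V →ₗ[k] W) {t : V ⊗[k] C} (h : f.rTensor C t = 0) :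
    (LinearMap.ker f).mkQ.rTensor C t = 0 := by
  obtain ⟨r, hr⟩ := ((LinearMap.ker f).liftQ f le_rfl).exists_leftInverse_of_injective
    ((LinearMap.ker f).ker_liftQ_eq_bot f le_rfl le_rfl)
  have : (LinearMap.ker f).mkQ = r ∘ₗ f := by
    have h2 := congrArg (· ∘ₗ (LinearMap.ker f).mkQ) hr
    simpa [LinearMap.comp_assoc] using h2.symm
  rw [this, LinearMap.rTensor_comp_apply, h, map_zero]

/-- The quotient of a graded right comodule by a graded subcomodule. -/
noncomputable abbrev GrRComod.quot (X : GrRComod 𝓒) (S : Submodule k X.carrier)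
    (hS : ∀ x ∈ S, ∀ i, X.proj i x ∈ S) (hc : ∀ x ∈ S, S.mkQ.rTensor C (X.coact x) = 0) :
    GrRComod 𝓒 where
  toGrVect := X.toGrVect.quot S hS
  coact := S.liftQ (S.mkQ.rTensor C ∘ₗ X.coact) hc
  coact_mem := by
    rintro i _ ⟨x, hx, rfl⟩
    exact map_mem_tensorGr (f := S.mkQ) (g := LinearMap.id) (a := 0) (b := 0)
      (fun j v hv => by rw [zero_add]; exact Submodule.mem_map_of_mem hv)
      (fun j v hv => by simpa using hv) (by omega) (X.coact_mem i x hx)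
  coassoc := by
    refine Submodule.linearMap_qext S (LinearMap.ext fun x => ?_)
    have h1 : ∀ t : X.carrier ⊗[k] C,
        TensorProduct.assoc k (X.carrier ⧸ S) C C ((S.liftQ (S.mkQ.rTensor C ∘ₗ X.coact) hc).rTensor C
          (S.mkQ.rTensor C t)) =
        S.mkQ.rTensor (C ⊗[k] C) (TensorProduct.assoc k X.carrier C C (X.coact.rTensor C t)) := by
      intro t
      induction t with
      | zero => simp
      | add x y hx hy => simp only [map_add, hx, hy]
      | tmul x c =>
        rw [LinearMap.rTensor_tmul, LinearMap.rTensor_tmul, LinearMap.rTensor_tmul,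
          show S.liftQ (S.mkQ.rTensor C ∘ₗ X.coact) hc (S.mkQ x) = S.mkQ.rTensor C (X.coact x)
            from rfl]
        generalize X.coact x = y
        induction y with
        | zero => simp
        | add x y hx hy => simp only [map_add, add_tmul, hx, hy]
        | tmul x c => simp
    have h2 := LinearMap.congr_fun X.coassoc x
    simp only [LinearMap.comp_apply, LinearEquiv.coe_coe] at h2
    refine (h1 (X.coact x)).trans ?_
    rw [h2, ← LinearMap.comp_apply, LinearMap.rTensor_comp_lTensor,
      ← LinearMap.lTensor_comp_rTensor]
    rfl
  counit := by
    refine Submodule.linearMap_qext S (LinearMap.ext fun x => ?_)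
    have h2 := LinearMap.congr_fun X.counit x
    simp only [LinearMap.comp_apply] at h2
    change (Coalgebra.counit (R := k) (A := C)).lTensor (X.carrier ⧸ S)
      (S.mkQ.rTensor C (X.coact x)) = _
    rw [← LinearMap.comp_apply, LinearMap.lTensor_comp_rTensor, ← LinearMap.rTensor_comp_lTensor,
      LinearMap.comp_apply, h2]
    rfl

/-- The projection onto the quotient. -/
noncomputable def GrRComod.quotMk (X : GrRComod 𝓒) (S : Submodule k X.carrier)
    (hS : ∀ x ∈ S, ∀ i, X.proj i x ∈ S) (hc : ∀ x ∈ S, S.mkQ.rTensor C (X.coact x) = 0) :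
    X ⟶ X.quot S hS hc where
  lin := S.mkQ
  map_gr _ _ hx := Submodule.mem_map_of_mem hx
  map_coact _ := rfl

/-- The factorisation is `g ∘ s` for a linear section `s` of `p`. The section respects neither
grading nor coaction, but `g ∘ s` agrees with `g` after composition with the surjective `p`, and
compatibility descends from `g`. -/
theorem GrRComod.exists_factor {X Q Z : GrRComod 𝓒} (p : X ⟶ Q) (g : X ⟶ Z)
    (hp : Function.Surjective p.lin) (h : LinearMap.ker p.lin ≤ LinearMap.ker g.lin) :
    ∃ e : Q ⟶ Z, p ≫ e = g := by
  obtain ⟨s, hs⟩ := p.lin.exists_rightInverse_of_surjective (LinearMap.range_eq_top.mpr hp)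
  have hs' : ∀ x, g.lin (s (p.lin x)) = g.lin x := fun x => by
    rw [← sub_eq_zero, ← map_sub]
    refine h ?_
    rw [LinearMap.mem_ker, map_sub, sub_eq_zero]
    exact LinearMap.congr_fun hs (p.lin x)
  have hl : (g.lin ∘ₗ s) ∘ₗ p.lin = g.lin := LinearMap.ext hs'
  refine ⟨⟨g.lin ∘ₗ s, fun i y hy => ?_, fun y => ?_⟩, GrRComod.hom_ext hl⟩
  · obtain ⟨x, hx, rfl⟩ := GrVect.exists_mem_of_surjective p.map_gr hp hy
    rw [LinearMap.comp_apply, hs']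
    exact g.map_gr i x hx
  · obtain ⟨x, rfl⟩ := hp y
    rw [p.map_coact, ← LinearMap.rTensor_comp_apply, hl, LinearMap.comp_apply, hs', g.map_coact]

instance GrRComod.homalgCat : HomalgCat (GrRComod.forget 𝓒) where
  exists_sub f g := ⟨GrRComod.homSub f g, rfl⟩
  exists_coimage {X Y} d := by
    refine ⟨X.quot (LinearMap.ker d.lin) (GrVect.proj_mem_ker d.map_gr) fun x hx => ?_,
      X.quotMk _ _ _, Submodule.mkQ_surjective _, Submodule.ker_mkQ _⟩
    refine rTensor_mkQ_ker_eq_zero _ ?_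
    rw [← d.map_coact, LinearMap.mem_ker.mp hx, map_zero]
  exists_coker {X Y} d := by
    refine ⟨Y.quot (LinearMap.range d.lin) (GrVect.proj_mem_range d.map_gr) ?_,
      Y.quotMk _ _ _, Submodule.mkQ_surjective _, Submodule.ker_mkQ _⟩
    rintro _ ⟨x, rfl⟩
    rw [d.map_coact, ← LinearMap.rTensor_comp_apply, LinearMap.range_mkQ_comp]
    simp
  exists_factor p g hp h := GrRComod.exists_factor p g hp h

variable [NonposGrCoalg 𝓒]

variable (𝓒) in
/-- The cofree graded right comodule `V ⊗ C`. -/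
noncomputable abbrev GrRComod.cofree (V : GrVect k) : GrRComod 𝓒 where
  carrier := V.carrier ⊗[k] C
  addCommGroup := Module.addCommMonoidToAddCommGroup k
  gr := tensorGr V.gr 𝓒
  isInternal := tensorGr_isInternal V.isInternal (NonposGrCoalg.isInternal (𝓒 := 𝓒))
  coact := (TensorProduct.assoc k V.carrier C C).symm.toLinearMap ∘ₗ
    (Coalgebra.comul (R := k) (A := C)).lTensor V.carrier
  coact_mem i x hx := by
    refine tmul_mem_assoc_tensorGr (map_mem_tensorGr (f := LinearMap.id) (a := 0) (b := 0)
      (fun j v hv => by simpa using hv) (fun j c hc => ?_) (by omega) hx)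
    rw [zero_add]
    exact NonposGrCoalg.comul_mem j c hc
  coassoc := by
    refine TensorProduct.ext' fun v c => ?_
    -- With `v` fixed, both sides of the identity are images under v ⊗ - of the two sides of
    -- coassociativity in `C`.
    have key : ∀ t : C ⊗[k] C, TensorProduct.assoc k (V.carrier ⊗[k] C) C C
        (((TensorProduct.assoc k V.carrier C C).symm.toLinearMap ∘ₗ
          (Coalgebra.comul (R := k) (A := C)).lTensor V.carrier).rTensor C
            ((TensorProduct.assoc k V.carrier C C).symm (v ⊗ₜ t))) =
        (TensorProduct.mk k V.carrier C v).rTensor (C ⊗[k] C) (TensorProduct.assoc k C C C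
          ((Coalgebra.comul (R := k) (A := C)).rTensor C t)) := by
      intro t
      induction t with
      | zero => simp
      | add x y hx hy => simp only [map_add, tmul_add, hx, hy]
      | tmul a b =>
        simp only [assoc_symm_tmul, LinearMap.rTensor_tmul, LinearMap.comp_apply,
          LinearMap.lTensor_tmul, LinearEquiv.coe_coe]
        generalize Coalgebra.comul (R := k) a = y
        induction y with
        | zero => simp
        | add x y hx hy => simp only [map_add, tmul_add, add_tmul, hx, hy]
        | tmul x c => simp
    have key' : ∀ t : C ⊗[k] C, (Coalgebra.comul (R := k) (A := C)).lTensor (V.carrier ⊗[k] C)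
          ((TensorProduct.assoc k V.carrier C C).symm (v ⊗ₜ t)) =
        (TensorProduct.mk k V.carrier C v).rTensor (C ⊗[k] C)
          ((Coalgebra.comul (R := k) (A := C)).lTensor C t) := by
      intro t
      induction t with
      | zero => simp
      | add x y hx hy => simp only [map_add, tmul_add, hx, hy]
      | tmul a b => simp
    refine (key _).trans (Eq.trans ?_ (key' _).symm)
    rw [Coalgebra.coassoc_apply]
  counit := by
    refine TensorProduct.ext' fun v c => ?_
    have key : ∀ t : C ⊗[k] C, (Coalgebra.counit (R := k) (A := C)).lTensor (V.carrier ⊗[k] C)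
          ((TensorProduct.assoc k V.carrier C C).symm (v ⊗ₜ t)) =
        (TensorProduct.mk k V.carrier C v).rTensor k
          ((Coalgebra.counit (R := k) (A := C)).lTensor C t) := by
      intro t
      induction t with
      | zero => simp
      | add x y hx hy => simp only [map_add, tmul_add, hx, hy]
      | tmul a b => simp
    refine (key _).trans ?_
    rw [Coalgebra.lTensor_counit_comul]
    simp

/-- The counit `V ⊗ C → V`. -/
noncomputable def GrRComod.cofreeCounit (V : GrVect k) : V.carrier ⊗[k] C →ₗ[k] V.carrier :=
  (TensorProduct.rid k V.carrier).toLinearMap ∘ₗ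
    (Coalgebra.counit (R := k) (A := C)).lTensor V.carrier

omit [NonposGrCoalg 𝓒] in
theorem GrRComod.cofreeCounit_tmul (V : GrVect k) (v : V.carrier) (c : C) :
    cofreeCounit V (v ⊗ₜ[k] c) = Coalgebra.counit (R := k) c • v := by
  simp [cofreeCounit]

/-- Only the degree 0 part of `C` survives the counit, so the degree of the factor in `V` is the
total degree. -/
theorem GrRComod.cofreeCounit_mem (V : GrVect k) {p : ℤ} {t : V.carrier ⊗[k] C}
    (ht : t ∈ tensorGr V.gr 𝓒 p) : cofreeCounit V t ∈ V.gr p := by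
  induction ht using Submodule.span_induction with
  | zero => simp
  | add x y _ _ hx hy => rw [map_add]; exact add_mem hx hy
  | smul c x _ hx => rw [map_smul]; exact Submodule.smul_mem _ c hx
  | mem t ht =>
    obtain ⟨i, j, hij, v, hv, w, hw, rfl⟩ := ht
    rw [cofreeCounit_tmul]
    by_cases hj : j = 0
    · subst hj
      rw [add_zero] at hij
      exact Submodule.smul_mem _ _ (hij ▸ hv)
    · rw [NonposGrCoalg.counit_eq_zero j hj w hw, zero_smul]
      exact zero_mem _

/-- A counit law of `C`. It says that an element of V ⊗ C is recovered from its coaction through the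
counit V ⊗ C → V, so that homomorphisms into a cofree comodule are determined by their composite
with the counit. -/
theorem GrRComod.rTensor_cofreeCounit_coact (V : GrVect k) (t : V.carrier ⊗[k] C) :
    (cofreeCounit V).rTensor C ((cofree 𝓒 V).coact t) = t := by
  induction t with
  | zero => exact map_zero _
  | add x y hx hy =>
    rw [map_add, map_add, hx, hy]
  | tmul v c =>
    have key : ∀ t : C ⊗[k] C, (cofreeCounit V).rTensor C
        ((TensorProduct.assoc k V.carrier C C).symm (v ⊗ₜ t)) =
        (TensorProduct.lid k C ((Coalgebra.counit (R := k) (A := C)).rTensor C t) |>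
          TensorProduct.mk k V.carrier C v) := by
      intro t
      induction t with
      | zero => simp
      | add x y hx hy => simp only [map_add, tmul_add, hx, hy]
      | tmul a b => simp [cofreeCounit_tmul, smul_tmul]
    refine (key _).trans ?_
    rw [Coalgebra.rTensor_counit_comul]
    simp

/-- The comodule homomorphism into a cofree comodule induced by a linear map of degree `0`. -/
noncomputable def GrRComod.toCofree (Y : GrRComod 𝓒) (V : GrVect k)
    (g : Y.carrier →ₗ[k] V.carrier) (hg : ∀ p, ∀ y ∈ Y.gr p, g y ∈ V.gr p) :
    Y ⟶ cofree 𝓒 V where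
  lin := g.rTensor C ∘ₗ Y.coact
  map_gr i y hy := map_mem_tensorGr (f := g) (g := LinearMap.id) (a := 0) (b := 0)
      (fun j v hv => by rw [zero_add]; exact hg j v hv)
      (fun j v hv => by simpa using hv) (by omega) (Y.coact_mem i y hy)
  map_coact y := by
    have h2 := LinearMap.congr_fun Y.coassoc y
    simp only [LinearMap.comp_apply, LinearEquiv.coe_coe] at h2
    have h1 : (TensorProduct.assoc k V.carrier C C).symm
        ((Coalgebra.comul (R := k) (A := C)).lTensor V.carrier (g.rTensor C (Y.coact y))) =
        (g.rTensor C).rTensor C ((TensorProduct.assoc k Y.carrier C C).symm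
          ((Coalgebra.comul (R := k) (A := C)).lTensor Y.carrier (Y.coact y))) := by
      rw [← LinearMap.comp_apply, LinearMap.lTensor_comp_rTensor,
        ← LinearMap.rTensor_comp_lTensor, LinearMap.comp_apply]
      generalize (Coalgebra.comul (R := k) (A := C)).lTensor Y.carrier (Y.coact y) = t
      -- What remains is naturality of the associator; rewriting `t` as the reassociation of a
      -- left-nested tensor allows induction down to pure tensors.
      rw [LinearEquiv.symm_apply_eq]
      rw [← (TensorProduct.assoc k Y.carrier C C).apply_symm_apply t]
      rw [LinearEquiv.symm_apply_apply]
      generalize (TensorProduct.assoc k Y.carrier C C).symm t = t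
      induction t with
      | zero => simp
      | add x y hx hy => simp only [map_add, hx, hy]
      | tmul x c =>
        induction x with
        | zero => simp
        | add x y hx hy => simp only [map_add, add_tmul, hx, hy]
        | tmul x c => simp
    refine h1.trans ?_
    rw [← h2, LinearEquiv.symm_apply_apply, ← LinearMap.rTensor_comp_apply]

/-- The cofree comodule is right adjoint to forgetting the coaction: the linear map obtained from
`f` and the counit extends along `i`, and the extension corresponds to a comodule homomorphism. -/
theorem GrRComod.isInjectiveObj_cofree (V : GrVect k) :
    IsInjectiveObj (GrRComod.forget 𝓒) (cofree 𝓒 V) := by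
  intro X Y i f hi
  obtain ⟨g, hg, hgi⟩ := GrVect.exists_extension (V := V) i.map_gr hi
    (g := cofreeCounit V ∘ₗ f.lin) fun p x hx => cofreeCounit_mem V (f.map_gr p x hx)
  refine ⟨Y.toCofree V g hg, GrRComod.hom_ext (LinearMap.ext fun x => ?_)⟩
  change g.rTensor C (Y.coact (i.lin x)) = f.lin x
  rw [i.map_coact, ← LinearMap.rTensor_comp_apply, hgi, LinearMap.rTensor_comp_apply,
    ← f.map_coact]
  exact rTensor_cofreeCounit_coact V _

theorem GrRComod.cofree_isBddAbove {V : GrVect k} (hV : V.IsBddAbove) :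
    (cofree 𝓒 V).IsBddAbove :=
  GrVect.isBddAbove_of_tensor hV (coalgGrVect_isBddAbove 𝓒) LinearMap.id (fun _ _ h => h)
    fun _ _ h => h

/-- Bounded-above graded right comodules have resolutions by bounded-above cofree comodules. -/
theorem GrRComod.exists_cofree_injRes (X : GrRComod 𝓒) (hX : X.IsBddAbove) :
    ∃ I : InjRes (GrRComod.forget 𝓒) X,
      ∀ n, ∃ V : GrVect k, V.IsBddAbove ∧ I.obj n = cofree 𝓒 V := by
  refine exists_injRes (P := fun Z : GrRComod 𝓒 => Z.IsBddAbove)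
    (Q := fun I => ∃ V : GrVect k, V.IsBddAbove ∧ I = cofree 𝓒 V) ?_ ?_ hX
  · rintro _ ⟨V, -, rfl⟩
    exact isInjectiveObj_cofree V
  · intro Z hZ
    -- The coaction embeds `Z` in the cofree comodule on its underlying space, with the counit as
    -- linear left inverse. The cokernel is bounded above, so the construction can be repeated.
    obtain ⟨Q, p, hp, hker⟩ := HomalgCat.exists_coker (F := GrRComod.forget 𝓒)
      (Z.toCofree Z.toGrVect LinearMap.id fun _ _ h => h)
    refine ⟨_, _, Q, p, ⟨Z.toGrVect, hZ, rfl⟩, ?_, LinearMap.exact_iff.mpr hker, hp,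
      GrVect.IsBddAbove.of_surjective p.map_gr hp (cofree_isBddAbove hZ)⟩
    refine Function.LeftInverse.injective (g := cofreeCounit Z.toGrVect) fun z => ?_
    have h := LinearMap.congr_fun Z.counit z
    change cofreeCounit Z.toGrVect (LinearMap.rTensor C LinearMap.id (Z.coact z)) = z
    rw [LinearMap.rTensor_id, LinearMap.id_apply]
    simp only [LinearMap.comp_apply] at h
    simp [cofreeCounit, h]

end Right

/-! ### Left comodules, by mirror-image arguments. -/

section Left

omit [Coalgebra k C] in
/-- `C ⊗ V` has negatives. -/
noncomputable abbrev leftTensorAddCommGroup {V : Type u} [AddCommMonoid V] [Module k V] :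
    AddCommGroup (C ⊗[k] V) :=
  Module.addCommMonoidToAddCommGroup k

attribute [local instance] leftTensorAddCommGroup

theorem GrLComod.hom_ext {X Y : GrLComod 𝓒} {f g : X ⟶ Y} (h : f.lin = g.lin) : f = g :=
  GrLComod.Hom.ext h

/-- The difference of two homomorphisms. -/
def GrLComod.homSub {X Y : GrLComod 𝓒} (f g : X ⟶ Y) : X ⟶ Y where
  lin := f.lin - g.lin
  map_gr i x hx := sub_mem (f.map_gr i x hx) (g.map_gr i x hx)
  map_coact x := by
    let _ : AddCommGroup C := Module.addCommMonoidToAddCommGroup k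
    rw [LinearMap.sub_apply, map_sub, f.map_coact, g.map_coact]
    exact (LinearMap.congr_fun (LinearMap.lTensor_sub f.lin g.lin (M := C)) (X.coact x)).symm

-- As on the right: the splitting of V / ker f in W makes kernels of homomorphisms subcomodules.
omit [Coalgebra k C] in
theorem lTensor_mkQ_ker_eq_zero {V W : Type u} [AddCommGroup V] [Module k V] [AddCommGroup W]
    [Module k W] (f : V →ₗ[k] W) {t : C ⊗[k] V} (h : f.lTensor C t = 0) :
    (LinearMap.ker f).mkQ.lTensor C t = 0 := by
  obtain ⟨r, hr⟩ := ((LinearMap.ker f).liftQ f le_rfl).exists_leftInverse_of_injective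
    ((LinearMap.ker f).ker_liftQ_eq_bot f le_rfl le_rfl)
  have : (LinearMap.ker f).mkQ = r ∘ₗ f := by
    have h2 := congrArg (· ∘ₗ (LinearMap.ker f).mkQ) hr
    simpa [LinearMap.comp_assoc] using h2.symm
  rw [this, LinearMap.lTensor_comp_apply, h, map_zero]

/-- The quotient of a graded left comodule by a graded subcomodule. -/
noncomputable abbrev GrLComod.quot (X : GrLComod 𝓒) (S : Submodule k X.carrier)
    (hS : ∀ x ∈ S, ∀ i, X.proj i x ∈ S) (hc : ∀ x ∈ S, S.mkQ.lTensor C (X.coact x) = 0) :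
    GrLComod 𝓒 where
  toGrVect := X.toGrVect.quot S hS
  coact := S.liftQ (S.mkQ.lTensor C ∘ₗ X.coact) hc
  coact_mem := by
    rintro i _ ⟨x, hx, rfl⟩
    exact map_mem_tensorGr (g := S.mkQ) (f := LinearMap.id) (a := 0) (b := 0)
      (fun j v hv => by simpa using hv)
      (fun j v hv => by rw [zero_add]; exact Submodule.mem_map_of_mem hv)
      (by omega) (X.coact_mem i x hx)
  coassoc := by
    refine Submodule.linearMap_qext S (LinearMap.ext fun x => ?_)
    have h1 : ∀ t : C ⊗[k] X.carrier,
        TensorProduct.assoc k C C (X.carrier ⧸ S)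
          ((Coalgebra.comul (R := k) (A := C)).rTensor (X.carrier ⧸ S) (S.mkQ.lTensor C t)) =
        (S.mkQ.lTensor C).lTensor C (TensorProduct.assoc k C C X.carrier
          ((Coalgebra.comul (R := k) (A := C)).rTensor X.carrier t)) := by
      intro t
      induction t with
      | zero => simp
      | add x y hx hy => simp only [map_add, hx, hy]
      | tmul c x =>
        rw [LinearMap.rTensor_tmul, LinearMap.lTensor_tmul, LinearMap.rTensor_tmul]
        generalize Coalgebra.comul (R := k) c = y
        induction y with
        | zero => simp
        | add x y hx hy => simp only [map_add, add_tmul, hx, hy]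
        | tmul x c => simp
    have h2 := LinearMap.congr_fun X.coassoc x
    simp only [LinearMap.comp_apply, LinearEquiv.coe_coe] at h2
    refine (h1 (X.coact x)).trans ?_
    rw [h2, ← LinearMap.lTensor_comp_apply]
    exact LinearMap.lTensor_comp_apply C (S.liftQ (S.mkQ.lTensor C ∘ₗ X.coact) hc)
      S.mkQ (X.coact x)
  counit := by
    refine Submodule.linearMap_qext S (LinearMap.ext fun x => ?_)
    have h2 := LinearMap.congr_fun X.counit x
    simp only [LinearMap.comp_apply] at h2
    change (Coalgebra.counit (R := k) (A := C)).rTensor (X.carrier ⧸ S)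
      (S.mkQ.lTensor C (X.coact x)) = _
    rw [← LinearMap.comp_apply, LinearMap.rTensor_comp_lTensor, ← LinearMap.lTensor_comp_rTensor,
      LinearMap.comp_apply, h2]
    rfl

/-- The projection onto the quotient. -/
noncomputable def GrLComod.quotMk (X : GrLComod 𝓒) (S : Submodule k X.carrier)
    (hS : ∀ x ∈ S, ∀ i, X.proj i x ∈ S) (hc : ∀ x ∈ S, S.mkQ.lTensor C (X.coact x) = 0) :
    X ⟶ X.quot S hS hc where
  lin := S.mkQ
  map_gr _ _ hx := Submodule.mem_map_of_mem hx
  map_coact _ := rfl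

theorem GrLComod.exists_factor {X Q Z : GrLComod 𝓒} (p : X ⟶ Q) (g : X ⟶ Z)
    (hp : Function.Surjective p.lin) (h : LinearMap.ker p.lin ≤ LinearMap.ker g.lin) :
    ∃ e : Q ⟶ Z, p ≫ e = g := by
  obtain ⟨s, hs⟩ := p.lin.exists_rightInverse_of_surjective (LinearMap.range_eq_top.mpr hp)
  have hs' : ∀ x, g.lin (s (p.lin x)) = g.lin x := fun x => by
    rw [← sub_eq_zero, ← map_sub]
    refine h ?_
    rw [LinearMap.mem_ker, map_sub, sub_eq_zero]
    exact LinearMap.congr_fun hs (p.lin x)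
  have hl : (g.lin ∘ₗ s) ∘ₗ p.lin = g.lin := LinearMap.ext hs'
  refine ⟨⟨g.lin ∘ₗ s, fun i y hy => ?_, fun y => ?_⟩, GrLComod.hom_ext hl⟩
  · obtain ⟨x, hx, rfl⟩ := GrVect.exists_mem_of_surjective p.map_gr hp hy
    rw [LinearMap.comp_apply, hs']
    exact g.map_gr i x hx
  · obtain ⟨x, rfl⟩ := hp y
    rw [p.map_coact, ← LinearMap.lTensor_comp_apply, hl, LinearMap.comp_apply, hs', g.map_coact]

instance GrLComod.homalgCat : HomalgCat (GrLComod.forget 𝓒) where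
  exists_sub f g := ⟨GrLComod.homSub f g, rfl⟩
  exists_coimage {X Y} d := by
    refine ⟨X.quot (LinearMap.ker d.lin) (GrVect.proj_mem_ker d.map_gr) fun x hx => ?_,
      X.quotMk _ _ _, Submodule.mkQ_surjective _, Submodule.ker_mkQ _⟩
    refine lTensor_mkQ_ker_eq_zero _ ?_
    rw [← d.map_coact, LinearMap.mem_ker.mp hx, map_zero]
  exists_coker {X Y} d := by
    refine ⟨Y.quot (LinearMap.range d.lin) (GrVect.proj_mem_range d.map_gr) ?_,
      Y.quotMk _ _ _, Submodule.mkQ_surjective _, Submodule.ker_mkQ _⟩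
    rintro _ ⟨x, rfl⟩
    rw [d.map_coact, ← LinearMap.lTensor_comp_apply, LinearMap.range_mkQ_comp]
    simp
  exists_factor p g hp h := GrLComod.exists_factor p g hp h

variable [NonposGrCoalg 𝓒]

variable (𝓒) in
/-- The cofree graded left comodule `C ⊗ V`. -/
noncomputable abbrev GrLComod.cofree (V : GrVect k) : GrLComod 𝓒 where
  carrier := C ⊗[k] V.carrier
  addCommGroup := Module.addCommMonoidToAddCommGroup k
  gr := tensorGr 𝓒 V.gr
  isInternal := tensorGr_isInternal (NonposGrCoalg.isInternal (𝓒 := 𝓒)) V.isInternal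
  coact := (TensorProduct.assoc k C C V.carrier).toLinearMap ∘ₗ
    (Coalgebra.comul (R := k) (A := C)).rTensor V.carrier
  coact_mem i x hx := by
    refine tmul_mem_assoc_symm_tensorGr (map_mem_tensorGr (g := LinearMap.id) (a := 0) (b := 0)
      (fun j c hc => ?_) (fun j v hv => by simpa using hv) (by omega) hx)
    rw [zero_add]
    exact NonposGrCoalg.comul_mem j c hc
  coassoc := by
    refine TensorProduct.ext' fun c v => ?_
    have key : ∀ t : C ⊗[k] C, TensorProduct.assoc k C C (C ⊗[k] V.carrier)
        ((Coalgebra.comul (R := k) (A := C)).rTensor (C ⊗[k] V.carrier)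
          (TensorProduct.assoc k C C V.carrier (t ⊗ₜ v))) =
        (((TensorProduct.mk k C V.carrier).flip v).lTensor C).lTensor C
          (TensorProduct.assoc k C C C ((Coalgebra.comul (R := k) (A := C)).rTensor C t)) := by
      intro t
      induction t with
      | zero => simp
      | add x y hx hy => simp only [map_add, add_tmul, hx, hy]
      | tmul a b =>
        simp only [assoc_tmul, LinearMap.rTensor_tmul]
        generalize Coalgebra.comul (R := k) a = y
        induction y with
        | zero => simp
        | add x y hx hy => simp only [map_add, add_tmul, hx, hy]
        | tmul x c => simp
    have key' : ∀ t : C ⊗[k] C, ((TensorProduct.assoc k C C V.carrier).toLinearMap ∘ₗ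
          (Coalgebra.comul (R := k) (A := C)).rTensor V.carrier).lTensor C
            (TensorProduct.assoc k C C V.carrier (t ⊗ₜ v)) =
        (((TensorProduct.mk k C V.carrier).flip v).lTensor C).lTensor C
          ((Coalgebra.comul (R := k) (A := C)).lTensor C t) := by
      intro t
      induction t with
      | zero => simp
      | add x y hx hy => simp only [map_add, add_tmul, hx, hy]
      | tmul a b =>
        simp only [assoc_tmul, LinearMap.lTensor_tmul, LinearMap.comp_apply,
          LinearMap.rTensor_tmul, LinearEquiv.coe_coe]
        generalize Coalgebra.comul (R := k) b = y
        induction y with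
        | zero => simp
        | add x y hx hy => simp only [map_add, add_tmul, tmul_add, hx, hy]
        | tmul x c => simp
    refine (key _).trans (Eq.trans ?_ (key' _).symm)
    rw [Coalgebra.coassoc_apply]
  counit := by
    refine TensorProduct.ext' fun c v => ?_
    have key : ∀ t : C ⊗[k] C, (Coalgebra.counit (R := k) (A := C)).rTensor (C ⊗[k] V.carrier)
          (TensorProduct.assoc k C C V.carrier (t ⊗ₜ v)) =
        ((TensorProduct.mk k C V.carrier).flip v).lTensor k
          ((Coalgebra.counit (R := k) (A := C)).rTensor C t) := by
      intro t
      induction t with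
      | zero => simp
      | add x y hx hy => simp only [map_add, add_tmul, hx, hy]
      | tmul a b => simp
    refine (key _).trans ?_
    rw [Coalgebra.rTensor_counit_comul]
    simp

/-- The counit `C ⊗ V → V`. -/
noncomputable def GrLComod.cofreeCounit (V : GrVect k) : C ⊗[k] V.carrier →ₗ[k] V.carrier :=
  (TensorProduct.lid k V.carrier).toLinearMap ∘ₗ
    (Coalgebra.counit (R := k) (A := C)).rTensor V.carrier

omit [NonposGrCoalg 𝓒] in
theorem GrLComod.cofreeCounit_tmul (V : GrVect k) (c : C) (v : V.carrier) :
    cofreeCounit V (c ⊗ₜ[k] v) = Coalgebra.counit (R := k) c • v := by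
  simp [cofreeCounit]

theorem GrLComod.cofreeCounit_mem (V : GrVect k) {p : ℤ} {t : C ⊗[k] V.carrier}
    (ht : t ∈ tensorGr 𝓒 V.gr p) : cofreeCounit V t ∈ V.gr p := by
  induction ht using Submodule.span_induction with
  | zero => simp
  | add x y _ _ hx hy => rw [map_add]; exact add_mem hx hy
  | smul c x _ hx => rw [map_smul]; exact Submodule.smul_mem _ c hx
  | mem t ht =>
    obtain ⟨j, i, hij, w, hw, v, hv, rfl⟩ := ht
    rw [cofreeCounit_tmul]
    by_cases hj : j = 0
    · subst hj
      rw [zero_add] at hij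
      exact Submodule.smul_mem _ _ (hij ▸ hv)
    · rw [NonposGrCoalg.counit_eq_zero j hj w hw, zero_smul]
      exact zero_mem _

/-- The other counit law of `C`; it makes homomorphisms into C ⊗ V determined by their composite
with the counit. -/
theorem GrLComod.lTensor_cofreeCounit_coact (V : GrVect k) (t : C ⊗[k] V.carrier) :
    (cofreeCounit V).lTensor C ((cofree 𝓒 V).coact t) = t := by
  induction t with
  | zero => exact map_zero _
  | add x y hx hy =>
    rw [map_add, map_add, hx, hy]
  | tmul c v =>
    have key : ∀ t : C ⊗[k] C, (cofreeCounit V).lTensor C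
        (TensorProduct.assoc k C C V.carrier (t ⊗ₜ v)) =
        (TensorProduct.rid k C ((Coalgebra.counit (R := k) (A := C)).lTensor C t) |>
          (TensorProduct.mk k C V.carrier).flip v) := by
      intro t
      induction t with
      | zero => simp
      | add x y hx hy => simp only [map_add, add_tmul, hx, hy]
      | tmul a b => simp [cofreeCounit_tmul]
    refine (key _).trans ?_
    rw [Coalgebra.lTensor_counit_comul]
    simp

/-- The comodule homomorphism into a cofree comodule induced by a linear map of degree `0`. -/
noncomputable def GrLComod.toCofree (Y : GrLComod 𝓒) (V : GrVect k)
    (g : Y.carrier →ₗ[k] V.carrier) (hg : ∀ p, ∀ y ∈ Y.gr p, g y ∈ V.gr p) :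
    Y ⟶ cofree 𝓒 V where
  lin := g.lTensor C ∘ₗ Y.coact
  map_gr i y hy := map_mem_tensorGr (g := g) (f := LinearMap.id) (a := 0) (b := 0)
      (fun j v hv => by simpa using hv)
      (fun j v hv => by rw [zero_add]; exact hg j v hv) (by omega) (Y.coact_mem i y hy)
  map_coact y := by
    have h2 := LinearMap.congr_fun Y.coassoc y
    simp only [LinearMap.comp_apply, LinearEquiv.coe_coe] at h2
    have h1 : TensorProduct.assoc k C C V.carrier
        ((Coalgebra.comul (R := k) (A := C)).rTensor V.carrier (g.lTensor C (Y.coact y))) =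
        (g.lTensor C).lTensor C (TensorProduct.assoc k C C Y.carrier
          ((Coalgebra.comul (R := k) (A := C)).rTensor Y.carrier (Y.coact y))) := by
      rw [← LinearMap.comp_apply, LinearMap.rTensor_comp_lTensor,
        ← LinearMap.lTensor_comp_rTensor, LinearMap.comp_apply]
      generalize (Coalgebra.comul (R := k) (A := C)).rTensor Y.carrier (Y.coact y) = t
      induction t with
      | zero => simp
      | add x y hx hy => simp only [map_add, hx, hy]
      | tmul x c =>
        induction x with
        | zero => simp
        | add x y hx hy => simp only [map_add, add_tmul, hx, hy]
        | tmul x c => simp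
    refine h1.trans ?_
    rw [h2, ← LinearMap.lTensor_comp_apply]

/-- Cofreeness turns the extension problem into one for linear maps of degree 0. -/
theorem GrLComod.isInjectiveObj_cofree (V : GrVect k) :
    IsInjectiveObj (GrLComod.forget 𝓒) (cofree 𝓒 V) := by
  intro X Y i f hi
  obtain ⟨g, hg, hgi⟩ := GrVect.exists_extension (V := V) i.map_gr hi
    (g := cofreeCounit V ∘ₗ f.lin) fun p x hx => cofreeCounit_mem V (f.map_gr p x hx)
  refine ⟨Y.toCofree V g hg, GrLComod.hom_ext (LinearMap.ext fun x => ?_)⟩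
  change g.lTensor C (Y.coact (i.lin x)) = f.lin x
  rw [i.map_coact, ← LinearMap.lTensor_comp_apply, hgi, LinearMap.lTensor_comp_apply,
    ← f.map_coact]
  exact lTensor_cofreeCounit_coact V _

theorem GrLComod.cofree_isBddAbove {V : GrVect k} (hV : V.IsBddAbove) :
    (cofree 𝓒 V).IsBddAbove :=
  GrVect.isBddAbove_of_tensor (coalgGrVect_isBddAbove 𝓒) hV LinearMap.id (fun _ _ h => h)
    fun _ _ h => h

/-- Bounded-above graded left comodules have resolutions by bounded-above cofree comodules. -/
theorem GrLComod.exists_cofree_injRes (X : GrLComod 𝓒) (hX : X.IsBddAbove) :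
    ∃ I : InjRes (GrLComod.forget 𝓒) X,
      ∀ n, ∃ V : GrVect k, V.IsBddAbove ∧ I.obj n = cofree 𝓒 V := by
  refine exists_injRes (P := fun Z : GrLComod 𝓒 => Z.IsBddAbove)
    (Q := fun I => ∃ V : GrVect k, V.IsBddAbove ∧ I = cofree 𝓒 V) ?_ ?_ hX
  · rintro _ ⟨V, -, rfl⟩
    exact isInjectiveObj_cofree V
  · intro Z hZ
    -- Again the coaction is the embedding and the counit its linear left inverse.
    obtain ⟨Q, p, hp, hker⟩ := HomalgCat.exists_coker (F := GrLComod.forget 𝓒)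
      (Z.toCofree Z.toGrVect LinearMap.id fun _ _ h => h)
    refine ⟨_, _, Q, p, ⟨Z.toGrVect, hZ, rfl⟩, ?_, LinearMap.exact_iff.mpr hker, hp,
      GrVect.IsBddAbove.of_surjective p.map_gr hp (cofree_isBddAbove hZ)⟩
    refine Function.LeftInverse.injective (g := cofreeCounit Z.toGrVect) fun z => ?_
    have h := LinearMap.congr_fun Z.counit z
    change cofreeCounit Z.toGrVect (LinearMap.lTensor C LinearMap.id (Z.coact z)) = z
    rw [LinearMap.lTensor_id, LinearMap.id_apply]
    simp only [LinearMap.comp_apply] at h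
    simp [cofreeCounit, h]

end Left

end Comodules

/-! ### The grading of the dual coalgebra. -/

section DualCoalgebra

variable {k : Type u} [Field k] {A : Type u} [Ring A] [Algebra k A] (𝓐 : ℤ → Submodule k A)
  [GradedAlgebra 𝓐]

theorem dual_ext_homogeneous {f g : grDual 𝓐}
    (h : ∀ i, ∀ a ∈ 𝓐 i, (f : Module.Dual k A) a = (g : Module.Dual k A) a) : f = g := by
  classical
  ext a
  induction a using DirectSum.Decomposition.inductionOn 𝓐 with
  | zero => simp
  | add x y hx hy => simp [hx, hy]
  | homogeneous a => exact h _ _ a.2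

theorem extDual_apply (i : ℤ) (f : Module.Dual k (𝓐 i)) (a : A) :
    (extDual 𝓐 i f : Module.Dual k A) a = f (projGr 𝓐 i a) := by
  rw [extDual, LinearMap.comp_apply]

/-- The projection of the graded dual onto its degree `i` part. -/
noncomputable def dualProj (i : ℤ) : grDual 𝓐 →ₗ[k] grDual 𝓐 where
  toFun f := extDual 𝓐 (-i) ((f : Module.Dual k A) ∘ₗ (𝓐 (-i)).subtype)
  map_add' f g := by
    ext a
    simp [extDual_apply]
  map_smul' c f := by
    ext a
    simp [extDual_apply]

theorem dualProj_apply (i : ℤ) (f : grDual 𝓐) (a : A) :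
    (dualProj 𝓐 i f : Module.Dual k A) a = (f : Module.Dual k A) (projGr 𝓐 (-i) a) :=
  extDual_apply 𝓐 _ _ _

/-- The projection to degree i restricts a functional to A^{-i} and extends it by zero. -/
theorem dualGr_isInternal : DirectSum.IsInternal (dualGr 𝓐) := by
  let _ : AddCommGroup (grDual 𝓐) := Module.addCommMonoidToAddCommGroup k
  refine isInternal_of_proj (dualProj 𝓐) ?_ ?_ ?_
  · intro i f hf
    refine dual_ext_homogeneous 𝓐 fun j a ha => ?_
    rw [dualProj_apply]
    by_cases hj : j = -i
    · subst hj
      rw [projGr_of_mem 𝓐 ha]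
    · have h0 : (f : Module.Dual k A) a = 0 := hf j hj a ha
      rw [projGr_of_mem_ne 𝓐 hj ha, h0]
      simp
  · intro i j hij f hf
    refine dual_ext_homogeneous 𝓐 fun l a ha => ?_
    rw [dualProj_apply]
    by_cases hl : l = -i
    · subst hl
      rw [projGr_of_mem 𝓐 ha]
      exact hf _ (by omega) a ha
    · rw [projGr_of_mem_ne 𝓐 hl ha]
      simp
  · rintro ⟨f, hf⟩
    induction hf using Submodule.iSup_induction' with
    | mem p f hf => exact Submodule.mem_iSup_of_mem (p := dualGr 𝓐) p hf
    | zero => exact zero_mem _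
    | add f g _ _ hf hg => exact add_mem hf hg

variable [PosFiniteType 𝓐]

instance dualGr_nonposGrCoalg : NonposGrCoalg (dualGr 𝓐) where
  isInternal := dualGr_isInternal 𝓐
  comul_mem _ _ hc := comulDual_mem 𝓐 hc
  -- The counit is evaluation at 1, and 1 has degree 0, where functionals of degree `p ≠ 0` vanish.
  counit_eq_zero p hp f hf := hf 0 (by omega) 1 SetLike.GradedOne.one_mem
  eq_bot_of_pos p hp := (Submodule.eq_bot_iff _).mpr fun f hf =>
    dual_ext_homogeneous 𝓐 fun i a ha => by
      by_cases hi : i = -p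
      · rw [eq_zero_of_neg 𝓐 (by omega) ha]
        simp
      · exact hf i hi a ha

end DualCoalgebra

/-! ### From comodules to modules, without any boundedness. -/

section ComodToMod

variable {k : Type u} [Field k] {A : Type u} [Ring A] [Algebra k A] {𝓐 : ℤ → Submodule k A}
  {V : Type u} [AddCommMonoid V] [Module k V]

/-- In v ⊗ f of total degree j, the value f(a) on a ∈ A^i is nonzero only if deg f = -i, and then
deg v = i + j. -/
theorem canHom_mem_gr {𝓥 : ℤ → Submodule k V} {i j : ℤ} {t : V ⊗[k] grDual 𝓐}
    (ht : t ∈ tensorGr 𝓥 (dualGr 𝓐) j) {a : A} (ha : a ∈ 𝓐 i) :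
    canHom 𝓐 V t a ∈ 𝓥 (i + j) := by
  induction ht using Submodule.span_induction with
  | zero => simp
  | add x y _ _ hx hy => rw [map_add]; exact add_mem hx hy
  | smul c x _ hx => rw [map_smul]; exact Submodule.smul_mem _ c hx
  | mem t ht =>
    obtain ⟨l, q, hlq, v, hv, f, hf, rfl⟩ := ht
    rw [canHom_tmul]
    by_cases hi : i = -q
    · exact Submodule.smul_mem _ _ ((by omega : l = i + j) ▸ hv)
    · have h0 : (f : Module.Dual k A) a = 0 := hf i hi a ha
      rw [h0, zero_smul]
      exact zero_mem _

variable [GradedAlgebra 𝓐] [PosFiniteType 𝓐]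

/-- The comultiplication is dual to the multiplication. Combined with coassociativity this makes the
action read off from a right coaction associative. -/
theorem canHom_canHom_comul (x : V ⊗[k] grDual 𝓐) (a b : A) :
    canHom 𝓐 V (canHom 𝓐 _ ((TensorProduct.assoc k V (grDual 𝓐) (grDual 𝓐)).symm
      ((Coalgebra.comul (R := k) (A := grDual 𝓐)).lTensor V x)) b) a =
      canHom 𝓐 V x (a * b) := by
  induction x with
  | zero => simp
  | add x y hx hy => simp only [map_add, LinearMap.add_apply, hx, hy]
  | tmul v f =>
    rw [LinearMap.lTensor_tmul, canHom_tmul, ← canHom_comul]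
    change _ = (canHom 𝓐 _ (Coalgebra.comul (R := k) f) b : Module.Dual k A) a • v
    generalize Coalgebra.comul (R := k) f = t
    induction t with
    | zero => simp
    | add x y hx hy =>
      simp only [map_add, LinearMap.add_apply, hx, hy, TensorProduct.tmul_add,
        Submodule.coe_add, add_smul]
    | tmul f g =>
      simp only [TensorProduct.assoc_symm_tmul, canHom_tmul, map_smul, LinearMap.smul_apply,
        Submodule.coe_smul, smul_eq_mul, mul_smul]

/-- The counit of the dual is evaluation at 1, so the counit law of a comodule is the unit law of
the action. -/
theorem canHom_one (x : V ⊗[k] grDual 𝓐) :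
    canHom 𝓐 V x 1 = TensorProduct.rid k V
      ((Coalgebra.counit (R := k) (A := grDual 𝓐)).lTensor V x) := by
  induction x with
  | zero => simp
  | add x y hx hy => simp only [map_add, LinearMap.add_apply, hx, hy]
  | tmul v f =>
    rw [canHom_tmul, LinearMap.lTensor_tmul, rid_tmul]
    rfl

variable (𝓐 V) in
/-- The canonical map `DA ⊗ V → Hom(A, V)`, `(f ⊗ v)(a) = f(a) v`. -/
noncomputable def canHomLeft : grDual 𝓐 ⊗[k] V →ₗ[k] A →ₗ[k] V :=
  canHom 𝓐 V ∘ₗ (TensorProduct.comm k (grDual 𝓐) V).toLinearMap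

omit [GradedAlgebra 𝓐] [PosFiniteType 𝓐] in
@[simp]
theorem canHomLeft_tmul (f : grDual 𝓐) (v : V) (a : A) :
    canHomLeft 𝓐 V (f ⊗ₜ v) a = (f : Module.Dual k A) a • v := by
  simp [canHomLeft]

omit [GradedAlgebra 𝓐] [PosFiniteType 𝓐] in
theorem canHomLeft_map {W : Type u} [AddCommMonoid W] [Module k W] (g : V →ₗ[k] W)
    (t : grDual 𝓐 ⊗[k] V) (a : A) :
    canHomLeft 𝓐 W (g.lTensor _ t) a = g (canHomLeft 𝓐 V t a) := by
  induction t with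
  | zero => simp
  | add x y hx hy => simp [hx, hy]
  | tmul v f => simp

/-- Here `a` is evaluated before `b`, the reverse of the order for right coactions, so a left
coaction yields a right action. -/
theorem canHomLeft_canHomLeft_comul (x : grDual 𝓐 ⊗[k] V) (a b : A) :
    canHomLeft 𝓐 V (canHomLeft 𝓐 _ (TensorProduct.assoc k (grDual 𝓐) (grDual 𝓐) V
      ((Coalgebra.comul (R := k) (A := grDual 𝓐)).rTensor V x)) a) b =
      canHomLeft 𝓐 V x (a * b) := by
  induction x with
  | zero => simp
  | add x y hx hy => simp only [map_add, LinearMap.add_apply, hx, hy]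
  | tmul f v =>
    rw [LinearMap.rTensor_tmul, canHomLeft_tmul, ← canHom_comul]
    change _ = (canHom 𝓐 _ (Coalgebra.comul (R := k) f) b : Module.Dual k A) a • v
    generalize Coalgebra.comul (R := k) f = t
    induction t with
    | zero => simp
    | add x y hx hy =>
      simp only [map_add, LinearMap.add_apply, hx, hy, TensorProduct.add_tmul,
        Submodule.coe_add, add_smul]
    | tmul f g =>
      simp only [TensorProduct.assoc_tmul, canHomLeft_tmul, canHom_tmul, map_smul,
        LinearMap.smul_apply, Submodule.coe_smul, smul_eq_mul, smul_smul]
      rw [mul_comm]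

theorem canHomLeft_one (x : grDual 𝓐 ⊗[k] V) :
    canHomLeft 𝓐 V x 1 = TensorProduct.lid k V
      ((Coalgebra.counit (R := k) (A := grDual 𝓐)).rTensor V x) := by
  induction x with
  | zero => simp
  | add x y hx hy => simp only [map_add, LinearMap.add_apply, hx, hy]
  | tmul f v =>
    rw [canHomLeft_tmul, LinearMap.rTensor_tmul, lid_tmul]
    rfl

/-- The graded left module underlying a graded right comodule. -/
noncomputable abbrev GrRComod.toMod (X : GrRComod (dualGr 𝓐)) : GrLMod 𝓐 where
  toGrVect := X.toGrVect
  act := AlgHom.ofLinearMap (canHom 𝓐 X.carrier ∘ₗ X.coact).flip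
    (by
      refine LinearMap.ext fun x => ?_
      have h := LinearMap.congr_fun X.counit x
      simp only [LinearMap.comp_apply] at h
      simp [canHom_one, h])
    (fun a b => by
      refine LinearMap.ext fun x => ?_
      have h := LinearMap.congr_fun X.coassoc x
      simp only [LinearMap.comp_apply, LinearEquiv.coe_coe, ← LinearEquiv.eq_symm_apply] at h
      change canHom 𝓐 _ (X.coact x) (a * b) = canHom 𝓐 _ (X.coact (canHom 𝓐 _ (X.coact x) b)) a
      rw [← canHom_map, h, canHom_canHom_comul])
  act_mem i j a ha x hx := canHom_mem_gr (X.coact_mem j x hx) ha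

/-- The graded right module underlying a graded left comodule. -/
noncomputable abbrev GrLComod.toMod (X : GrLComod (dualGr 𝓐)) : GrRMod 𝓐 where
  toGrVect := X.toGrVect
  act := AlgHom.ofLinearMap ((canHomLeft 𝓐 X.carrier ∘ₗ X.coact).flip ∘ₗ
      (MulOpposite.opLinearEquiv k).symm.toLinearMap)
    (by
      refine LinearMap.ext fun x => ?_
      have h := LinearMap.congr_fun X.counit x
      simp only [LinearMap.comp_apply] at h
      simp [canHomLeft_one, h])
    (fun a b => by
      refine LinearMap.ext fun x => ?_
      have h := LinearMap.congr_fun X.coassoc x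
      simp only [LinearMap.comp_apply, LinearEquiv.coe_coe] at h
      change canHomLeft 𝓐 _ (X.coact x) (b.unop * a.unop) =
        canHomLeft 𝓐 _ (X.coact (canHomLeft 𝓐 _ (X.coact x) b.unop)) a.unop
      rw [← canHomLeft_map, ← h, canHomLeft_canHomLeft_comul])
  act_mem i j a ha x hx := canHom_mem_gr (comm_mem_tensorGr (X.coact_mem j x hx)) ha

theorem GrRComod.toMod_act (X : GrRComod (dualGr 𝓐)) (a : A) (x : X.carrier) :
    X.toMod.act a x = canHom 𝓐 _ (X.coact x) a := rfl

theorem GrLComod.toMod_act (X : GrLComod (dualGr 𝓐)) (a : A) (x : X.carrier) :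
    X.toMod.act (MulOpposite.op a) x = canHomLeft 𝓐 _ (X.coact x) a := rfl

/-- The module homomorphism underlying a comodule homomorphism. -/
noncomputable def GrRComod.toModMap {X Y : GrRComod (dualGr 𝓐)} (f : X ⟶ Y) :
    X.toMod ⟶ Y.toMod where
  lin := f.lin
  map_gr := f.map_gr
  map_act a x := by rw [toMod_act, toMod_act, f.map_coact, canHom_map]

/-- The module homomorphism underlying a comodule homomorphism. -/
noncomputable def GrLComod.toModMap {X Y : GrLComod (dualGr 𝓐)} (f : X ⟶ Y) :
    X.toMod ⟶ Y.toMod where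
  lin := f.lin
  map_gr := f.map_gr
  map_act a x := by
    obtain ⟨a, rfl⟩ := MulOpposite.op_surjective a
    rw [toMod_act, toMod_act, f.map_coact, canHomLeft_map]

/-- A bounded-above module is the module underlying its comodule. -/
noncomputable def GrLMod.toModToComod (M : GrLMod 𝓐) (hM : M.IsBddAbove) :
    M ⟶ (M.toComod hM).toMod where
  lin := LinearMap.id
  map_gr _ _ h := h
  map_act a x := by
    rw [GrRComod.toMod_act]
    exact (LinearMap.congr_fun (canHom_coactOf 𝓐
      (φ := M.act.toLinearMap.flip)
      (eventually_zero_of_isBddAbove hM _ M.act_mem) x) a).symm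

/-- A bounded-above module is the module underlying its comodule. -/
noncomputable def GrRMod.toModToComod (M : GrRMod 𝓐) (hM : M.IsBddAbove) :
    M ⟶ (M.toComod hM).toMod where
  lin := LinearMap.id
  map_gr _ _ h := h
  map_act a x := by
    obtain ⟨a, rfl⟩ := MulOpposite.op_surjective a
    rw [GrLComod.toMod_act]
    -- The left coaction was obtained by swapping the factors, and `canHomLeft` swaps them back.
    refine Eq.trans ?_ (congrArg (canHom 𝓐 _ · a) (TensorProduct.comm_comm ..).symm)
    exact (LinearMap.congr_fun (canHom_coactOf 𝓐
      (φ := (M.act.toLinearMap ∘ₗ (MulOpposite.opLinearEquiv k).toLinearMap).flip)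
      (eventually_zero_of_isBddAbove hM _ M.act_mem) x) a).symm

end ComodToMod

/-! ### Graded bimodules, and direct sums along a diagonal r + s = n. -/

section Bimodules

variable {k : Type u} [Field k] {A : Type u} [Ring A] [Algebra k A] {𝓐 : ℤ → Submodule k A}

theorem GrBimod.hom_ext {X Y : GrBimod 𝓐} {f g : X ⟶ Y} (h : f.lin = g.lin) : f = g :=
  GrBimod.Hom.ext h

/-- The difference of two homomorphisms. -/
def GrBimod.homSub {X Y : GrBimod 𝓐} (f g : X ⟶ Y) : X ⟶ Y where
  lin := f.lin - g.lin
  map_gr i x hx := sub_mem (f.map_gr i x hx) (g.map_gr i x hx)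
  map_lact a x := by simp [f.map_lact, g.map_lact]
  map_ract a x := by simp [f.map_ract, g.map_ract]

/-- The action on the quotient by an invariant subspace. -/
def quotAct {B V : Type u} [Ring B] [Algebra k B] [AddCommGroup V] [Module k V]
    (act : B →ₐ[k] Module.End k V) (S : Submodule k V) (h : ∀ a, ∀ x ∈ S, act a x ∈ S) :
    B →ₐ[k] Module.End k (V ⧸ S) :=
  AlgHom.ofLinearMap
    { toFun := fun a => S.mapQ S (act a) (h a)
      map_add' := fun a b => by ext; simp
      map_smul' := fun a b => by ext; simp }
    (by ext; simp) (fun a b => by ext; simp)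

/-- The quotient of a graded bimodule by a graded subbimodule. -/
abbrev GrBimod.quot (X : GrBimod 𝓐) (S : Submodule k X.carrier)
    (hS : ∀ x ∈ S, ∀ i, X.proj i x ∈ S) (hl : ∀ a, ∀ x ∈ S, X.lact a x ∈ S)
    (hr : ∀ a, ∀ x ∈ S, X.ract a x ∈ S) : GrBimod 𝓐 where
  toGrVect := X.toGrVect.quot S hS
  lact := quotAct X.lact S hl
  ract := quotAct X.ract S hr
  lact_mem := by
    rintro i j a ha _ ⟨x, hx, rfl⟩
    exact Submodule.mem_map_of_mem (f := S.mkQ) (X.lact_mem i j a ha x hx)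
  ract_mem := by
    rintro i j a ha _ ⟨x, hx, rfl⟩
    exact Submodule.mem_map_of_mem (f := S.mkQ) (X.ract_mem i j a ha x hx)
  lact_ract a b x := by
    obtain ⟨x, rfl⟩ := S.mkQ_surjective x
    exact congrArg S.mkQ (X.lact_ract a b x)

/-- The projection onto the quotient. -/
def GrBimod.quotMk (X : GrBimod 𝓐) (S : Submodule k X.carrier)
    (hS : ∀ x ∈ S, ∀ i, X.proj i x ∈ S) (hl : ∀ a, ∀ x ∈ S, X.lact a x ∈ S)
    (hr : ∀ a, ∀ x ∈ S, X.ract a x ∈ S) : X ⟶ X.quot S hS hl hr where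
  lin := S.mkQ
  map_gr _ _ hx := Submodule.mem_map_of_mem hx
  map_lact _ _ := rfl
  map_ract _ _ := rfl

theorem GrBimod.exists_factor {X Q Z : GrBimod 𝓐} (p : X ⟶ Q) (g : X ⟶ Z)
    (hp : Function.Surjective p.lin) (h : LinearMap.ker p.lin ≤ LinearMap.ker g.lin) :
    ∃ e : Q ⟶ Z, p ≫ e = g := by
  obtain ⟨s, hs⟩ := p.lin.exists_rightInverse_of_surjective (LinearMap.range_eq_top.mpr hp)
  have hs' : ∀ x, g.lin (s (p.lin x)) = g.lin x := fun x => by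
    rw [← sub_eq_zero, ← map_sub]
    refine h ?_
    rw [LinearMap.mem_ker, map_sub, sub_eq_zero]
    exact LinearMap.congr_fun hs (p.lin x)
  refine ⟨⟨g.lin ∘ₗ s, fun i y hy => ?_, fun a y => ?_, fun a y => ?_⟩,
    GrBimod.hom_ext (LinearMap.ext hs')⟩
  · obtain ⟨x, hx, rfl⟩ := GrVect.exists_mem_of_surjective p.map_gr hp hy
    rw [LinearMap.comp_apply, hs']
    exact g.map_gr i x hx
  · obtain ⟨x, rfl⟩ := hp y
    rw [← p.map_lact, LinearMap.comp_apply, LinearMap.comp_apply, hs', hs', g.map_lact]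
  · obtain ⟨x, rfl⟩ := hp y
    rw [← p.map_ract, LinearMap.comp_apply, LinearMap.comp_apply, hs', hs', g.map_ract]

instance GrBimod.homalgCat : HomalgCat (GrBimod.forget 𝓐) where
  exists_sub f g := ⟨GrBimod.homSub f g, rfl⟩
  exists_coimage {X Y} d := by
    refine ⟨X.quot (LinearMap.ker d.lin) (GrVect.proj_mem_ker d.map_gr) (fun a x hx => ?_)
      (fun a x hx => ?_), X.quotMk _ _ _ _, Submodule.mkQ_surjective _, Submodule.ker_mkQ _⟩
    · rw [LinearMap.mem_ker, d.map_lact, LinearMap.mem_ker.mp hx, map_zero]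
    · rw [LinearMap.mem_ker, d.map_ract, LinearMap.mem_ker.mp hx, map_zero]
  exists_coker {X Y} d := by
    refine ⟨Y.quot (LinearMap.range d.lin) (GrVect.proj_mem_range d.map_gr) ?_ ?_,
      Y.quotMk _ _ _ _, Submodule.mkQ_surjective _, Submodule.ker_mkQ _⟩
    · rintro a _ ⟨x, rfl⟩
      exact ⟨X.lact a x, d.map_lact a x⟩
    · rintro a _ ⟨x, rfl⟩
      exact ⟨X.ract a x, d.map_ract a x⟩
  exists_factor p g hp h := GrBimod.exists_factor p g hp h

variable (B : ℕ → ℕ → GrBimod 𝓐) (n : ℕ)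

/-- The families supported on the diagonal `r + s = n`. -/
def diagSub : Submodule k (∀ r s : ℕ, (B r s).carrier) where
  carrier := {x | ∀ r s, r + s ≠ n → x r s = 0}
  add_mem' hx hy r s h := by simp [hx r s h, hy r s h]
  zero_mem' _ _ _ := rfl
  smul_mem' c x hx r s h := by simp [hx r s h]

variable {B n} in
/-- The componentwise action of a family of linear maps. -/
def diagMap {B' : ℕ → ℕ → GrBimod 𝓐} (f : ∀ r s, (B r s).carrier →ₗ[k] (B' r s).carrier) :
    diagSub B n →ₗ[k] diagSub B' n where
  toFun x := ⟨fun r s => f r s (x.1 r s), fun r s h => by simp [x.2 r s h]⟩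
  map_add' x y := by ext; simp
  map_smul' c x := by ext; simp

/-- A componentwise algebra action. -/
def diagAct {D : Type u} [Ring D] [Algebra k D]
    (act : ∀ r s, D →ₐ[k] Module.End k (B r s).carrier) : D →ₐ[k] Module.End k (diagSub B n) :=
  AlgHom.ofLinearMap
    { toFun := fun a => diagMap fun r s => act r s a
      map_add' := fun a b => by ext; simp [diagMap]
      map_smul' := fun a b => by ext; simp [diagMap] }
    (by ext; simp [diagMap]) (fun a b => by ext; simp [diagMap])

/-- The degree `p` part of the diagonal sum. -/
def diagGr (p : ℤ) : Submodule k (diagSub B n) where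
  carrier := {x | ∀ r s, x.1 r s ∈ (B r s).gr p}
  add_mem' hx hy r s := add_mem (hx r s) (hy r s)
  zero_mem' _ _ := zero_mem _
  smul_mem' c _ hx r s := Submodule.smul_mem _ c (hx r s)

/-- The family with a single component. -/
def diagSingle {r s : ℕ} (h : r + s = n) : (B r s).carrier →ₗ[k] diagSub B n :=
  (LinearMap.single k (fun r => ∀ s, (B r s).carrier) r ∘ₗ
    LinearMap.single k (fun s => (B r s).carrier) s).codRestrict _ fun x r' s' h' => by
      by_cases hr : r' = r
      · subst hr
        by_cases hs : s' = s
        · subst hs; exact absurd h h'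
        · simp [hs]
      · simp [hr]

theorem diagSingle_apply {r s r' s' : ℕ} (h : r + s = n) (x : (B r s).carrier) :
    (diagSingle B n h x).1 r' s' =
      (Pi.single r (Pi.single s x) : ∀ r s, (B r s).carrier) r' s' := rfl

theorem diagSingle_apply_same {r s : ℕ} (h : r + s = n) (x : (B r s).carrier) :
    (diagSingle B n h x).1 r s = x := by
  simp [diagSingle_apply]

theorem diagSingle_apply_ne {r s r' s' : ℕ} (h : r + s = n) (x : (B r s).carrier)
    (h' : r' ≠ r ∨ s' ≠ s) : (diagSingle B n h x).1 r' s' = 0 := by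
  by_cases hr : r' = r
  · subst hr
    have hs : s' ≠ s := by simpa using h'
    simp [diagSingle_apply, hs]
  · simp [diagSingle_apply, hr]

theorem diagSingle_mem {r s : ℕ} (h : r + s = n) {p : ℤ} {x : (B r s).carrier}
    (hx : x ∈ (B r s).gr p) : diagSingle B n h x ∈ diagGr B n p := by
  intro r' s'
  by_cases h' : r' ≠ r ∨ s' ≠ s
  · rw [diagSingle_apply_ne B n h x h']
    exact zero_mem _
  · simp only [not_or, not_not] at h'
    obtain ⟨rfl, rfl⟩ := h'
    rwa [diagSingle_apply_same]

variable {B} in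
theorem diagMap_diagSingle {B' : ℕ → ℕ → GrBimod 𝓐}
    (f : ∀ r s, (B r s).carrier →ₗ[k] (B' r s).carrier) {r s : ℕ} (h : r + s = n)
    (x : (B r s).carrier) : diagMap f (diagSingle B n h x) = diagSingle B' n h (f r s x) := by
  refine Subtype.ext (funext₂ fun r' s' => ?_)
  change f r' s' ((diagSingle B n h x).1 r' s') = _
  by_cases h' : r' ≠ r ∨ s' ≠ s
  · rw [diagSingle_apply_ne B n h x h', diagSingle_apply_ne B' n h _ h', map_zero]
  · simp only [not_or, not_not] at h'
    obtain ⟨rfl, rfl⟩ := h'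
    rw [diagSingle_apply_same, diagSingle_apply_same]

/-- The diagonal is finite, so every family is a finite sum of families with a single component,
each of which splits into homogeneous pieces. An infinite product of graded spaces would not have
this property. -/
theorem diagGr_isInternal : DirectSum.IsInternal (diagGr B n) := by
  refine isInternal_of_proj (fun i => diagMap fun r s => (B r s).proj i) ?_ ?_ ?_
  · intro i x hx
    exact Subtype.ext (funext₂ fun r s => GrVect.proj_of_mem (hx r s))
  · intro i j hij x hx
    exact Subtype.ext (funext₂ fun r s => GrVect.proj_of_mem_ne hij (hx r s))
  · intro x
    -- The diagonal is parametrised by r ≤ n, so the truncated subtraction n - r is a true one.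
    have hsum : x = ∑ r : Fin (n + 1),
        diagSingle B n (r := r) (s := n - r) (by omega) (x.1 r (n - r)) := by
      refine Subtype.ext (funext₂ fun r s => ?_)
      rw [AddSubmonoidClass.coe_finsetSum, Finset.sum_apply, Finset.sum_apply]
      by_cases h : r + s = n
      · obtain rfl : s = n - r := by omega
        rw [Finset.sum_eq_single ⟨r, by omega⟩]
        · exact (diagSingle_apply_same B n _ _).symm
        · intro r' _ hr'
          refine diagSingle_apply_ne B n _ _ (Or.inl fun h => hr' (Fin.ext h.symm))
        · simp
      · rw [x.2 r s h]
        refine (Finset.sum_eq_zero fun r' _ => ?_).symm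
        exact diagSingle_apply_ne B n _ _ (by omega)
    rw [hsum]
    refine sum_mem fun r _ => ?_
    generalize x.1 r (n - r) = y
    induction y using GrVect.inductionOn with
    | zero => rw [map_zero]; exact zero_mem _
    | homogeneous i y hy =>
      exact Submodule.mem_iSup_of_mem i (diagSingle_mem B n _ hy)
    | add y z hy hz => rw [map_add]; exact add_mem hy hz

/-- The direct sum of the bimodules `B r s` with `r + s = n`. -/
abbrev diagSum : GrBimod 𝓐 where
  carrier := diagSub B n
  gr := diagGr B n
  isInternal := diagGr_isInternal B n
  lact := diagAct B n fun r s => (B r s).lact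
  ract := diagAct B n fun r s => (B r s).ract
  lact_mem i j a ha _ hx r s := (B r s).lact_mem i j a ha _ (hx r s)
  ract_mem i j a ha _ hx r s := (B r s).ract_mem i j a ha _ (hx r s)
  lact_ract a b x := Subtype.ext (funext₂ fun r s => (B r s).lact_ract a b (x.1 r s))

/-- The projection onto a component. -/
def diagProj (r s : ℕ) : diagSum B n ⟶ B r s where
  lin := LinearMap.proj s ∘ₗ LinearMap.proj r ∘ₗ (diagSub B n).subtype
  map_gr _ _ hx := hx r s
  map_lact _ _ := rfl
  map_ract _ _ := rfl

/-- The inclusion of a component. -/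
noncomputable def diagIncl {r s : ℕ} (h : r + s = n) : B r s ⟶ diagSum B n where
  lin := diagSingle B n h
  map_gr _ _ hx := diagSingle_mem B n h hx
  map_lact a x := (diagMap_diagSingle n (fun r s => (B r s).lact a) h x).symm
  map_ract a x := (diagMap_diagSingle n (fun r s => (B r s).ract a) h x).symm

/-- A homomorphism into the sum is the same as a family of homomorphisms into its components, and
these extend one at a time; off the diagonal the extension is set to 0. -/
theorem isInjectiveObj_diagSum (h : ∀ r s, r + s = n → IsInjectiveObj (GrBimod.forget 𝓐) (B r s)) :
    IsInjectiveObj (GrBimod.forget 𝓐) (diagSum B n) := by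
  intro X Y i f hi
  have h' : ∀ r s, r + s = n → ∃ g : Y ⟶ B r s, i ≫ g = f ≫ diagProj B n r s :=
    fun r s hrs => h r s hrs i _ hi
  choose g hg using h'
  have hg' : ∀ r s hrs x, (g r s hrs).lin (i.lin x) = (f.lin x).1 r s := fun r s hrs x =>
    LinearMap.congr_fun (congrArg GrBimod.Hom.lin (hg r s hrs)) x
  refine ⟨{
    lin :=
      { toFun := fun y => ⟨fun r s => if hrs : r + s = n then (g r s hrs).lin y else 0,
          fun r s hrs => by simp [hrs]⟩
        map_add' := fun x y => Subtype.ext (funext₂ fun r s => by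
          by_cases hrs : r + s = n <;> simp [hrs])
        map_smul' := fun c y => Subtype.ext (funext₂ fun r s => by
          by_cases hrs : r + s = n <;> simp [hrs]) }
    map_gr := fun p y hy r s => ?_
    map_lact := fun a y => Subtype.ext (funext₂ fun r s => ?_)
    map_ract := fun a y => Subtype.ext (funext₂ fun r s => ?_) },
    GrBimod.hom_ext (LinearMap.ext fun x => Subtype.ext (funext₂ fun r s => ?_))⟩
  · change (if hrs : r + s = n then (g r s hrs).lin y else 0) ∈ _
    split_ifs with hrs
    · exact (g r s hrs).map_gr p y hy
    · exact zero_mem _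
  · change (if hrs : r + s = n then (g r s hrs).lin (Y.lact a y) else 0) =
      (B r s).lact a (if hrs : r + s = n then (g r s hrs).lin y else 0)
    split_ifs with hrs
    · exact (g r s hrs).map_lact a y
    · simp
  · change (if hrs : r + s = n then (g r s hrs).lin (Y.ract a y) else 0) =
      (B r s).ract a (if hrs : r + s = n then (g r s hrs).lin y else 0)
    split_ifs with hrs
    · exact (g r s hrs).map_ract a y
    · simp
  · change (if hrs : r + s = n then (g r s hrs).lin (i.lin x) else 0) = (f.lin x).1 r s
    split_ifs with hrs
    · exact hg' r s hrs x
    · exact ((f.lin x).2 r s hrs).symm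

end Bimodules

/-! ### Linear contractions of resolutions over a field. -/

section Contraction

variable {k : Type u} [Field k] {𝒟 : Type (u + 1)} [Category.{u} 𝒟] {F : 𝒟 ⥤ ModuleCat.{u} k}

/-- Project `W` linearly onto the image of `f`, then apply a linear section of `f` onto its image.
-/
theorem exists_pseudoinverse {V W : Type u} [AddCommGroup V] [Module k V] [AddCommGroup W]
    [Module k W] (f : V →ₗ[k] W) : ∃ g : W →ₗ[k] V, ∀ x, f (g (f x)) = f x := by
  obtain ⟨s, hs⟩ := f.rangeRestrict.exists_rightInverse_of_surjective f.range_rangeRestrict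
  obtain ⟨r, hr⟩ := (LinearMap.range f).subtype.exists_leftInverse_of_injective
    (Submodule.ker_subtype _)
  refine ⟨s ∘ₗ r, fun x => ?_⟩
  have h1 : r (f x) = f.rangeRestrict x := LinearMap.congr_fun hr (f.rangeRestrict x)
  have h2 := congrArg Subtype.val (LinearMap.congr_fun hs (f.rangeRestrict x))
  rw [LinearMap.comp_apply, h1]
  exact h2

/-- A resolution of vector spaces is contractible. -/
theorem Res.exists_contraction {M : 𝒟} (I : Res F M) :
    ∃ (ρ : F.obj (I.obj 0) →ₗ[k] F.obj M) (σ : ∀ r, F.obj (I.obj (r + 1)) →ₗ[k] F.obj (I.obj r)),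
      ρ ∘ₗ undl F I.ι = LinearMap.id ∧
      undl F I.ι ∘ₗ ρ + σ 0 ∘ₗ undl F (I.d 0) = LinearMap.id ∧
      ∀ r, undl F (I.d r) ∘ₗ σ r + σ (r + 1) ∘ₗ undl F (I.d (r + 1)) = LinearMap.id := by
  obtain ⟨v, hv⟩ := (undl F I.ι).exists_leftInverse_of_injective
    (LinearMap.ker_eq_bot.mpr I.ι_injective)
  have hv' : ∀ x, v (undl F I.ι x) = x := LinearMap.congr_fun hv
  choose w hw using fun r => exists_pseudoinverse (undl F (I.d r))
  have hd : ∀ r x, undl F (I.d (r + 1)) (undl F (I.d r) x) = 0 := fun r x =>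
    (I.exact_succ r).apply_apply_eq_zero x
  have hd0 : ∀ x, undl F (I.d 0) (undl F I.ι x) = 0 := I.exact_zero.apply_apply_eq_zero
  -- For a pseudoinverse w of d, the element x - w(dx) is a cycle, hence a boundary, and dw fixes
  -- boundaries. The factor 1 - wd in σ turns this into the contraction identity.
  refine ⟨v ∘ₗ (LinearMap.id - w 0 ∘ₗ undl F (I.d 0)),
    fun r => w r ∘ₗ (LinearMap.id - w (r + 1) ∘ₗ undl F (I.d (r + 1))), ?_, ?_, fun r => ?_⟩
  · ext x
    simp [hd0, hv']
  · ext x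
    obtain ⟨m, hm⟩ := (I.exact_zero (x - w 0 (undl F (I.d 0) x))).mp (by simp [hw])
    simp only [LinearMap.add_apply, LinearMap.comp_apply, LinearMap.sub_apply, LinearMap.id_apply,
      hd, map_zero, sub_zero]
    rw [← hm, hv', hm, sub_add_cancel]
  · ext x
    obtain ⟨m, hm⟩ := (I.exact_succ r (x - w (r + 1) (undl F (I.d (r + 1)) x))).mp (by simp [hw])
    simp only [LinearMap.add_apply, LinearMap.comp_apply, LinearMap.sub_apply, LinearMap.id_apply,
      hd, map_zero, sub_zero]
    rw [← hm, hw, hm, sub_add_cancel]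

end Contraction

/-! ### Contraction identities after tensoring. -/

section TensorLemmas

variable {k : Type u} [Field k] {U V W X : Type u} [AddCommGroup U] [Module k U]
  [AddCommGroup V] [Module k V] [AddCommGroup W] [Module k W] [AddCommGroup X] [Module k X]

theorem lTensor_rTensor_apply (f : U →ₗ[k] V) (g : W →ₗ[k] X) (t : U ⊗[k] W) :
    g.lTensor V (f.rTensor W t) = f.rTensor X (g.lTensor U t) := by
  rw [← LinearMap.comp_apply, LinearMap.lTensor_comp_rTensor, ← LinearMap.comp_apply,
    LinearMap.rTensor_comp_lTensor]

theorem rTensor_eq_sub {a : U →ₗ[k] V} {b : V →ₗ[k] U} {c : W →ₗ[k] V} {d : V →ₗ[k] W}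
    (h : a ∘ₗ b + c ∘ₗ d = LinearMap.id) (t : V ⊗[k] X) :
    a.rTensor X (b.rTensor X t) = t - c.rTensor X (d.rTensor X t) := by
  rw [eq_sub_iff_add_eq, ← LinearMap.rTensor_comp_apply, ← LinearMap.rTensor_comp_apply,
    ← LinearMap.add_apply, ← LinearMap.rTensor_add, h, LinearMap.rTensor_id, LinearMap.id_apply]

theorem lTensor_eq_sub {a : U →ₗ[k] V} {b : V →ₗ[k] U} {c : W →ₗ[k] V} {d : V →ₗ[k] W}
    (h : a ∘ₗ b + c ∘ₗ d = LinearMap.id) (t : X ⊗[k] V) :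
    a.lTensor X (b.lTensor X t) = t - c.lTensor X (d.lTensor X t) := by
  rw [eq_sub_iff_add_eq, ← LinearMap.lTensor_comp_apply, ← LinearMap.lTensor_comp_apply,
    ← LinearMap.add_apply, ← LinearMap.lTensor_add, h, LinearMap.lTensor_id, LinearMap.id_apply]

/-- On the kernel of `d'` the map `d ∘ τ` is the identity. -/
theorem lTensor_map_eq {d : U →ₗ[k] V} {τ : V →ₗ[k] U} {τ' : W →ₗ[k] V} {d' : V →ₗ[k] W}
    (h : d ∘ₗ τ + τ' ∘ₗ d' = LinearMap.id) (e : X →ₗ[k] X) {t : X ⊗[k] V}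
    (ht : d'.lTensor X t = 0) : d.lTensor X (TensorProduct.map e τ t) = e.rTensor V t := by
  rw [← LinearMap.rTensor_comp_lTensor, LinearMap.comp_apply, lTensor_rTensor_apply,
    lTensor_eq_sub h, ht, map_zero, sub_zero]

/-- `a ∘ b` is the identity on the kernel of `d`, and likewise for the primed maps. With a the
augmentation and b its retraction, this gives exactness of I ⊗ J at the augmentation. -/
theorem map_map_eq {U' V' W' : Type u} [AddCommGroup U'] [Module k U']
    [AddCommGroup V'] [Module k V'] [AddCommGroup W'] [Module k W'] {a : U →ₗ[k] V}
    {b : V →ₗ[k] U} {c : W →ₗ[k] V} {d : V →ₗ[k] W} (h : a ∘ₗ b + c ∘ₗ d = LinearMap.id)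
    {a' : U' →ₗ[k] V'} {b' : V' →ₗ[k] U'} {c' : W' →ₗ[k] V'} {d' : V' →ₗ[k] W'}
    (h' : a' ∘ₗ b' + c' ∘ₗ d' = LinearMap.id) {t : V ⊗[k] V'} (ht : d.rTensor V' t = 0)
    (ht' : d'.lTensor V t = 0) : TensorProduct.map a a' (TensorProduct.map b b' t) = t := by
  have h3 := lTensor_eq_sub (X := V) h' t
  have h4 := rTensor_eq_sub (X := V') h t
  rw [ht', map_zero, sub_zero] at h3
  rw [ht, map_zero, sub_zero] at h4
  rw [← LinearMap.comp_apply, ← TensorProduct.map_comp, ← LinearMap.rTensor_comp_lTensor,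
    LinearMap.comp_apply, LinearMap.lTensor_comp_apply, h3, LinearMap.rTensor_comp_apply, h4]

end TensorLemmas

/-! ### The total differential in components. -/

section TotD

variable {k : Type u} [Field k] {C : Type u} [AddCommMonoid C] [Module k C] [Coalgebra k C]
  {𝓒 : ℤ → Submodule k C} {M M' : GrRComod 𝓒} {N N' : GrLComod 𝓒}
  (I : InjRes (GrRComod.forget 𝓒) M) (J : InjRes (GrLComod.forget 𝓒) N)
  {I' : InjRes (GrRComod.forget 𝓒) M'} {J' : InjRes (GrLComod.forget 𝓒) N'}

theorem totD_apply_zero_zero (x : ∀ r s : ℕ, (I.obj r).carrier ⊗[k] (J.obj s).carrier) :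
    totD I J x 0 0 = 0 := by
  simp [totD]

theorem totD_apply_zero_succ (x : ∀ r s : ℕ, (I.obj r).carrier ⊗[k] (J.obj s).carrier) (s : ℕ) :
    totD I J x 0 (s + 1) = (J.d s).lin.lTensor _ (x 0 s) := by
  simp [totD]

theorem totD_apply_succ_zero (x : ∀ r s : ℕ, (I.obj r).carrier ⊗[k] (J.obj s).carrier) (r : ℕ) :
    totD I J x (r + 1) 0 = (I.d r).lin.rTensor _ (x r 0) := by
  simp [totD]

theorem totD_apply_succ_succ (x : ∀ r s : ℕ, (I.obj r).carrier ⊗[k] (J.obj s).carrier)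
    (r s : ℕ) : totD I J x (r + 1) (s + 1) = (I.d r).lin.rTensor _ (x r (s + 1)) +
      (-1 : k) ^ (r + 1) • (J.d s).lin.lTensor _ (x (r + 1) s) := by
  simp [totD]

variable {I J} in
/-- The total differential commutes with families commuting with both differentials. -/
theorem totD_comm
    (g : ∀ r s, (I.obj r).carrier ⊗[k] (J.obj s).carrier →ₗ[k]
      (I'.obj r).carrier ⊗[k] (J'.obj s).carrier)
    (h₁ : ∀ r s t, g (r + 1) s ((I.d r).lin.rTensor _ t) = (I'.d r).lin.rTensor _ (g r s t))
    (h₂ : ∀ r s t, g r (s + 1) ((J.d s).lin.lTensor _ t) = (J'.d s).lin.lTensor _ (g r s t))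
    (x : ∀ r s : ℕ, (I.obj r).carrier ⊗[k] (J.obj s).carrier) (r s : ℕ) :
    totD I' J' (fun r s => g r s (x r s)) r s = g r s (totD I J x r s) := by
  rcases r with _ | r <;> rcases s with _ | s
  · rw [totD_apply_zero_zero, totD_apply_zero_zero, map_zero]
  · rw [totD_apply_zero_succ, totD_apply_zero_succ, h₂]
  · rw [totD_apply_succ_zero, totD_apply_succ_zero, h₁]
  · rw [totD_apply_succ_succ, totD_apply_succ_succ, map_add, map_smul, h₁, h₂]

variable {I J} in
theorem totD_apply_mem (S : ∀ r s, Submodule k ((I.obj r).carrier ⊗[k] (J.obj s).carrier))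
    (h₁ : ∀ r s, ∀ t ∈ S r s, (I.d r).lin.rTensor _ t ∈ S (r + 1) s)
    (h₂ : ∀ r s, ∀ t ∈ S r s, (J.d s).lin.lTensor _ t ∈ S r (s + 1))
    {x : ∀ r s : ℕ, (I.obj r).carrier ⊗[k] (J.obj s).carrier} (hx : ∀ r s, x r s ∈ S r s)
    (r s : ℕ) : totD I J x r s ∈ S r s := by
  rcases r with _ | r <;> rcases s with _ | s
  · rw [totD_apply_zero_zero]; exact zero_mem _
  · rw [totD_apply_zero_succ]; exact h₂ _ _ _ (hx _ _)
  · rw [totD_apply_succ_zero]; exact h₁ _ _ _ (hx _ _)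
  · rw [totD_apply_succ_succ]
    exact add_mem (h₁ _ _ _ (hx _ _)) (Submodule.smul_mem _ _ (h₂ _ _ _ (hx _ _)))

theorem totD_eq_zero_of_ne {n : ℕ} {x : ∀ r s : ℕ, (I.obj r).carrier ⊗[k] (J.obj s).carrier}
    (hx : ∀ r s, r + s ≠ n → x r s = 0) (r s : ℕ) (h : r + s ≠ n + 1) : totD I J x r s = 0 := by
  rcases r with _ | r <;> rcases s with _ | s
  · rw [totD_apply_zero_zero]
  · rw [totD_apply_zero_succ, hx _ _ (by omega), map_zero]
  · rw [totD_apply_succ_zero, hx _ _ (by omega), map_zero]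
  · rw [totD_apply_succ_succ, hx _ _ (by omega), hx _ _ (by omega), map_zero, map_zero, smul_zero,
      add_zero]

end TotD

/-! ### The total complex of I ⊗ J as a complex of bimodules, and its contraction. -/

section TotBimod

variable {k : Type u} [Field k] {A : Type u} [Ring A] [Algebra k A] {𝓐 : ℤ → Submodule k A}

variable [GradedAlgebra 𝓐] [PosFiniteType 𝓐]

/-- The bimodule underlying the tensor product of a right and a left comodule. -/
noncomputable abbrev comodBimod (X : GrRComod (dualGr 𝓐)) (Y : GrLComod (dualGr 𝓐)) : GrBimod 𝓐 :=
  tensorBimod X.toMod Y.toMod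

variable {M : GrRComod (dualGr 𝓐)} {N : GrLComod (dualGr 𝓐)}
  (I : InjRes (GrRComod.forget (dualGr 𝓐)) M) (J : InjRes (GrLComod.forget (dualGr 𝓐)) N)

/-- The terms of the total complex of `I ⊗ J`, as bimodules. -/
noncomputable abbrev totBimod (n : ℕ) : GrBimod 𝓐 :=
  diagSum (fun r s => comodBimod (I.obj r) (J.obj s)) n

/-- The differential of the total complex of `I ⊗ J`. -/
noncomputable def totBimodD (n : ℕ) : totBimod I J n ⟶ totBimod I J (n + 1) where
  lin := (totD I J).restrict (p := diagSub (fun r s => comodBimod (I.obj r) (J.obj s)) n)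
    (q := diagSub (fun r s => comodBimod (I.obj r) (J.obj s)) (n + 1))
    fun _ hx => totD_eq_zero_of_ne I J hx
  map_gr p _ hx := totD_apply_mem (fun r s => tensorGr (I.obj r).gr (J.obj s).gr p)
    (fun r s => (tensorBimodMap (GrRComod.toModMap (I.d r)) (𝟙 (J.obj s).toMod)).map_gr p)
    (fun r s => (tensorBimodMap (𝟙 (I.obj r).toMod) (GrLComod.toModMap (J.d s))).map_gr p) hx
  map_lact a x := Subtype.ext (funext₂ fun r s => totD_comm (I' := I) (J' := J)
    (fun r s => (comodBimod (I.obj r) (J.obj s)).lact a)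
    (fun r s t =>
      ((tensorBimodMap (GrRComod.toModMap (I.d r)) (𝟙 (J.obj s).toMod)).map_lact a t).symm)
    (fun r s t =>
      ((tensorBimodMap (𝟙 (I.obj r).toMod) (GrLComod.toModMap (J.d s))).map_lact a t).symm)
    x.1 r s)
  map_ract a x := Subtype.ext (funext₂ fun r s => totD_comm (I' := I) (J' := J)
    (fun r s => (comodBimod (I.obj r) (J.obj s)).ract a)
    (fun r s t =>
      ((tensorBimodMap (GrRComod.toModMap (I.d r)) (𝟙 (J.obj s).toMod)).map_ract a t).symm)
    (fun r s t =>
      ((tensorBimodMap (𝟙 (I.obj r).toMod) (GrLComod.toModMap (J.d s))).map_ract a t).symm)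
    x.1 r s)

theorem totBimodD_val {n : ℕ} (x : (totBimod I J n).carrier) :
    ((totBimodD I J n).lin x).1 = totD I J x.1 := rfl

/-- The contraction of the total complex of `I ⊗ J` built from contractions of `I` and `J`. -/
noncomputable def totContraction
    (e : (I.obj 0).carrier →ₗ[k] (I.obj 0).carrier)
    (σ : ∀ r, (I.obj (r + 1)).carrier →ₗ[k] (I.obj r).carrier)
    (τ : ∀ s, (J.obj (s + 1)).carrier →ₗ[k] (J.obj s).carrier)
    (x : ∀ r s : ℕ, (I.obj r).carrier ⊗[k] (J.obj s).carrier) (r s : ℕ) :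
    (I.obj r).carrier ⊗[k] (J.obj s).carrier :=
  -- The operator is σ ⊗ 1 + e ⊗ τ, where e = 1 - σd in degree 0 is the projection left over from
  -- contracting `I`. The second term lives only in r = 0, where the differential of `J` enters with
  -- sign +1, so no sign is needed.
  (σ r).rTensor _ (x (r + 1) s) + match r with
    | 0 => TensorProduct.map e (τ s) (x 0 (s + 1))
    | _ + 1 => 0

theorem totContraction_zero
    (e : (I.obj 0).carrier →ₗ[k] (I.obj 0).carrier)
    (σ : ∀ r, (I.obj (r + 1)).carrier →ₗ[k] (I.obj r).carrier)
    (τ : ∀ s, (J.obj (s + 1)).carrier →ₗ[k] (J.obj s).carrier)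
    (x : ∀ r s : ℕ, (I.obj r).carrier ⊗[k] (J.obj s).carrier) (s : ℕ) :
    totContraction I J e σ τ x 0 s =
      (σ 0).rTensor _ (x 1 s) + TensorProduct.map e (τ s) (x 0 (s + 1)) := rfl

theorem totContraction_succ
    (e : (I.obj 0).carrier →ₗ[k] (I.obj 0).carrier)
    (σ : ∀ r, (I.obj (r + 1)).carrier →ₗ[k] (I.obj r).carrier)
    (τ : ∀ s, (J.obj (s + 1)).carrier →ₗ[k] (J.obj s).carrier)
    (x : ∀ r s : ℕ, (I.obj r).carrier ⊗[k] (J.obj s).carrier) (r s : ℕ) :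
    totContraction I J e σ τ x (r + 1) s = (σ (r + 1)).rTensor _ (x (r + 2) s) :=
  add_zero _

theorem totContraction_eq_zero_of_ne
    (e : (I.obj 0).carrier →ₗ[k] (I.obj 0).carrier)
    (σ : ∀ r, (I.obj (r + 1)).carrier →ₗ[k] (I.obj r).carrier)
    (τ : ∀ s, (J.obj (s + 1)).carrier →ₗ[k] (J.obj s).carrier) {n : ℕ}
    {x : ∀ r s : ℕ, (I.obj r).carrier ⊗[k] (J.obj s).carrier}
    (hx : ∀ r s, r + s ≠ n + 1 → x r s = 0) (r s : ℕ) (h : r + s ≠ n) :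
    totContraction I J e σ τ x r s = 0 := by
  rcases r with _ | r
  · rw [totContraction_zero, hx _ _ (by omega), hx _ _ (by omega), map_zero, map_zero, add_zero]
  · rw [totContraction_succ, hx _ _ (by omega), map_zero]

section

variable {I J} {e : (I.obj 0).carrier →ₗ[k] (I.obj 0).carrier}
  {σ : ∀ r, (I.obj (r + 1)).carrier →ₗ[k] (I.obj r).carrier}
  {τ : ∀ s, (J.obj (s + 1)).carrier →ₗ[k] (J.obj s).carrier}
  (he : (I.d 0).lin ∘ₗ e = 0)
  (hσ0 : e + σ 0 ∘ₗ (I.d 0).lin = LinearMap.id)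
  (hσ : ∀ r, (I.d r).lin ∘ₗ σ r + σ (r + 1) ∘ₗ (I.d (r + 1)).lin = LinearMap.id)
  (hτ : ∀ s, (J.d s).lin ∘ₗ τ s + τ (s + 1) ∘ₗ (J.d (s + 1)).lin = LinearMap.id)
  (x : ∀ r s : ℕ, (I.obj r).carrier ⊗[k] (J.obj s).carrier)

-- The term e ⊗ τ disappears because d e = 0; what is left is the contraction identity of `I`.
include he hσ in
theorem rTensor_d_totContraction (r s : ℕ) :
    (I.d r).lin.rTensor _ (totContraction I J e σ τ x r s) =
      x (r + 1) s - (σ (r + 1)).rTensor _ ((I.d (r + 1)).lin.rTensor _ (x (r + 1) s)) := by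
  rcases r with _ | r
  · have h : ∀ t, (I.d 0).lin.rTensor (J.obj s).carrier (TensorProduct.map e (τ s) t) = 0 :=
      fun t => by
        rw [← LinearMap.comp_apply, LinearMap.rTensor_comp_map, he]
        simp
    rw [totContraction_zero, map_add, rTensor_eq_sub (hσ 0), h, add_zero]
  · rw [totContraction_succ, rTensor_eq_sub (hσ (r + 1))]

variable {x} (hx : ∀ r s, totD I J x r s = 0)

-- The cycle condition at (1, s + 1) replaces (1 ⊗ d) x(1, s) by (d ⊗ 1) x(0, s + 1), so the first
-- term contributes (σd ⊗ 1) x. The condition at (0, s + 2) makes the second contribute (e ⊗ 1) x,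
-- and σd + e = 1.
include hσ0 hτ hx in
theorem totD_totContraction_zero_succ (s : ℕ) :
    totD I J (totContraction I J e σ τ x) 0 (s + 1) = x 0 (s + 1) := by
  have h1 := hx 1 (s + 1)
  have h2 := hx 0 (s + 2)
  rw [totD_apply_succ_succ, pow_succ, pow_zero, one_mul, neg_one_smul, add_neg_eq_zero] at h1
  rw [totD_apply_zero_succ] at h2
  have h3 : (σ 0).rTensor (J.obj (s + 1)).carrier
      ((I.d 0).lin.rTensor _ (x 0 (s + 1))) = x 0 (s + 1) - e.rTensor _ (x 0 (s + 1)) := by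
    refine rTensor_eq_sub (b := (I.d 0).lin) (c := e) (d := LinearMap.id) ?_ _ |>.trans ?_
    · rw [LinearMap.comp_id, add_comm, hσ0]
    · rw [LinearMap.rTensor_id, LinearMap.id_apply]
  have h4 := lTensor_map_eq (hτ s) e h2
  rw [totD_apply_zero_succ, totContraction_zero, map_add, lTensor_rTensor_apply, ← h1, h3,
    h4, sub_add_cancel]

-- The defect σd x of the contraction identity of `I` is cancelled, through the cycle condition at
-- (r + 2, s), by the term with the differential of `J`.
include he hσ hx in
theorem totD_totContraction_succ (r s : ℕ) :
    totD I J (totContraction I J e σ τ x) (r + 1) s = x (r + 1) s := by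
  rcases s with _ | s
  · have h1 := hx (r + 2) 0
    rw [totD_apply_succ_zero] at h1
    rw [totD_apply_succ_zero, rTensor_d_totContraction he hσ, h1, map_zero, sub_zero]
  · have h1 := hx (r + 2) (s + 1)
    rw [totD_apply_succ_succ, pow_succ, mul_neg_one, neg_smul, add_neg_eq_zero] at h1
    rw [totD_apply_succ_succ, rTensor_d_totContraction he hσ, totContraction_succ,
      lTensor_rTensor_apply, ← map_smul, ← h1, sub_add_cancel]

-- The position (0, 0) has to be excluded: the complex is only exact after augmentation, and nothing
-- maps into that position.
include he hσ0 hσ hτ hx in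
theorem totD_totContraction (r s : ℕ) (h : r ≠ 0 ∨ s ≠ 0) :
    totD I J (totContraction I J e σ τ x) r s = x r s := by
  rcases r with _ | r
  · rcases s with _ | s
    · simp at h
    · exact totD_totContraction_zero_succ hσ0 hτ hx s
  · exact totD_totContraction_succ he hσ hx r s

end

end TotBimod

/-! ### Contractions of comodule resolutions. -/

section Contraction

variable {k : Type u} [Field k] {C : Type u} [AddCommMonoid C] [Module k C] [Coalgebra k C]
  {𝓒 : ℤ → Submodule k C}

theorem GrRComod.exists_contraction {M : GrRComod 𝓒} (I : InjRes (GrRComod.forget 𝓒) M) :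
    ∃ (ρ : (I.obj 0).carrier →ₗ[k] M.carrier)
      (σ : ∀ r, (I.obj (r + 1)).carrier →ₗ[k] (I.obj r).carrier),
      ρ ∘ₗ I.ι.lin = LinearMap.id ∧
      I.ι.lin ∘ₗ ρ + σ 0 ∘ₗ (I.d 0).lin = LinearMap.id ∧
      ∀ r, (I.d r).lin ∘ₗ σ r + σ (r + 1) ∘ₗ (I.d (r + 1)).lin = LinearMap.id :=
  I.toRes.exists_contraction

theorem GrLComod.exists_contraction {M : GrLComod 𝓒} (I : InjRes (GrLComod.forget 𝓒) M) :
    ∃ (ρ : (I.obj 0).carrier →ₗ[k] M.carrier)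
      (σ : ∀ r, (I.obj (r + 1)).carrier →ₗ[k] (I.obj r).carrier),
      ρ ∘ₗ I.ι.lin = LinearMap.id ∧
      I.ι.lin ∘ₗ ρ + σ 0 ∘ₗ (I.d 0).lin = LinearMap.id ∧
      ∀ r, (I.d r).lin ∘ₗ σ r + σ (r + 1) ∘ₗ (I.d (r + 1)).lin = LinearMap.id :=
  I.toRes.exists_contraction

end Contraction

/-! ### I ⊗ J resolves M ⊗ N. -/

section TotRes

variable {k : Type u} [Field k] {A : Type u} [Ring A] [Algebra k A] {𝓐 : ℤ → Submodule k A}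
  [GradedAlgebra 𝓐] [PosFiniteType 𝓐] {M : GrLMod 𝓐} {N : GrRMod 𝓐} {hM : M.IsBddAbove}
  {hN : N.IsBddAbove} (I : InjRes (GrRComod.forget (dualGr 𝓐)) (M.toComod hM))
  (J : InjRes (GrLComod.forget (dualGr 𝓐)) (N.toComod hN))

/-- The augmentation of the total complex of `I ⊗ J`. -/
noncomputable def totBimodAug : tensorBimod M N ⟶ totBimod I J 0 :=
  tensorBimodMap (M.toModToComod hM ≫ GrRComod.toModMap I.ι)
    (N.toModToComod hN ≫ GrLComod.toModMap J.ι) ≫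
    diagIncl (fun r s => comodBimod (I.obj r) (J.obj s)) 0 (r := 0) (s := 0) rfl

theorem totBimodAug_apply (t : M.carrier ⊗[k] N.carrier) :
    ((totBimodAug I J).lin t).1 0 0 = TensorProduct.map I.ι.lin J.ι.lin t :=
  diagSingle_apply_same _ 0 (r := 0) (s := 0) rfl _

theorem totBimodZero_ext {x y : (totBimod I J 0).carrier} (h : x.1 0 0 = y.1 0 0) : x = y := by
  refine Subtype.ext (funext₂ fun r s => ?_)
  by_cases h' : r + s = 0
  · obtain ⟨rfl, rfl⟩ : r = 0 ∧ s = 0 := by omega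
    exact h
  · rw [x.2 r s h', y.2 r s h']

/-- The tensor product of linear retractions of the two augmentations is a left inverse. -/
theorem totBimodAug_injective : Function.Injective (totBimodAug I J).lin := by
  obtain ⟨ρ, -, hρ, -⟩ := GrRComod.exists_contraction I
  obtain ⟨ρ', -, hρ', -⟩ := GrLComod.exists_contraction J
  refine Function.LeftInverse.injective
    (g := fun x : (totBimod I J 0).carrier => TensorProduct.map ρ ρ' (x.1 0 0)) fun t => ?_
  refine (congrArg (TensorProduct.map ρ ρ') (totBimodAug_apply I J t)).trans ?_
  refine (LinearMap.congr_fun (TensorProduct.map_comp ρ ρ' I.ι.lin J.ι.lin) t).symm.trans ?_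
  rw [hρ, hρ', TensorProduct.map_id]
  rfl

theorem totBimodD_totBimodAug (t : M.carrier ⊗[k] N.carrier) :
    (totBimodD I J 0).lin ((totBimodAug I J).lin t) = 0 := by
  have hdI : (I.d 0).lin ∘ₗ I.ι.lin = 0 := LinearMap.ext I.exact_zero.apply_apply_eq_zero
  have hdJ : (J.d 0).lin ∘ₗ J.ι.lin = 0 := LinearMap.ext J.exact_zero.apply_apply_eq_zero
  refine Subtype.ext (funext₂ fun r s => ?_)
  rw [totBimodD_val]
  by_cases h : r + s = 1
  · obtain ⟨rfl, rfl⟩ | ⟨rfl, rfl⟩ : (r = 0 ∧ s = 1) ∨ (r = 1 ∧ s = 0) := by omega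
    · refine (totD_apply_zero_succ I J _ 0).trans ?_
      rw [totBimodAug_apply]
      refine (LinearMap.congr_fun (LinearMap.lTensor_comp_map _ (J.d 0).lin I.ι.lin J.ι.lin)
        t).trans ?_
      rw [hdJ, TensorProduct.map_zero_right]
      rfl
    · refine (totD_apply_succ_zero I J _ 0).trans ?_
      rw [totBimodAug_apply]
      refine (LinearMap.congr_fun (LinearMap.rTensor_comp_map _ (I.d 0).lin I.ι.lin J.ι.lin)
        t).trans ?_
      rw [hdI, TensorProduct.map_zero_left]
      rfl
  · exact totD_eq_zero_of_ne I J ((totBimodAug I J).lin t).2 r s h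

/-- In total degree 0 a cycle is killed by d ⊗ 1 and by 1 ⊗ d separately, since these land in
different components; hence ιρ ⊗ ι'ρ' fixes it. -/
theorem exists_totBimodAug_eq {x : (totBimod I J 0).carrier} (hx : (totBimodD I J 0).lin x = 0) :
    ∃ t, (totBimodAug I J).lin t = x := by
  obtain ⟨ρ, σ, -, hρ, -⟩ := GrRComod.exists_contraction I
  obtain ⟨ρ', τ, -, hρ', -⟩ := GrLComod.exists_contraction J
  have hx' : ∀ r s, totD I J x.1 r s = 0 := congrFun₂ (congrArg Subtype.val hx)
  have h1 := (totD_apply_succ_zero I J x.1 0).symm.trans (hx' 1 0)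
  have h2 := (totD_apply_zero_succ I J x.1 0).symm.trans (hx' 0 1)
  refine ⟨TensorProduct.map ρ ρ' (x.1 0 0), totBimodZero_ext I J ?_⟩
  refine (totBimodAug_apply I J _).trans ?_
  exact map_map_eq hρ hρ' h1 h2

/-- The preimage is given by the contraction, which is only linear; exactness does not require a
bimodule homomorphism. -/
theorem exists_totBimodD_eq {n : ℕ} {x : (totBimod I J (n + 1)).carrier}
    (hx : (totBimodD I J (n + 1)).lin x = 0) : ∃ y, (totBimodD I J n).lin y = x := by
  obtain ⟨ρ, σ, -, hρ, hσ⟩ := GrRComod.exists_contraction I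
  obtain ⟨-, τ, -, -, hτ⟩ := GrLComod.exists_contraction J
  have hdI : (I.d 0).lin ∘ₗ I.ι.lin = 0 := LinearMap.ext I.exact_zero.apply_apply_eq_zero
  refine ⟨⟨totContraction I J (I.ι.lin ∘ₗ ρ) σ τ x.1, fun r s h => ?_⟩,
    Subtype.ext (funext₂ fun r s => ?_)⟩
  · exact totContraction_eq_zero_of_ne I J _ _ _ x.2 r s h
  · rw [totBimodD_val]
    by_cases h : r ≠ 0 ∨ s ≠ 0
    · exact totD_totContraction (by rw [← LinearMap.comp_assoc, hdI, LinearMap.zero_comp]) hρ hσ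
        hτ (congrFun₂ (congrArg Subtype.val hx)) r s h
    -- At (0, 0) both sides vanish, because `x` lives in total degree n + 1 > 0.
    · simp only [not_or, not_not] at h
      obtain ⟨rfl, rfl⟩ := h
      rw [totD_apply_zero_zero, x.2 0 0 (by omega)]
      rfl

/-- The total complex of `I ⊗ J` as a resolution of `M ⊗ N` by graded bimodules. -/
noncomputable def totRes : Res (GrBimod.forget 𝓐) (tensorBimod M N) where
  obj := totBimod I J
  d := totBimodD I J
  ι := totBimodAug I J
  ι_injective := totBimodAug_injective I J
  exact_zero x := ⟨fun hx => exists_totBimodAug_eq I J hx, by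
    rintro ⟨t, rfl⟩; exact totBimodD_totBimodAug I J t⟩
  exact_succ n x := ⟨fun hx => exists_totBimodD_eq I J hx, by
    rintro ⟨y, rfl⟩; exact Subtype.ext (totD_totD I J y.1)⟩

end TotRes

/-! ### (V ⊗ C) ⊗ (C ⊗ W) as a space of bilinear maps A × A → V ⊗ W. -/

section BiEval

variable {k : Type u} [Field k]

theorem exists_factor_of_injective {P Q Y : Type u} [AddCommMonoid P] [Module k P]
    [AddCommMonoid Q] [Module k Q] [AddCommMonoid Y] [Module k Y] {Φ : P →ₗ[k] Q}
    (hΦ : Function.Injective Φ) (Ψ : Y →ₗ[k] Q) (h : ∀ y, ∃ t, Φ t = Ψ y) :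
    ∃ f : Y →ₗ[k] P, ∀ y, Φ (f y) = Ψ y := by
  refine ⟨(LinearEquiv.ofInjective Φ hΦ).symm.toLinearMap ∘ₗ
    Ψ.codRestrict (LinearMap.range Φ) h, fun y => ?_⟩
  exact congrArg Subtype.val ((LinearEquiv.ofInjective Φ hΦ).apply_symm_apply
    (Ψ.codRestrict (LinearMap.range Φ) h y))

variable {A : Type u} [Ring A] [Algebra k A] (𝓐 : ℤ → Submodule k A)
  (V W : Type u) [AddCommMonoid V] [Module k V] [AddCommMonoid W] [Module k W]

/-- The rearrangement `(v ⊗ f) ⊗ (f' ⊗ w) ↦ ((v ⊗ w) ⊗ f) ⊗ f'`. -/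
noncomputable def biRearrange : (V ⊗[k] grDual 𝓐) ⊗[k] (grDual 𝓐 ⊗[k] W) ≃ₗ[k]
    ((V ⊗[k] W) ⊗[k] grDual 𝓐) ⊗[k] grDual 𝓐 :=
  TensorProduct.congr (LinearEquiv.refl k _) (TensorProduct.comm k _ _) ≪≫ₗ
    TensorProduct.tensorTensorTensorComm k _ _ _ _ ≪≫ₗ (TensorProduct.assoc k _ _ _).symm

variable {V W} in
theorem biRearrange_tmul (v : V) (f f' : grDual 𝓐) (w : W) :
    biRearrange 𝓐 V W ((v ⊗ₜ f) ⊗ₜ (f' ⊗ₜ w)) = ((v ⊗ₜ w) ⊗ₜ f) ⊗ₜ f' := by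
  simp [biRearrange]

/-- The map sending `(v ⊗ f) ⊗ (f' ⊗ w)` to the bilinear map `(b, a) ↦ f(a) f'(b) v ⊗ w`. -/
noncomputable def biEval : (V ⊗[k] grDual 𝓐) ⊗[k] (grDual 𝓐 ⊗[k] W) →ₗ[k]
    A →ₗ[k] A →ₗ[k] V ⊗[k] W :=
  LinearMap.compRight k (canHom 𝓐 (V ⊗[k] W)) ∘ₗ canHom 𝓐 _ ∘ₗ (biRearrange 𝓐 V W).toLinearMap

variable {V W}

theorem biEval_apply (t : (V ⊗[k] grDual 𝓐) ⊗[k] (grDual 𝓐 ⊗[k] W)) (b a : A) :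
    biEval 𝓐 V W t b a = canHom 𝓐 _ (canHom 𝓐 _ (biRearrange 𝓐 V W t) b) a := rfl

theorem biEval_tmul (x : V ⊗[k] grDual 𝓐) (y : grDual 𝓐 ⊗[k] W) (b a : A) :
    biEval 𝓐 V W (x ⊗ₜ y) b a = canHom 𝓐 V x a ⊗ₜ canHomLeft 𝓐 W y b := by
  induction x with
  | zero => simp
  | add x x' hx hx' => simp only [add_tmul, map_add, LinearMap.add_apply, hx, hx']
  | tmul v f =>
    induction y with
    | zero => simp
    | add y y' hy hy' => simp only [tmul_add, map_add, LinearMap.add_apply, hy, hy']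
    | tmul f' w =>
      rw [biEval_apply, biRearrange_tmul, canHom_tmul, canHom_tmul, canHomLeft_tmul, map_smul,
        LinearMap.smul_apply, canHom_tmul, tmul_smul, smul_tmul']

theorem map_eq_biEval {a b : A} {L : V ⊗[k] grDual 𝓐 →ₗ[k] V ⊗[k] grDual 𝓐}
    {R : grDual 𝓐 ⊗[k] W →ₗ[k] grDual 𝓐 ⊗[k] W} {e : V ⊗[k] grDual 𝓐 →ₗ[k] V}
    {e' : grDual 𝓐 ⊗[k] W →ₗ[k] W} (h : ∀ x, e (L x) = canHom 𝓐 V x a)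
    (h' : ∀ y, e' (R y) = canHomLeft 𝓐 W y b)
    (t : (V ⊗[k] grDual 𝓐) ⊗[k] (grDual 𝓐 ⊗[k] W)) :
    TensorProduct.map e e' (L.rTensor _ (R.lTensor _ t)) = biEval 𝓐 V W t b a := by
  induction t with
  | zero => simp
  | add x y hx hy => simp only [map_add, LinearMap.add_apply, hx, hy]
  | tmul x y =>
    rw [biEval_tmul, ← h, ← h']
    rfl

/-- After moving both copies of the dual to the right, this is injectivity of U ⊗ C → Hom(A, U) used
twice. -/
theorem biEval_injective : Function.Injective (biEval 𝓐 V W) := by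
  intro s t h
  refine (biRearrange 𝓐 V W).injective (canHom_injective 𝓐 (LinearMap.ext fun b => ?_))
  exact canHom_injective 𝓐 (LinearMap.congr_fun h b)

variable {𝓐} in
theorem biRearrange_symm_mem {𝓥 : ℤ → Submodule k V} {𝓦 : ℤ → Submodule k W} {p : ℤ}
    {t : ((V ⊗[k] W) ⊗[k] grDual 𝓐) ⊗[k] grDual 𝓐}
    (ht : t ∈ tensorGr (tensorGr (tensorGr 𝓥 𝓦) (dualGr 𝓐)) (dualGr 𝓐) p) :
    (biRearrange 𝓐 V W).symm t ∈
      tensorGr (tensorGr 𝓥 (dualGr 𝓐)) (tensorGr (dualGr 𝓐) 𝓦) p := by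
  induction ht using Submodule.span_induction with
  | zero => simp
  | add x y _ _ hx hy => rw [map_add]; exact add_mem hx hy
  | smul c x _ hx => rw [map_smul]; exact Submodule.smul_mem _ c hx
  | mem t ht =>
    obtain ⟨i, j, hij, u, hu, f', hf', rfl⟩ := ht
    induction hu using Submodule.span_induction with
    | zero => simp
    | add x y _ _ hx hy => rw [add_tmul, map_add]; exact add_mem hx hy
    | smul c x _ hx => rw [← smul_tmul', map_smul]; exact Submodule.smul_mem _ c hx
    | mem u hu =>
      obtain ⟨i', j', hij', s, hs, f, hf, rfl⟩ := hu
      induction hs using Submodule.span_induction with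
      | zero => simp
      | add x y _ _ hx hy => rw [add_tmul, add_tmul, map_add]; exact add_mem hx hy
      | smul c x _ hx =>
        rw [← smul_tmul', ← smul_tmul', map_smul]; exact Submodule.smul_mem _ c hx
      | mem s hs =>
        obtain ⟨l, m, hlm, v, hv, w, hw, rfl⟩ := hs
        rw [← biRearrange_tmul, LinearEquiv.symm_apply_apply]
        exact tmul_mem_tensorGr (i := l + j') (j := j + m) (by omega)
          (tmul_mem_tensorGr rfl hv hf) (tmul_mem_tensorGr rfl hf' hw)

variable [GradedAlgebra 𝓐] [PosFiniteType 𝓐]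

/-- Negative degrees need no check, as A vanishes there. The inequality `i ≥ 0` is what turns a
bound on i + j into bounds on i and j separately. -/
theorem linearMap_eq_zero_of_homogeneous {T : Type u} [AddCommMonoid T] [Module k T]
    {g : A →ₗ[k] T} (h : ∀ i ≥ 0, ∀ a ∈ 𝓐 i, g a = 0) : g = 0 := by
  classical
  ext a
  induction a using DirectSum.Decomposition.inductionOn 𝓐 with
  | zero => simp
  | add x y hx hy => simp_all
  | @homogeneous i a =>
    rcases lt_or_ge i 0 with hi | hi
    · rw [eq_zero_of_neg 𝓐 hi a.2]; simp
    · exact h i hi a a.2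

variable {𝓐} in
/-- A homogeneous bilinear map with values in a bounded-above space comes from a homogeneous
tensor. -/
theorem exists_biEval_eq {𝓥 : ℤ → Submodule k V} {𝓦 : ℤ → Submodule k W} {c p : ℤ}
    (hc : ∀ q > c, tensorGr 𝓥 𝓦 q = ⊥) (B : A →ₗ[k] A →ₗ[k] V ⊗[k] W)
    (hB : ∀ j, ∀ b ∈ 𝓐 j, ∀ i, ∀ a ∈ 𝓐 i, B b a ∈ tensorGr 𝓥 𝓦 (i + j + p)) :
    ∃ t ∈ tensorGr (tensorGr 𝓥 (dualGr 𝓐)) (tensorGr (dualGr 𝓐) 𝓦) p, biEval 𝓐 V W t = B := by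
  have hB0 : ∀ j, ∀ b ∈ 𝓐 j, ∀ i, ∀ a ∈ 𝓐 i, i + j > c - p → B b a = 0 :=
    fun j b hb i a ha h => by
      have := hB j b hb i a ha
      rwa [hc _ (by omega), Submodule.mem_bot] at this
  -- The bound on i must not depend on `b`: since A lives in degrees j ≥ 0, the condition i > c - p
  -- already forces i + j > c - p.
  have hbd : ∀ b, ∀ i > c - p, ∀ a ∈ 𝓐 i, B b a = 0 := fun b i hi a ha => by
    have : B.flip a = 0 := linearMap_eq_zero_of_homogeneous 𝓐 fun j hj b hb =>
      hB0 j b hb i a ha (by omega)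
    exact LinearMap.congr_fun this b
  -- The tensor is built one variable at a time: `B'` represents the dependence on `a`, and
  -- representing `B'` as a function of `b` finishes.
  obtain ⟨B', hB'⟩ := exists_factor_of_injective (canHom_injective 𝓐 (V := V ⊗[k] W)) B
    fun b => by
      obtain ⟨t, -, ht⟩ := exists_canHom_eq 𝓐 (B b) ⟨_, hbd b⟩ ⊤ fun _ _ _ _ _ => trivial
      exact ⟨t, ht⟩
  have hmem : ∀ j, ∀ b ∈ 𝓐 j, B' b ∈ tensorGr (tensorGr 𝓥 𝓦) (dualGr 𝓐) (j + p) := by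
    intro j b hb
    obtain ⟨t, ht, h⟩ := exists_canHom_eq 𝓐 (B b) ⟨_, hbd b⟩
      (tensorGr (tensorGr 𝓥 𝓦) (dualGr 𝓐) (j + p))
      fun i a ha f hf => tmul_mem_tensorGr (by omega) (hB j b hb i a ha) hf
    rw [← hB' b] at h
    exact canHom_injective 𝓐 h ▸ ht
  have hB'0 : ∀ j > c - p, ∀ b ∈ 𝓐 j, B' b = 0 := fun j hj b hb => by
    refine canHom_injective 𝓐 ?_
    rw [hB', map_zero]
    exact linearMap_eq_zero_of_homogeneous 𝓐 fun i hi a ha => hB0 j b hb i a ha (by omega)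
  obtain ⟨t, ht, h⟩ := exists_canHom_eq 𝓐 B' ⟨_, hB'0⟩
    (tensorGr (tensorGr (tensorGr 𝓥 𝓦) (dualGr 𝓐)) (dualGr 𝓐) p)
    fun j b hb f hf => tmul_mem_tensorGr (by omega) (hmem j b hb) hf
  refine ⟨_, biRearrange_symm_mem ht, LinearMap.ext fun b => LinearMap.ext fun a => ?_⟩
  rw [biEval_apply, LinearEquiv.apply_symm_apply, h, hB']

end BiEval

/-! ### Tensor products of bounded-above cofree comodules are injective bimodules. -/

section InjectiveBimodules

variable {k : Type u} [Field k] {A : Type u} [Ring A] [Algebra k A] {𝓐 : ℤ → Submodule k A}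
  [GradedAlgebra 𝓐] [PosFiniteType 𝓐] (V W : GrVect k)

/-- The counit of a tensor product of cofree comodules. -/
noncomputable abbrev biCounit : (V.carrier ⊗[k] grDual 𝓐) ⊗[k] (grDual 𝓐 ⊗[k] W.carrier) →ₗ[k]
    V.carrier ⊗[k] W.carrier :=
  TensorProduct.map (GrRComod.cofreeCounit V) (GrLComod.cofreeCounit W)

theorem GrRComod.cofreeCounit_act (a : A) (x : V.carrier ⊗[k] grDual 𝓐) :
    cofreeCounit V ((cofree (dualGr 𝓐) V).toMod.act a x) = canHom 𝓐 _ x a := by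
  refine (canHom_map 𝓐 (cofreeCounit V) _ a).symm.trans ?_
  exact congrArg (canHom 𝓐 _ · a) (rTensor_cofreeCounit_coact V x)

theorem GrLComod.cofreeCounit_act (a : A) (x : grDual 𝓐 ⊗[k] W.carrier) :
    cofreeCounit W ((cofree (dualGr 𝓐) W).toMod.act (MulOpposite.op a) x) =
      canHomLeft 𝓐 _ x a := by
  refine (canHomLeft_map (cofreeCounit W) _ a).symm.trans ?_
  exact congrArg (canHomLeft 𝓐 _ · a) (lTensor_cofreeCounit_coact W x)

/-- The value of t at (b, a) is the counit of a t b. So an element is determined by the counits of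
its translates, which is what it means for the bimodule to be coinduced from V ⊗ W. -/
theorem biCounit_act (a b : A) (t : (V.carrier ⊗[k] grDual 𝓐) ⊗[k] (grDual 𝓐 ⊗[k] W.carrier)) :
    biCounit V W ((comodBimod (GrRComod.cofree (dualGr 𝓐) V) (GrLComod.cofree (dualGr 𝓐) W)).lact a
      ((comodBimod (GrRComod.cofree (dualGr 𝓐) V) (GrLComod.cofree (dualGr 𝓐) W)).ract
        (MulOpposite.op b) t)) = biEval 𝓐 _ _ t b a :=
  map_eq_biEval 𝓐 (GrRComod.cofreeCounit_act V a) (GrLComod.cofreeCounit_act W b) t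

variable {V W}

theorem biCounit_mem {p : ℤ} {t : (V.carrier ⊗[k] grDual 𝓐) ⊗[k] (grDual 𝓐 ⊗[k] W.carrier)}
    (ht : t ∈ tensorGr (tensorGr V.gr (dualGr 𝓐)) (tensorGr (dualGr 𝓐) W.gr) p) :
    biCounit V W t ∈ tensorGr V.gr W.gr p :=
  map_mem_tensorGr (a := 0) (b := 0)
    (fun i _ hv => by rw [zero_add]; exact GrRComod.cofreeCounit_mem V hv)
    (fun i _ hw => by rw [zero_add]; exact GrLComod.cofreeCounit_mem W hw) (by omega) ht

variable (V W) in
/-- The tensor product of graded vector spaces. -/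
abbrev GrVect.tensor : GrVect k where
  carrier := V.carrier ⊗[k] W.carrier
  gr := tensorGr V.gr W.gr
  isInternal := tensorGr_isInternal V.isInternal W.isInternal

omit [GradedAlgebra 𝓐] [PosFiniteType 𝓐] in
theorem GrVect.tensor_isBddAbove (hV : V.IsBddAbove) (hW : W.IsBddAbove) :
    (V.tensor W).IsBddAbove :=
  GrVect.isBddAbove_of_tensor hV hW LinearMap.id (fun _ _ h => h) fun _ _ h => h

omit [GradedAlgebra 𝓐] [PosFiniteType 𝓐] in
theorem GrBimod.lact_ract_lact (Y : GrBimod 𝓐) (a b c : A) (y : Y.carrier) :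
    Y.lact a (Y.ract (MulOpposite.op b) (Y.lact c y)) =
      Y.lact (a * c) (Y.ract (MulOpposite.op b) y) := by
  rw [← Y.lact_ract, map_mul]
  rfl

omit [GradedAlgebra 𝓐] [PosFiniteType 𝓐] in
theorem GrBimod.lact_ract_ract (Y : GrBimod 𝓐) (a b c : A) (y : Y.carrier) :
    Y.lact a (Y.ract (MulOpposite.op b) (Y.ract (MulOpposite.op c) y)) =
      Y.lact a (Y.ract (MulOpposite.op (c * b)) y) := by
  rw [MulOpposite.op_mul, map_mul]
  rfl

/-- A linear map of degree `0` into `V ⊗ W` lifts to a bimodule homomorphism. -/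
theorem exists_bimod_lift (hV : V.IsBddAbove) (hW : W.IsBddAbove) (Y : GrBimod 𝓐)
    (g : Y.carrier →ₗ[k] V.carrier ⊗[k] W.carrier)
    (hg : ∀ p, ∀ y ∈ Y.gr p, g y ∈ tensorGr V.gr W.gr p) :
    ∃ f : Y.carrier →ₗ[k] (V.carrier ⊗[k] grDual 𝓐) ⊗[k] (grDual 𝓐 ⊗[k] W.carrier),
      (∀ p, ∀ y ∈ Y.gr p,
        f y ∈ tensorGr (tensorGr V.gr (dualGr 𝓐)) (tensorGr (dualGr 𝓐) W.gr) p) ∧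
      ∀ y b a, biEval 𝓐 _ _ (f y) b a = g (Y.lact a (Y.ract (MulOpposite.op b) y)) := by
  obtain ⟨c, hc⟩ := GrVect.tensor_isBddAbove hV hW
  let R : Y.carrier →ₗ[k] A →ₗ[k] Y.carrier :=
    (Y.ract.toLinearMap ∘ₗ (MulOpposite.opLinearEquiv k).toLinearMap).flip
  let Ψ : Y.carrier →ₗ[k] A →ₗ[k] A →ₗ[k] V.carrier ⊗[k] W.carrier :=
    LinearMap.compRight k (LinearMap.compRight k g ∘ₗ Y.lact.toLinearMap.flip) ∘ₗ R
  have hΨ : ∀ y b a, Ψ y b a = g (Y.lact a (Y.ract (MulOpposite.op b) y)) := fun _ _ _ => rfl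
  have hmem : ∀ p, ∀ y ∈ Y.gr p,
      ∃ t ∈ tensorGr (tensorGr V.gr (dualGr 𝓐)) (tensorGr (dualGr 𝓐) W.gr) p,
        biEval 𝓐 _ _ t = Ψ y := fun p y hy =>
    exists_biEval_eq hc (Ψ y) fun j b hb i a ha => by
      rw [hΨ, add_assoc]
      exact hg _ _ (Y.lact_mem _ _ a ha _ (Y.ract_mem _ _ b hb _ hy))
  obtain ⟨f, hf⟩ := exists_factor_of_injective (biEval_injective 𝓐) Ψ fun y => by
    change Ψ y ∈ LinearMap.range (biEval 𝓐 V.carrier W.carrier)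
    induction y using GrVect.inductionOn with
    | zero => rw [map_zero]; exact zero_mem _
    | homogeneous p y hy =>
      obtain ⟨t, -, ht⟩ := hmem p y hy
      exact ⟨t, ht⟩
    | add x y hx hy => rw [map_add]; exact add_mem hx hy
  refine ⟨f, fun p y hy => ?_, fun y b a => by rw [hf, hΨ]⟩
  obtain ⟨t, ht, h⟩ := hmem p y hy
  rw [← hf] at h
  exact biEval_injective 𝓐 h ▸ ht

/-- Computed from translates: acting by `c` before `a` on the left is acting by `a * c`. -/
theorem biEval_lact (t : (V.carrier ⊗[k] grDual 𝓐) ⊗[k] (grDual 𝓐 ⊗[k] W.carrier)) (a b c : A) :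
    biEval 𝓐 _ _ ((comodBimod (GrRComod.cofree (dualGr 𝓐) V)
      (GrLComod.cofree (dualGr 𝓐) W)).lact c t) b a = biEval 𝓐 _ _ t b (a * c) :=
  (biCounit_act V W a b _).symm.trans ((congrArg (biCounit V W)
    (GrBimod.lact_ract_lact (comodBimod (GrRComod.cofree (dualGr 𝓐) V)
      (GrLComod.cofree (dualGr 𝓐) W)) a b c t)).trans (biCounit_act V W (a * c) b t))

theorem biEval_ract (t : (V.carrier ⊗[k] grDual 𝓐) ⊗[k] (grDual 𝓐 ⊗[k] W.carrier)) (a b c : A) :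
    biEval 𝓐 _ _ ((comodBimod (GrRComod.cofree (dualGr 𝓐) V)
      (GrLComod.cofree (dualGr 𝓐) W)).ract (MulOpposite.op c) t) b a =
      biEval 𝓐 _ _ t (c * b) a :=
  (biCounit_act V W a b _).symm.trans ((congrArg (biCounit V W)
    (GrBimod.lact_ract_ract (comodBimod (GrRComod.cofree (dualGr 𝓐) V)
      (GrLComod.cofree (dualGr 𝓐) W)) a b c t)).trans (biCounit_act V W a (c * b) t))

variable (V W) in
/-- The bimodule homomorphism with components the values of `g` on `a y b`. -/
noncomputable def bimodLift (Y : GrBimod 𝓐) (g : Y.carrier →ₗ[k] V.carrier ⊗[k] W.carrier)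
    (F : Y.carrier →ₗ[k] (V.carrier ⊗[k] grDual 𝓐) ⊗[k] (grDual 𝓐 ⊗[k] W.carrier))
    (hF : ∀ p, ∀ y ∈ Y.gr p,
      F y ∈ tensorGr (tensorGr V.gr (dualGr 𝓐)) (tensorGr (dualGr 𝓐) W.gr) p)
    (hFg : ∀ y b a, biEval 𝓐 _ _ (F y) b a = g (Y.lact a (Y.ract (MulOpposite.op b) y))) :
    Y ⟶ comodBimod (GrRComod.cofree (dualGr 𝓐) V) (GrLComod.cofree (dualGr 𝓐) W) where
  lin := F
  map_gr := hF
  map_lact c y := biEval_injective 𝓐 <| LinearMap.ext fun b => LinearMap.ext fun a =>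
    (hFg _ b a).trans ((congrArg g (Y.lact_ract_lact a b c y)).trans
      ((hFg y b (a * c)).symm.trans (biEval_lact (F y) a b c).symm))
  map_ract c y := biEval_injective 𝓐 <| LinearMap.ext fun b => LinearMap.ext fun a =>
    (hFg _ b a).trans ((congrArg g (Y.lact_ract_ract a b c.unop y)).trans
      ((hFg y (c.unop * b) a).symm.trans (biEval_ract (F y) a b c.unop).symm))

/-- A homomorphism into the coinduced bimodule is recovered from its composite with the counit. -/
theorem biEval_hom {X : GrBimod 𝓐}
    (f : X ⟶ comodBimod (GrRComod.cofree (dualGr 𝓐) V) (GrLComod.cofree (dualGr 𝓐) W))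
    (x : X.carrier) (b a : A) : biEval 𝓐 V.carrier W.carrier (f.lin x) b a =
      biCounit V W (f.lin (X.lact a (X.ract (MulOpposite.op b) x))) :=
  (biCounit_act V W a b _).symm.trans (congrArg (biCounit V W)
    ((f.map_lact _ _).trans (congrArg _ (f.map_ract _ _))).symm)

/-- Homomorphisms into this bimodule correspond to linear maps of degree 0 into V ⊗ W. The one
obtained from `f` extends linearly along `i`, and the bimodule lift of the extension, which exists
because `V` and `W` are bounded above, restricts to `f` since the bilinear maps agree. -/
theorem isInjectiveObj_comodBimod_cofree (hV : V.IsBddAbove) (hW : W.IsBddAbove) :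
    IsInjectiveObj (GrBimod.forget 𝓐)
      (comodBimod (GrRComod.cofree (dualGr 𝓐) V) (GrLComod.cofree (dualGr 𝓐) W)) := by
  intro X Y i f hi
  obtain ⟨g, hg, hgi⟩ := GrVect.exists_extension (V := V.tensor W) i.map_gr hi
    (g := biCounit V W ∘ₗ f.lin) fun p x hx => biCounit_mem (f.map_gr p x hx)
  obtain ⟨F, hF, hFg⟩ := exists_bimod_lift hV hW Y g hg
  refine ⟨bimodLift V W Y g F hF hFg, GrBimod.hom_ext (LinearMap.ext fun x => ?_)⟩
  refine biEval_injective 𝓐 (LinearMap.ext fun b => LinearMap.ext fun a => ?_)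
  refine (hFg (i.lin x) b a).trans (Eq.trans ?_ (biEval_hom f x b a).symm)
  rw [← i.map_ract, ← i.map_lact]
  exact LinearMap.congr_fun hgi _

theorem isInjectiveObj_totBimod {M : GrRComod (dualGr 𝓐)} {N : GrLComod (dualGr 𝓐)}
    {I : InjRes (GrRComod.forget (dualGr 𝓐)) M} {J : InjRes (GrLComod.forget (dualGr 𝓐)) N}
    (hI : ∀ r, ∃ V : GrVect k, V.IsBddAbove ∧ I.obj r = GrRComod.cofree _ V)
    (hJ : ∀ s, ∃ V : GrVect k, V.IsBddAbove ∧ J.obj s = GrLComod.cofree _ V) (n : ℕ) :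
    IsInjectiveObj (GrBimod.forget 𝓐) (totBimod I J n) := by
  refine isInjectiveObj_diagSum _ n fun r s _ => ?_
  obtain ⟨V, hV, h⟩ := hI r
  obtain ⟨W, hW, h'⟩ := hJ s
  rw [h, h']
  exact isInjectiveObj_comodBimod_cofree hV hW

end InjectiveBimodules

/-! ### Identity and composition of morphisms of resolutions. -/

section Lifts

variable {k : Type u} [Field k] {𝒟 : Type (u + 1)} [Category.{u} 𝒟] {F : 𝒟 ⥤ ModuleCat.{u} k}
  {M M' M'' : 𝒟} {f : M ⟶ M'} {g : M' ⟶ M''}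

/-- The identity as a morphism of resolutions. -/
def InjRes.Lift.id (I : InjRes F M) : I.Lift I (𝟙 M) where
  app _ := 𝟙 _
  comm _ := by simp
  aug := by simp

/-- Composition of morphisms of resolutions. -/
def InjRes.Lift.comp {I : InjRes F M} {I' : InjRes F M'} {I'' : InjRes F M''} (φ : I.Lift I' f)
    (ψ : I'.Lift I'' g) : I.Lift I'' (f ≫ g) where
  app n := φ.app n ≫ ψ.app n
  comm n := by rw [← Category.assoc, φ.comm, Category.assoc, ψ.comm, Category.assoc]
  aug := by rw [← Category.assoc, φ.aug, Category.assoc, ψ.aug, Category.assoc]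

/-- A morphism of resolutions lifting an equal morphism. -/
def InjRes.Lift.copy {I : InjRes F M} {I' : InjRes F M'} (φ : I.Lift I' f) {f' : M ⟶ M'}
    (h : f = f') : I.Lift I' f' where
  app := φ.app
  comm := φ.comm
  aug := h ▸ φ.aug

/-- A morphism of injective resolutions as a morphism from the underlying resolution. -/
def InjRes.Lift.toResLift {I : InjRes F M} {I' : InjRes F M'} (φ : I.Lift I' f) :
    I.toRes.Lift I' f where
  app := φ.app
  comm := φ.comm
  aug := φ.aug

theorem InjRes.exists_lift [HomalgCat F] (I : InjRes F M) (I' : InjRes F M') (f : M ⟶ M') :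
    Nonempty (I.Lift I' f) := by
  obtain ⟨φ⟩ := I.toRes.exists_lift I' f
  exact ⟨⟨φ.app, φ.comm, φ.aug⟩⟩

end Lifts

/-! ### Homotopy invariance and functoriality of Cotor. -/

section CotorFunctoriality

variable {k : Type u} [Field k] {C : Type u} [AddCommMonoid C] [Module k C] [Coalgebra k C]
  {𝓒 : ℤ → Submodule k C}

theorem GrRComod.exists_homotopy {M M' : GrRComod 𝓒} {f : M ⟶ M'}
    {I : InjRes (GrRComod.forget 𝓒) M} {I' : InjRes (GrRComod.forget 𝓒) M'}
    (φ φ' : I.Lift I' f) : ∃ h : ∀ n, I.obj (n + 1) ⟶ I'.obj n,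
      ((φ.app 0).lin = (h 0).lin ∘ₗ (I.d 0).lin + (φ'.app 0).lin) ∧
      ∀ n, (φ.app (n + 1)).lin = (I'.d n).lin ∘ₗ (h n).lin + (h (n + 1)).lin ∘ₗ (I.d (n + 1)).lin +
        (φ'.app (n + 1)).lin :=
  φ.toResLift.exists_homotopy φ'.toResLift

theorem GrLComod.exists_homotopy {M M' : GrLComod 𝓒} {f : M ⟶ M'}
    {I : InjRes (GrLComod.forget 𝓒) M} {I' : InjRes (GrLComod.forget 𝓒) M'}
    (φ φ' : I.Lift I' f) : ∃ h : ∀ n, I.obj (n + 1) ⟶ I'.obj n,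
      ((φ.app 0).lin = (h 0).lin ∘ₗ (I.d 0).lin + (φ'.app 0).lin) ∧
      ∀ n, (φ.app (n + 1)).lin = (I'.d n).lin ∘ₗ (h n).lin + (h (n + 1)).lin ∘ₗ (I.d (n + 1)).lin +
        (φ'.app (n + 1)).lin :=
  φ.toResLift.exists_homotopy φ'.toResLift

variable {M M' M'' : GrRComod 𝓒} {N N' N'' : GrLComod 𝓒}
  {I : InjRes (GrRComod.forget 𝓒) M} {J : InjRes (GrLComod.forget 𝓒) N}
  {I' : InjRes (GrRComod.forget 𝓒) M'} {J' : InjRes (GrLComod.forget 𝓒) N'}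
  {I'' : InjRes (GrRComod.forget 𝓒) M''} {J'' : InjRes (GrLComod.forget 𝓒) N''}
  {f : M ⟶ M'} {g : N ⟶ N'} {f' : M' ⟶ M''} {g' : N' ⟶ N''}

theorem totMap_apply (φ : I.Lift I' f) (ψ : J.Lift J' g)
    (x : ∀ r s : ℕ, (I.obj r).carrier ⊗[k] (J.obj s).carrier) (r s : ℕ) :
    totMap φ ψ x r s = TensorProduct.map (φ.app r).lin (ψ.app s).lin (x r s) := rfl

theorem cotensorComplex_d (I : InjRes (GrRComod.forget 𝓒) M) (J : InjRes (GrLComod.forget 𝓒) N)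
    (p : ℤ) (n : ℕ) : (cotensorComplex I J p).d n (n + 1) =
      ModuleCat.ofHom ((totD I J).restrict fun _ hx => totD_mem (p := p) (n := n) hx) := by
  simp only [cotensorComplex, CochainComplex.of_d]

/-- A homotopy of total complexes in the first variable. -/
noncomputable def totHomotopyLeft (h : ∀ n, I.obj (n + 1) ⟶ I'.obj n) (ψ : J.Lift J' g) :
    (∀ r s : ℕ, (I.obj r).carrier ⊗[k] (J.obj s).carrier) →ₗ[k]
      ∀ r s : ℕ, (I'.obj r).carrier ⊗[k] (J'.obj s).carrier :=
  LinearMap.pi fun r => LinearMap.pi fun s =>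
    TensorProduct.map (h r).lin (ψ.app s).lin ∘ₗ LinearMap.proj s ∘ₗ LinearMap.proj (r + 1)

/-- A homotopy of total complexes in the second variable. -/
noncomputable def totHomotopyRight (φ : I.Lift I' f) (h : ∀ n, J.obj (n + 1) ⟶ J'.obj n) :
    (∀ r s : ℕ, (I.obj r).carrier ⊗[k] (J.obj s).carrier) →ₗ[k]
      ∀ r s : ℕ, (I'.obj r).carrier ⊗[k] (J'.obj s).carrier :=
  -- The sign (-1)^r matches the one in front of 1 ⊗ d: the two signs multiply to 1, and the terms
  -- with d ⊗ 1 cancel.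
  LinearMap.pi fun r => LinearMap.pi fun s => (-1 : k) ^ r •
    (TensorProduct.map (φ.app r).lin (h s).lin ∘ₗ LinearMap.proj (s + 1) ∘ₗ LinearMap.proj r)

theorem totHomotopyLeft_apply (h : ∀ n, I.obj (n + 1) ⟶ I'.obj n) (ψ : J.Lift J' g)
    (x : ∀ r s : ℕ, (I.obj r).carrier ⊗[k] (J.obj s).carrier) (r s : ℕ) :
    totHomotopyLeft h ψ x r s = TensorProduct.map (h r).lin (ψ.app s).lin (x (r + 1) s) := rfl

theorem totHomotopyRight_apply (φ : I.Lift I' f) (h : ∀ n, J.obj (n + 1) ⟶ J'.obj n)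
    (x : ∀ r s : ℕ, (I.obj r).carrier ⊗[k] (J.obj s).carrier) (r s : ℕ) :
    totHomotopyRight φ h x r s =
      (-1 : k) ^ r • TensorProduct.map (φ.app r).lin (h s).lin (x r (s + 1)) := rfl

theorem InjRes.Lift.comm_lin_right (φ : I.Lift I' f) (n : ℕ) :
    (φ.app (n + 1)).lin ∘ₗ (I.d n).lin = (I'.d n).lin ∘ₗ (φ.app n).lin :=
  congrArg GrRComod.Hom.lin (φ.comm n)

theorem InjRes.Lift.comm_lin_left (ψ : J.Lift J' g) (n : ℕ) :
    (ψ.app (n + 1)).lin ∘ₗ (J.d n).lin = (J'.d n).lin ∘ₗ (ψ.app n).lin :=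
  congrArg GrLComod.Hom.lin (ψ.comm n)

/-- Moving from r to r + 1 changes the sign of 1 ⊗ d, so its contributions to hD and Dh cancel,
leaving the homotopy identity of the first factor tensored with ψ. -/
theorem totMap_eq_left {φ φ' : I.Lift I' f} {h : ∀ n, I.obj (n + 1) ⟶ I'.obj n}
    (h0 : (φ.app 0).lin = (h 0).lin ∘ₗ (I.d 0).lin + (φ'.app 0).lin)
    (hs : ∀ n, (φ.app (n + 1)).lin = (I'.d n).lin ∘ₗ (h n).lin +
      (h (n + 1)).lin ∘ₗ (I.d (n + 1)).lin + (φ'.app (n + 1)).lin) (ψ : J.Lift J' g)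
    (x : ∀ r s : ℕ, (I.obj r).carrier ⊗[k] (J.obj s).carrier) :
    totMap φ ψ x = totHomotopyLeft h ψ (totD I J x) + totD I' J' (totHomotopyLeft h ψ x) +
      totMap φ' ψ x := by
  have e1 : ∀ r s t, TensorProduct.map (h r).lin (ψ.app s).lin ((I.d r).lin.rTensor _ t) =
      TensorProduct.map ((h r).lin ∘ₗ (I.d r).lin) (ψ.app s).lin t := fun r s t =>
    LinearMap.congr_fun (LinearMap.map_comp_rTensor _ (h r).lin (ψ.app s).lin (I.d r).lin) t
  have e2 : ∀ r s t, TensorProduct.map (h r).lin (ψ.app (s + 1)).lin ((J.d s).lin.lTensor _ t) =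
      (J'.d s).lin.lTensor _ (TensorProduct.map (h r).lin (ψ.app s).lin t) := fun r s t => by
    rw [← LinearMap.comp_apply, LinearMap.map_comp_lTensor, ψ.comm_lin_left,
      ← LinearMap.lTensor_comp_map, LinearMap.comp_apply]
  have e3 : ∀ r s t, (I'.d r).lin.rTensor _ (TensorProduct.map (h r).lin (ψ.app s).lin t) =
      TensorProduct.map ((I'.d r).lin ∘ₗ (h r).lin) (ψ.app s).lin t := fun r s t =>
    LinearMap.congr_fun (LinearMap.rTensor_comp_map _ (I'.d r).lin (h r).lin (ψ.app s).lin) t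
  funext r s
  simp only [Pi.add_apply, totMap_apply, totHomotopyLeft_apply]
  rcases r with _ | r <;> rcases s with _ | s
  · rw [totD_apply_zero_zero, totD_apply_succ_zero, e1, h0, TensorProduct.map_add_left,
      LinearMap.add_apply, add_zero]
  · rw [totD_apply_zero_succ, totD_apply_succ_succ, map_add, map_smul, e1, e2, h0,
      TensorProduct.map_add_left, LinearMap.add_apply, totHomotopyLeft_apply]
    simp
  · rw [totD_apply_succ_zero, totD_apply_succ_zero, e1, totHomotopyLeft_apply, e3, hs,
      TensorProduct.map_add_left, TensorProduct.map_add_left, LinearMap.add_apply,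
      LinearMap.add_apply]
    abel
  · rw [totD_apply_succ_succ, totD_apply_succ_succ, map_add, map_smul, e1, e2,
      totHomotopyLeft_apply, totHomotopyLeft_apply, e3, hs,
      TensorProduct.map_add_left, TensorProduct.map_add_left, LinearMap.add_apply,
      LinearMap.add_apply, pow_succ (-1 : k) (r + 1), mul_neg_one, neg_smul]
    abel

theorem totMap_eq_right {ψ ψ' : J.Lift J' g} {h : ∀ n, J.obj (n + 1) ⟶ J'.obj n}
    (h0 : (ψ.app 0).lin = (h 0).lin ∘ₗ (J.d 0).lin + (ψ'.app 0).lin)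
    (hs : ∀ n, (ψ.app (n + 1)).lin = (J'.d n).lin ∘ₗ (h n).lin +
      (h (n + 1)).lin ∘ₗ (J.d (n + 1)).lin + (ψ'.app (n + 1)).lin) (φ : I.Lift I' f)
    (x : ∀ r s : ℕ, (I.obj r).carrier ⊗[k] (J.obj s).carrier) :
    totMap φ ψ x = totHomotopyRight φ h (totD I J x) + totD I' J' (totHomotopyRight φ h x) +
      totMap φ ψ' x := by
  have e1 : ∀ r s t, TensorProduct.map (φ.app r).lin (h s).lin ((J.d s).lin.lTensor _ t) =
      TensorProduct.map (φ.app r).lin ((h s).lin ∘ₗ (J.d s).lin) t := fun r s t =>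
    LinearMap.congr_fun (LinearMap.map_comp_lTensor _ (φ.app r).lin (h s).lin (J.d s).lin) t
  have e2 : ∀ r s t, TensorProduct.map (φ.app (r + 1)).lin (h s).lin ((I.d r).lin.rTensor _ t) =
      (I'.d r).lin.rTensor _ (TensorProduct.map (φ.app r).lin (h s).lin t) := fun r s t => by
    rw [← LinearMap.comp_apply, LinearMap.map_comp_rTensor, φ.comm_lin_right,
      ← LinearMap.rTensor_comp_map, LinearMap.comp_apply]
  have e3 : ∀ r s t, (J'.d s).lin.lTensor _ (TensorProduct.map (φ.app r).lin (h s).lin t) =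
      TensorProduct.map (φ.app r).lin ((J'.d s).lin ∘ₗ (h s).lin) t := fun r s t =>
    LinearMap.congr_fun (LinearMap.lTensor_comp_map _ (J'.d s).lin (φ.app r).lin (h s).lin) t
  have hsq : ∀ r : ℕ, (-1 : k) ^ r * (-1) ^ r = 1 := fun r => by
    rw [← mul_pow]; simp
  funext r s
  simp only [Pi.add_apply, totMap_apply, totHomotopyRight_apply]
  rcases r with _ | r <;> rcases s with _ | s
  · rw [totD_apply_zero_zero, totD_apply_zero_succ, e1, h0, TensorProduct.map_add_right,
      LinearMap.add_apply, add_zero, pow_zero, one_smul]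
  · rw [totD_apply_zero_succ, totD_apply_zero_succ, e1, totHomotopyRight_apply, pow_zero, one_smul,
      one_smul, e3, hs, TensorProduct.map_add_right, TensorProduct.map_add_right,
      LinearMap.add_apply, LinearMap.add_apply]
    abel
  · rw [totD_apply_succ_zero, totD_apply_succ_succ, map_add, map_smul, e1, e2, smul_add, smul_smul,
      hsq, one_smul, totHomotopyRight_apply, map_smul, h0, TensorProduct.map_add_right,
      LinearMap.add_apply, pow_succ, mul_neg_one, neg_smul]
    abel
  · rw [totD_apply_succ_succ, totD_apply_succ_succ, map_add, map_smul, e1, e2,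
      totHomotopyRight_apply, totHomotopyRight_apply, map_smul, map_smul, e3, hs, smul_add,
      smul_smul, smul_smul, hsq, one_smul, one_smul, TensorProduct.map_add_right,
      TensorProduct.map_add_right, LinearMap.add_apply,
      LinearMap.add_apply, pow_succ, mul_neg_one, neg_smul]
    abel

/-- `H` is given on the whole product of the I^r ⊗ J^s, so the homotopy identity can be checked
without the cotensor conditions. Since `H` also vanishes on total degree 0, the term DH drops out
there, as a homotopy in degree 0 requires. -/
theorem cotensorComplexMap_homology_eq {p : ℤ} {φ φ' : I.Lift I' f} {ψ ψ' : J.Lift J' g}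
    (H : (∀ r s : ℕ, (I.obj r).carrier ⊗[k] (J.obj s).carrier) →ₗ[k]
      ∀ r s : ℕ, (I'.obj r).carrier ⊗[k] (J'.obj s).carrier)
    (hH : ∀ n, ∀ x ∈ totCotensor I J p (n + 1), H x ∈ totCotensor I' J' p n)
    (hH0 : ∀ x ∈ totCotensor I J p 0, H x = 0)
    (hc : ∀ x, totMap φ ψ x = H (totD I J x) + totD I' J' (H x) + totMap φ' ψ' x) (n : ℕ) :
    HomologicalComplex.homologyMap (cotensorComplexMap φ ψ p) n =
      HomologicalComplex.homologyMap (cotensorComplexMap φ' ψ' p) n := by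
  refine Homotopy.homologyMap_eq (homotopyOfComponents
    (fun n => ModuleCat.ofHom (H.restrict (hH n))) ?_ fun n => ?_) n
  · rw [cotensorComplex_d]
    refine ModuleCat.hom_ext (LinearMap.ext fun x => Subtype.ext ?_)
    refine (hc x.1).trans ?_
    rw [hH0 x.1 x.2, map_zero, add_zero]
    rfl
  · rw [cotensorComplex_d, cotensorComplex_d]
    exact ModuleCat.hom_ext (LinearMap.ext fun x => Subtype.ext (hc x.1))

/-- The lifts are exchanged one variable at a time. The homotopies consist of comodule
homomorphisms, so they preserve cotensor products. -/
theorem Cotor.map_eq (φ φ' : I.Lift I' f) (ψ ψ' : J.Lift J' g) (n : ℕ) :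
    Cotor.map φ ψ n = Cotor.map φ' ψ' n := by
  obtain ⟨h, h0, hs⟩ := GrRComod.exists_homotopy φ φ'
  obtain ⟨l, l0, ls⟩ := GrLComod.exists_homotopy ψ ψ'
  funext p
  refine (cotensorComplexMap_homology_eq (totHomotopyLeft h ψ) ?_ ?_
    (totMap_eq_left h0 hs ψ) n).trans (cotensorComplexMap_homology_eq (totHomotopyRight φ' l) ?_ ?_
    (totMap_eq_right l0 ls φ') n)
  · refine fun n x hx => ⟨fun r s => map_mem_cotensorGr (h r) (ψ.app s) (hx.1 (r + 1) s),
      fun r s hrs => ?_⟩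
    rw [totHomotopyLeft_apply, hx.2 _ _ (by omega), map_zero]
  · refine fun x hx => funext₂ fun r s => ?_
    rw [totHomotopyLeft_apply, hx.2 _ _ (by omega), map_zero]
    rfl
  · refine fun n x hx => ⟨fun r s => Submodule.smul_mem _ _
      (map_mem_cotensorGr (φ'.app r) (l s) (hx.1 r (s + 1))), fun r s hrs => ?_⟩
    rw [totHomotopyRight_apply, hx.2 _ _ (by omega), map_zero, smul_zero]
  · refine fun x hx => funext₂ fun r s => ?_
    rw [totHomotopyRight_apply, hx.2 _ _ (by omega), map_zero, smul_zero]
    rfl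

theorem Cotor.map_id (φ : I.Lift I (𝟙 M)) (ψ : J.Lift J (𝟙 N)) (n : ℕ) :
    Cotor.map φ ψ n = 𝟙 _ := by
  rw [Cotor.map_eq φ (.id I) ψ (.id J)]
  funext p
  refine Eq.trans (congrArg (fun F : cotensorComplex I J p ⟶ cotensorComplex I J p =>
    HomologicalComplex.homologyMap F n) ?_) (HomologicalComplex.homologyMap_id _ n)
  refine HomologicalComplex.hom_ext _ _ fun n => ?_
  refine ModuleCat.hom_ext (LinearMap.ext fun x => Subtype.ext (funext₂ fun r s => ?_))
  exact LinearMap.congr_fun TensorProduct.map_id (x.1 r s)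

theorem Cotor.map_comp (φ : I.Lift I' f) (φ' : I'.Lift I'' f') (ψ : J.Lift J' g)
    (ψ' : J'.Lift J'' g') (n : ℕ) :
    Cotor.map φ ψ n ≫ Cotor.map φ' ψ' n = Cotor.map (φ.comp φ') (ψ.comp ψ') n := by
  funext p
  refine (HomologicalComplex.homologyMap_comp _ _ n).symm.trans
    (congrArg (fun F : cotensorComplex I J p ⟶ cotensorComplex I'' J'' p =>
      HomologicalComplex.homologyMap F n) ?_)
  refine HomologicalComplex.hom_ext _ _ fun n => ?_
  refine ModuleCat.hom_ext (LinearMap.ext fun x => Subtype.ext (funext₂ fun r s => ?_))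
  exact (LinearMap.congr_fun (TensorProduct.map_comp (φ'.app r).lin (ψ'.app s).lin
    (φ.app r).lin (ψ.app s).lin) (x.1 r s)).symm

/-- Morphisms of resolutions of the same objects induce isomorphisms. -/
theorem Cotor.isIso_map {I I' : InjRes (GrRComod.forget 𝓒) M} {J J' : InjRes (GrLComod.forget 𝓒) N}
    (φ : I.Lift I' (𝟙 M)) (ψ : J.Lift J' (𝟙 N)) (φ' : I'.Lift I (𝟙 M)) (ψ' : J'.Lift J (𝟙 N))
    (n : ℕ) : IsIso (Cotor.map φ ψ n) := by
  refine ⟨Cotor.map φ' ψ' n, ?_, ?_⟩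
  · rw [Cotor.map_comp]
    exact Cotor.map_id ((φ.comp φ').copy (Category.comp_id _))
      ((ψ.comp ψ').copy (Category.comp_id _)) n
  · rw [Cotor.map_comp]
    exact Cotor.map_id ((φ'.comp φ).copy (Category.comp_id _))
      ((ψ'.comp ψ).copy (Category.comp_id _)) n

end CotorFunctoriality

/-! ### Sign twists, and hom_{A^e}(A, B) as central elements. -/

section Twist

variable {k : Type u} [Field k] (ε : ℤˣ) (p : ℤ)

/-- Multiplication by the sign `ε^{p i}` in degree `i`. -/
noncomputable def GrVect.twist (V : GrVect k) : V.carrier →ₗ[k] V.carrier :=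
  V.ofFamily fun i => ε ^ (p * i) • LinearMap.id

variable {V W : GrVect k}

theorem GrVect.twist_apply {i : ℤ} {x : V.carrier} (hx : x ∈ V.gr i) :
    V.twist ε p x = ε ^ (p * i) • x :=
  ofFamily_apply _ hx

theorem GrVect.units_smul_mem (ε : ℤˣ) {S : Submodule k V.carrier} {x : V.carrier} (hx : x ∈ S) :
    ε • x ∈ S := by
  rw [Units.smul_def]
  exact zsmul_mem hx _

theorem GrVect.units_map_smul (f : V.carrier →ₗ[k] W.carrier) (ε : ℤˣ) (x : V.carrier) :
    f (ε • x) = ε • f x := by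
  rw [Units.smul_def, Units.smul_def, map_zsmul]

theorem GrVect.twist_mem {i : ℤ} {x : V.carrier} (hx : x ∈ V.gr i) : V.twist ε p x ∈ V.gr i := by
  rw [twist_apply ε p hx]
  exact units_smul_mem _ hx

theorem GrVect.twist_comp_twist : V.twist ε p ∘ₗ V.twist ε p = LinearMap.id :=
  linearMap_ext fun i x hx => by
    rw [LinearMap.comp_apply, twist_apply ε p (twist_mem ε p hx), twist_apply ε p hx, smul_smul,
      Int.units_mul_self, one_smul]
    rfl

theorem GrVect.comp_twist {f : V.carrier →ₗ[k] W.carrier}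
    (hf : ∀ i, ∀ x ∈ V.gr i, f x ∈ W.gr i) : f ∘ₗ V.twist ε p = W.twist ε p ∘ₗ f :=
  linearMap_ext fun i x hx => by
    rw [LinearMap.comp_apply, LinearMap.comp_apply, twist_apply ε p hx,
      twist_apply ε p (hf i x hx), units_map_smul]

/-- The sign exponent is additive in the degree: p(i + j) = pi + pj. -/
theorem GrVect.twist_comp_of_degree {i : ℤ} {f : V.carrier →ₗ[k] V.carrier}
    (hf : ∀ j, ∀ x ∈ V.gr j, f x ∈ V.gr (i + j)) :
    V.twist ε p ∘ₗ f = ε ^ (p * i) • (f ∘ₗ V.twist ε p) :=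
  linearMap_ext fun j x hx => by
    rw [LinearMap.smul_apply, LinearMap.comp_apply, LinearMap.comp_apply, twist_apply ε p hx,
      twist_apply ε p (hf j x hx), units_map_smul, smul_smul, mul_add, zpow_add]

variable {A : Type u} [Ring A] [Algebra k A] {𝓐 : ℤ → Submodule k A}

/-- An involution of a graded bimodule that introduces the sign `ε^{p |a|}` when it passes a left
multiplication by `a`. -/
structure GrBimod.Twist (B : GrBimod 𝓐) where
  lin : B.carrier →ₗ[k] B.carrier
  map_gr : ∀ i, ∀ x ∈ B.gr i, lin x ∈ B.gr i
  invol : ∀ x, lin (lin x) = x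
  map_lact : ∀ i, ∀ a ∈ 𝓐 i, ∀ x, lin (B.lact a x) = ε ^ (p * i) • B.lact a (lin x)
  map_ract : ∀ a x, lin (B.ract a x) = B.ract a (lin x)

theorem rTensor_units_smul {U X : Type u} [AddCommGroup U] [Module k U] [AddCommGroup X]
    [Module k X] (η : ℤˣ) (f : U →ₗ[k] U) (t : U ⊗[k] X) :
    (η • f).rTensor X t = η • f.rTensor X t := by
  rcases Int.units_eq_one_or η with rfl | rfl
  · simp
  · simp [LinearMap.rTensor_neg]

/-- The twist of `M ⊗ N` coming from the grading of `M`. -/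
noncomputable def tensorTwist (M : GrLMod 𝓐) (N : GrRMod 𝓐) :
    GrBimod.Twist ε p (tensorBimod M N) where
  lin := (M.twist ε p).rTensor N.carrier
  map_gr i _ hx := map_mem_tensorGr (f := M.twist ε p) (g := LinearMap.id) (a := 0) (b := 0)
    (fun j v hv => by rw [zero_add]; exact GrVect.twist_mem ε p hv)
    (fun j v hv => by simpa using hv) (by omega) hx
  invol x := by
    refine (LinearMap.rTensor_comp_apply N.carrier (M.twist ε p) (M.twist ε p) x).symm.trans ?_
    rw [GrVect.twist_comp_twist, LinearMap.rTensor_id]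
    rfl
  map_lact i a ha x := by
    refine (LinearMap.rTensor_comp_apply N.carrier (M.twist ε p) (M.act a) x).symm.trans ?_
    rw [GrVect.twist_comp_of_degree ε p (M.act_mem i · a ha)]
    refine (rTensor_units_smul _ _ x).trans (congrArg _ ?_)
    exact LinearMap.rTensor_comp_apply N.carrier (M.act a) (M.twist ε p) x
  map_ract a x := (lTensor_rTensor_apply (M.twist ε p) (N.act a) x).symm

/-- The componentwise twist of a diagonal sum. -/
noncomputable def diagTwist {B : ℕ → ℕ → GrBimod 𝓐} (τ : ∀ r s, GrBimod.Twist ε p (B r s)) (n : ℕ) :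
    GrBimod.Twist ε p (diagSum B n) where
  lin := diagMap fun r s => (τ r s).lin
  map_gr i x hx r s := (τ r s).map_gr i _ (hx r s)
  invol x := Subtype.ext (funext₂ fun r s => (τ r s).invol (x.1 r s))
  map_lact i a ha x := Subtype.ext (funext₂ fun r s => (τ r s).map_lact i a ha (x.1 r s))
  map_ract a x := Subtype.ext (funext₂ fun r s => (τ r s).map_ract a (x.1 r s))

/-- The elements of degree `p` on which the left and the right action agree. -/
def GrBimod.centralGr (B : GrBimod 𝓐) : Submodule k B.carrier where
  carrier := {x | x ∈ B.gr p ∧ ∀ a, B.lact a x = B.ract (MulOpposite.op a) x}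
  add_mem' hx hy := ⟨add_mem hx.1 hy.1, fun a => by rw [map_add, map_add, hx.2, hy.2]⟩
  zero_mem' := ⟨zero_mem _, fun a => by simp⟩
  smul_mem' c x hx := ⟨Submodule.smul_mem _ c hx.1, fun a => by rw [map_smul, map_smul, hx.2]⟩

variable {ε p} {B : GrBimod 𝓐} (τ : GrBimod.Twist ε p B)

theorem GrBimod.Twist.map_units_smul (η : ℤˣ) (x : B.carrier) : τ.lin (η • x) = η • τ.lin x :=
  GrVect.units_map_smul (V := B.toGrVect) (W := B.toGrVect) τ.lin η x

theorem GrBimod.Twist.lact_eq {i : ℤ} {a : A} (ha : a ∈ 𝓐 i) (x : B.carrier) :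
    B.lact a (τ.lin x) = ε ^ (p * i) • τ.lin (B.lact a x) := by
  rw [τ.map_lact i a ha, smul_smul, Int.units_mul_self, one_smul]

/-- The bimodule map `a ↦ τ(x) a` attached to a central element `x`. -/
noncomputable def GrBimod.Twist.toHom : B.centralGr p →ₗ[k] bimodHom ε p B where
  toFun x := ⟨(B.ract.toLinearMap ∘ₗ (MulOpposite.opLinearEquiv k).toLinearMap).flip (τ.lin x.1),
    fun i a ha => B.ract_mem i p a ha _ (τ.map_gr p _ x.2.1),
    fun i a ha y => by
      change B.ract (MulOpposite.op (a * y)) (τ.lin x.1) =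
        ε ^ (p * i) • B.lact a (B.ract (MulOpposite.op y) (τ.lin x.1))
      rw [B.lact_ract, τ.lact_eq ha, x.2.2 a, τ.map_ract,
        GrVect.units_map_smul (V := B.toGrVect) (W := B.toGrVect), smul_smul, Int.units_mul_self,
        one_smul, MulOpposite.op_mul, map_mul]
      rfl,
    fun y a => by
      change B.ract (MulOpposite.op (y * a)) (τ.lin x.1) =
        B.ract (MulOpposite.op a) (B.ract (MulOpposite.op y) (τ.lin x.1))
      rw [MulOpposite.op_mul, map_mul]
      rfl⟩
  map_add' x y := Subtype.ext (LinearMap.ext fun a => by simp)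
  map_smul' c x := Subtype.ext (LinearMap.ext fun a => by simp)

theorem GrBimod.Twist.toHom_apply (x : B.centralGr p) (a : A) :
    (τ.toHom x).1 a = B.ract (MulOpposite.op a) (τ.lin x.1) := rfl

/-- Evaluation at 1 followed by the involution recovers the central element. -/
theorem GrBimod.Twist.toHom_injective : Function.Injective τ.toHom := by
  intro x y h
  have h1 := LinearMap.congr_fun (congrArg Subtype.val h) 1
  rw [toHom_apply, toHom_apply, MulOpposite.op_one, map_one] at h1
  have h2 : τ.lin x.1 = τ.lin y.1 := h1
  exact Subtype.ext (by rw [← τ.invol x.1, h2, τ.invol])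

/-- Writing a = 1·a = a·1 gives f(a) = f(1) a and f(a) = ε^{p|a|} a f(1) for homogeneous a. The
involution absorbs the sign, so τ(f(1)) is central and is the preimage of f. -/
theorem GrBimod.Twist.toHom_surjective [GradedAlgebra 𝓐] : Function.Surjective τ.toHom := by
  classical
  intro f
  have hr : ∀ a, f.1 a = B.ract (MulOpposite.op a) (f.1 1) := fun a => by
    rw [← f.2.2.2, one_mul]
  have hl : ∀ i, ∀ a ∈ 𝓐 i, f.1 a = ε ^ (p * i) • B.lact a (f.1 1) := fun i a ha => by
    rw [← f.2.2.1 i a ha, mul_one]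
  refine ⟨⟨τ.lin (f.1 1), τ.map_gr p _ ?_, fun a => ?_⟩, Subtype.ext (LinearMap.ext fun a => ?_)⟩
  · simpa using f.2.1 0 1 SetLike.GradedOne.one_mem
  · induction a using DirectSum.Decomposition.inductionOn 𝓐 with
    | zero => simp
    | add x y hx hy => rw [map_add, LinearMap.add_apply, hx, hy, MulOpposite.op_add, map_add]; rfl
    | @homogeneous i a =>
      rw [τ.lact_eq a.2, ← τ.map_ract, ← hr, hl i a a.2, τ.map_units_smul]
  · rw [toHom_apply, τ.invol, hr a]

end Twist

/-! ### Cotensor products as central elements. -/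

section Cotensor

variable {k : Type u} [Field k] {A : Type u} [Ring A] [Algebra k A] {𝓐 : ℤ → Submodule k A}

theorem canHomLeft_injective {V : Type u} [AddCommMonoid V] [Module k V] :
    Function.Injective (canHomLeft 𝓐 V) :=
  (canHom_injective 𝓐).comp (TensorProduct.comm k (grDual 𝓐) V).injective

variable [GradedAlgebra 𝓐] [PosFiniteType 𝓐]

/-- Evaluation of the middle factor. -/
noncomputable def midEval (V W : Type u) [AddCommMonoid V] [Module k V] [AddCommMonoid W]
    [Module k W] : V ⊗[k] (grDual 𝓐 ⊗[k] W) →ₗ[k] A →ₗ[k] V ⊗[k] W :=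
  canHomLeft 𝓐 _ ∘ₗ (TensorProduct.leftComm k V (grDual 𝓐) W).toLinearMap

section

variable {V W : Type u} [AddCommMonoid V] [Module k V] [AddCommMonoid W] [Module k W]

omit [GradedAlgebra 𝓐] [PosFiniteType 𝓐] in
theorem midEval_injective : Function.Injective (midEval (𝓐 := 𝓐) V W) :=
  canHomLeft_injective.comp (TensorProduct.leftComm k V (grDual 𝓐) W).injective

omit [GradedAlgebra 𝓐] [PosFiniteType 𝓐] in
theorem midEval_assoc_tmul (u : V ⊗[k] grDual 𝓐) (w : W) (a : A) :
    midEval V W (TensorProduct.assoc k V (grDual 𝓐) W (u ⊗ₜ w)) a = canHom 𝓐 V u a ⊗ₜ w := by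
  induction u with
  | zero => simp
  | add x y hx hy => simp only [add_tmul, map_add, LinearMap.add_apply, hx, hy]
  | tmul v f => simp [midEval, smul_tmul']

omit [GradedAlgebra 𝓐] [PosFiniteType 𝓐] in
theorem midEval_tmul (v : V) (u : grDual 𝓐 ⊗[k] W) (a : A) :
    midEval V W (v ⊗ₜ u) a = v ⊗ₜ canHomLeft 𝓐 W u a := by
  induction u with
  | zero => simp
  | add x y hx hy => simp only [tmul_add, map_add, LinearMap.add_apply, hx, hy]
  | tmul f w => simp [midEval]

end

/-- Evaluating the middle factor at `a` turns the two coactions into the two actions of `a`. -/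
theorem midEval_cotensorMap (X : GrRComod (dualGr 𝓐)) (Y : GrLComod (dualGr 𝓐))
    (t : X.carrier ⊗[k] Y.carrier) (a : A) :
    midEval X.carrier Y.carrier (cotensorMap X Y t) a = (X.toMod.act a).rTensor Y.carrier t -
      (Y.toMod.act (MulOpposite.op a)).lTensor X.carrier t := by
  induction t with
  | zero => simp
  | add x y hx hy =>
    simp only [map_add, LinearMap.add_apply, hx, hy]
    abel
  | tmul x y =>
    rw [cotensorMap, LinearMap.sub_apply, map_sub, LinearMap.sub_apply]
    exact congrArg₂ (· - ·) (midEval_assoc_tmul (X.coact x) y a) (midEval_tmul x (Y.coact y) a)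

/-- Evaluation of the middle factor is injective, so the cotensor condition can be tested against
every a ∈ A, where it reads at = ta. No boundedness of the comodules is needed. -/
theorem mem_cotensorGr_iff (X : GrRComod (dualGr 𝓐)) (Y : GrLComod (dualGr 𝓐)) (p : ℤ)
    (t : X.carrier ⊗[k] Y.carrier) :
    t ∈ cotensorGr X Y p ↔ t ∈ (comodBimod X Y).centralGr p := by
  have h : t ∈ LinearMap.ker (cotensorMap X Y) ↔ ∀ a : A, (X.toMod.act a).rTensor Y.carrier t =
      (Y.toMod.act (MulOpposite.op a)).lTensor X.carrier t := by
    rw [LinearMap.mem_ker, ← map_eq_zero_iff _ (midEval_injective (𝓐 := 𝓐)), LinearMap.ext_iff]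
    refine forall_congr' fun a => ?_
    rw [midEval_cotensorMap, LinearMap.zero_apply, sub_eq_zero]
  exact (and_congr_left' h).trans and_comm

end Cotensor

/-! ### Homotopy invariance and functoriality of Hochschild cohomology. -/

section HochschildFunctoriality

variable {k : Type u} [Field k] {A : Type u} [Ring A] [Algebra k A] {𝓐 : ℤ → Submodule k A}
  (ε : ℤˣ) {B B' B'' : GrBimod 𝓐} {h : B ⟶ B'} {h' : B' ⟶ B''}

/-- The degree `p` part of the complex `hom_{A^e}(A, R^*)` for an arbitrary resolution `R^*`. -/
noncomputable def bimodHomRes (R : Res (GrBimod.forget 𝓐) B) (p : ℤ) :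
    CochainComplex (ModuleCat.{u} k) ℕ :=
  CochainComplex.of (fun n => ModuleCat.of k (bimodHom ε p (R.obj n)))
    (fun n => ModuleCat.ofHom (bimodHomMap ε p (R.d n)))
    (fun n => by
      refine ModuleCat.hom_ext (LinearMap.ext fun f => Subtype.ext (LinearMap.ext fun a => ?_))
      exact (R.exact_succ n).apply_apply_eq_zero (f.1 a))

theorem bimodHomRes_d (R : Res (GrBimod.forget 𝓐) B) (p : ℤ) (n : ℕ) :
    (bimodHomRes ε R p).d n (n + 1) = ModuleCat.ofHom (bimodHomMap ε p (R.d n)) := by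
  simp only [bimodHomRes, CochainComplex.of_d]

theorem bimodHomComplex_d (E : InjRes (GrBimod.forget 𝓐) B) (p : ℤ) (n : ℕ) :
    (bimodHomComplex ε E p).d n (n + 1) = ModuleCat.ofHom (bimodHomMap ε p (E.d n)) := by
  simp only [bimodHomComplex, CochainComplex.of_d]

variable {R : Res (GrBimod.forget 𝓐) B} {E : InjRes (GrBimod.forget 𝓐) B}
  {E' : InjRes (GrBimod.forget 𝓐) B'} {E'' : InjRes (GrBimod.forget 𝓐) B''}

/-- The morphism of complexes induced by a morphism of resolutions. -/
noncomputable def bimodHomResMap (χ : R.Lift E' h) (p : ℤ) :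
    bimodHomRes ε R p ⟶ bimodHomComplex ε E' p :=
  CochainComplex.ofHom (fun n => ModuleCat.ofHom (bimodHomMap ε p (χ.app n)))
    (fun n => by
      rw [bimodHomComplex_d, bimodHomRes_d]
      refine ModuleCat.hom_ext (LinearMap.ext fun f => Subtype.ext (LinearMap.ext fun a => ?_))
      exact (LinearMap.congr_fun (congrArg GrBimod.Hom.lin (χ.comm n)) (f.1 a)).symm)

/-- Postcomposition with a homotopy of bimodule homomorphisms is a homotopy of hom complexes. The
source is an arbitrary resolution, since this is applied to I ⊗ J. -/
theorem bimodHomResMap_homology_eq (χ χ' : R.Lift E' h) (p : ℤ) (n : ℕ) :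
    HomologicalComplex.homologyMap (bimodHomResMap ε χ p) n =
      HomologicalComplex.homologyMap (bimodHomResMap ε χ' p) n := by
  obtain ⟨l, l0, ls⟩ := χ.exists_homotopy χ'
  refine Homotopy.homologyMap_eq (homotopyOfComponents
    (fun n => ModuleCat.ofHom (bimodHomMap ε p (l n))) ?_ fun n => ?_) n
  · rw [bimodHomRes_d]
    refine ModuleCat.hom_ext (LinearMap.ext fun f => Subtype.ext (LinearMap.ext fun a => ?_))
    exact LinearMap.congr_fun l0 (f.1 a)
  · rw [bimodHomRes_d, bimodHomComplex_d]
    refine ModuleCat.hom_ext (LinearMap.ext fun f => Subtype.ext (LinearMap.ext fun a => ?_))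
    have e := ls n
    rw [add_comm (undl _ (E'.d n) ∘ₗ _)] at e
    exact LinearMap.congr_fun e (f.1 a)

theorem HochGr.map_eq (χ χ' : E.Lift E' h) (n : ℕ) : HochGr.map ε χ n = HochGr.map ε χ' n :=
  funext fun p => bimodHomResMap_homology_eq ε χ.toResLift χ'.toResLift p n

theorem HochGr.map_id (χ : E.Lift E (𝟙 B)) (n : ℕ) : HochGr.map ε χ n = 𝟙 _ := by
  rw [HochGr.map_eq ε χ (.id E)]
  funext p
  refine Eq.trans (congrArg (fun F : bimodHomComplex ε E p ⟶ bimodHomComplex ε E p =>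
    HomologicalComplex.homologyMap F n) ?_) (HomologicalComplex.homologyMap_id _ n)
  exact HomologicalComplex.hom_ext _ _ fun n => rfl

theorem HochGr.map_comp (χ : E.Lift E' h) {E'' : InjRes (GrBimod.forget 𝓐) B''}
    (χ' : E'.Lift E'' h') (n : ℕ) :
    HochGr.map ε χ n ≫ HochGr.map ε χ' n = HochGr.map ε (χ.comp χ') n := by
  funext p
  refine (HomologicalComplex.homologyMap_comp _ _ n).symm.trans
    (congrArg (fun F : bimodHomComplex ε E p ⟶ bimodHomComplex ε E'' p =>
      HomologicalComplex.homologyMap F n) ?_)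
  exact HomologicalComplex.hom_ext _ _ fun n => rfl

/-- Morphisms of resolutions of the same bimodule induce isomorphisms. -/
theorem HochGr.isIso_map {E E' : InjRes (GrBimod.forget 𝓐) B} (χ : E.Lift E' (𝟙 B)) (n : ℕ) :
    IsIso (HochGr.map ε χ n) := by
  obtain ⟨χ'⟩ := E'.exists_lift E (𝟙 B)
  refine ⟨HochGr.map ε χ' n, ?_, ?_⟩
  · rw [HochGr.map_comp]
    exact HochGr.map_id ε ((χ.comp χ').copy (Category.comp_id _)) n
  · rw [HochGr.map_comp]
    exact HochGr.map_id ε ((χ'.comp χ).copy (Category.comp_id _)) n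

end HochschildFunctoriality

/-! ### The comparison isomorphism and its naturality. -/

section Comparison

variable {k : Type u} [Field k] {A : Type u} [Ring A] [Algebra k A] {𝓐 : ℤ → Submodule k A}
  [GradedAlgebra 𝓐] [PosFiniteType 𝓐] (ε : ℤˣ) (p : ℤ)

section

variable {M M' : GrRComod (dualGr 𝓐)} {N N' : GrLComod (dualGr 𝓐)}
  (I : InjRes (GrRComod.forget (dualGr 𝓐)) M) (J : InjRes (GrLComod.forget (dualGr 𝓐)) N)

/-- The twist of the total complex of `I ⊗ J`. -/
noncomputable def totTwist (n : ℕ) : GrBimod.Twist ε p (totBimod I J n) :=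
  diagTwist ε p (fun r s => tensorTwist ε p (I.obj r).toMod (J.obj s).toMod) n

/-- The total complex of `I □ J` consists of the central elements of the total complex of
`I ⊗ J`. -/
noncomputable def totCotensorEquiv (n : ℕ) :
    totCotensor I J p n ≃ₗ[k] (totBimod I J n).centralGr p where
  toFun x := ⟨⟨x.1, x.2.2⟩, fun r s => ((mem_cotensorGr_iff _ _ p _).mp (x.2.1 r s)).1,
    fun a => Subtype.ext (funext₂ fun r s => ((mem_cotensorGr_iff _ _ p _).mp (x.2.1 r s)).2 a)⟩
  map_add' _ _ := rfl
  map_smul' _ _ := rfl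
  invFun y := ⟨y.1.1, fun r s => (mem_cotensorGr_iff _ _ p _).mpr ⟨y.2.1 r s, fun a =>
    congrFun₂ (congrArg Subtype.val (y.2.2 a)) r s⟩, y.1.2⟩
  left_inv _ := rfl
  right_inv _ := rfl

variable {I J} in
/-- The bimodule homomorphisms between total complexes given by morphisms of resolutions. -/
noncomputable def totBimodMap {I' : InjRes (GrRComod.forget (dualGr 𝓐)) M'}
    {J' : InjRes (GrLComod.forget (dualGr 𝓐)) N'} {f : M ⟶ M'} {g : N ⟶ N'} (φ : I.Lift I' f)
    (ψ : J.Lift J' g) (n : ℕ) : totBimod I J n ⟶ totBimod I' J' n where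
  lin := diagMap fun r s => TensorProduct.map (φ.app r).lin (ψ.app s).lin
  map_gr q _ hx r s := (tensorBimodMap (GrRComod.toModMap (φ.app r))
    (GrLComod.toModMap (ψ.app s))).map_gr q _ (hx r s)
  map_lact a x := Subtype.ext (funext₂ fun r s => (tensorBimodMap (GrRComod.toModMap (φ.app r))
    (GrLComod.toModMap (ψ.app s))).map_lact a (x.1 r s))
  map_ract a x := Subtype.ext (funext₂ fun r s => (tensorBimodMap (GrRComod.toModMap (φ.app r))
    (GrLComod.toModMap (ψ.app s))).map_ract a (x.1 r s))

/-- The twist is a scalar on each graded piece of the first factor, so it commutes with maps of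
degree 0. -/
theorem totBimodMap_totTwist {I' : InjRes (GrRComod.forget (dualGr 𝓐)) M'}
    {J' : InjRes (GrLComod.forget (dualGr 𝓐)) N'} {f : M ⟶ M'} {g : N ⟶ N'} (φ : I.Lift I' f)
    (ψ : J.Lift J' g) (n : ℕ) (x : (totBimod I J n).carrier) :
    (totBimodMap φ ψ n).lin ((totTwist ε p I J n).lin x) =
      (totTwist ε p I' J' n).lin ((totBimodMap φ ψ n).lin x) := by
  refine Subtype.ext (funext₂ fun r s => ?_)
  refine (LinearMap.congr_fun (LinearMap.map_comp_rTensor _ (φ.app r).lin (ψ.app s).lin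
    ((I.obj r).twist ε p)) (x.1 r s)).trans ?_
  rw [GrVect.comp_twist ε p (φ.app r).map_gr]
  exact (LinearMap.congr_fun (LinearMap.rTensor_comp_map _ ((I'.obj r).twist ε p) (φ.app r).lin
    (ψ.app s).lin) (x.1 r s)).symm

theorem totBimodD_totTwist (n : ℕ) (x : (totBimod I J n).carrier) :
    (totBimodD I J n).lin ((totTwist ε p I J n).lin x) =
      (totTwist ε p I J (n + 1)).lin ((totBimodD I J n).lin x) := by
  refine Subtype.ext (funext₂ fun r s => ?_)
  refine totD_comm (I' := I) (J' := J)
    (fun r s => ((I.obj r).twist ε p).rTensor (J.obj s).carrier) (fun r s t => ?_)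
    (fun r s t => (lTensor_rTensor_apply _ _ t).symm) x.1 r s
  rw [← LinearMap.rTensor_comp_apply, ← LinearMap.rTensor_comp_apply,
    GrVect.comp_twist ε p (I.d r).map_gr]

/-- The isomorphism of complexes from `I □ J` to `hom_{A^e}(A, I ⊗ J)`, in components. -/
noncomputable def cotensorToHom (n : ℕ) : totCotensor I J p n →ₗ[k] bimodHom ε p (totBimod I J n) :=
  (totTwist ε p I J n).toHom ∘ₗ (totCotensorEquiv p I J n).toLinearMap

theorem cotensorToHom_bijective (n : ℕ) : Function.Bijective (cotensorToHom ε p I J n) := by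
  have h : Function.Bijective (totTwist ε p I J n).toHom :=
    ⟨(totTwist ε p I J n).toHom_injective, (totTwist ε p I J n).toHom_surjective⟩
  exact h.comp (totCotensorEquiv p I J n).bijective

end

variable {M M' : GrLMod 𝓐} {N N' : GrRMod 𝓐} {hM : M.IsBddAbove} {hN : N.IsBddAbove}
  {hM' : M'.IsBddAbove} {hN' : N'.IsBddAbove}
  (I : InjRes (GrRComod.forget (dualGr 𝓐)) (M.toComod hM))
  (J : InjRes (GrLComod.forget (dualGr 𝓐)) (N.toComod hN))

/-- The isomorphism of complexes from `I □ J` to `hom_{A^e}(A, I ⊗ J)`. -/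
noncomputable def cotensorToHomComplex :
    cotensorComplex I J p ⟶ bimodHomRes ε (totRes I J) p :=
  CochainComplex.ofHom (fun n => ModuleCat.ofHom (cotensorToHom ε p I J n))
    (fun n => by
      rw [bimodHomRes_d, cotensorComplex_d]
      refine ModuleCat.hom_ext (LinearMap.ext fun x => Subtype.ext (LinearMap.ext fun a => ?_))
      -- The map is x ↦ (a ↦ τ(x) a), and the differential commutes with right multiplication and
      -- with the twist.
      refine ((totBimodD I J n).map_ract _ _).trans (congrArg _ ?_)
      exact totBimodD_totTwist ε p I J n ⟨x.1, x.2.2⟩)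

instance cotensorToHomComplex_isIso : IsIso (cotensorToHomComplex ε p I J) := by
  have : ∀ n, IsIso ((cotensorToHomComplex ε p I J).f n) := fun n => by
    rw [ConcreteCategory.isIso_iff_bijective]
    exact cotensorToHom_bijective ε p I J n
  exact HomologicalComplex.Hom.isIso_of_components _

variable {I J} {B B' : GrBimod 𝓐} {h : tensorBimod M N ⟶ B} {h' : B ⟶ B'}
  {E : InjRes (GrBimod.forget 𝓐) B} {E' : InjRes (GrBimod.forget 𝓐) B'}

/-- The map from `Cotor` to Hochschild cohomology given by a morphism from the total complex of
`I ⊗ J` to an injective resolution. -/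
noncomputable def comparison (χ : (totRes I J).Lift E h) (n : ℕ) : Cotor I J n ⟶ HochGr ε E n :=
  fun p => HomologicalComplex.homologyMap (cotensorToHomComplex ε p I J ≫ bimodHomResMap ε χ p) n

/-- Two lifts are homotopic. Hence naturality only requires exhibiting both composites as comparison
maps of lifts of the same morphism. -/
theorem comparison_eq (χ χ' : (totRes I J).Lift E h) (n : ℕ) :
    comparison ε χ n = comparison ε χ' n := by
  funext p
  refine (HomologicalComplex.homologyMap_comp _ _ n).trans
    (Eq.trans ?_ (HomologicalComplex.homologyMap_comp _ _ n).symm)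
  rw [bimodHomResMap_homology_eq ε χ χ']

/-- Composition of morphisms of resolutions. -/
def Res.Lift.comp {𝒟 : Type (u + 1)} [Category.{u} 𝒟] {F : 𝒟 ⥤ ModuleCat.{u} k} {X X' X'' : 𝒟}
    {f : X ⟶ X'} {g : X' ⟶ X''} {R : Res F X} {R' : InjRes F X'} {R'' : InjRes F X''}
    (φ : R.Lift R' f) (ψ : R'.Lift R'' g) : R.Lift R'' (f ≫ g) where
  app n := φ.app n ≫ ψ.app n
  comm n := by rw [← Category.assoc, φ.comm, Category.assoc, ψ.comm, Category.assoc]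
  aug := by rw [← Category.assoc, φ.aug, Category.assoc, ψ.aug, Category.assoc]

/-- A morphism of resolutions lifting an equal morphism. -/
def Res.Lift.copy {𝒟 : Type (u + 1)} [Category.{u} 𝒟] {F : 𝒟 ⥤ ModuleCat.{u} k} {X X' : 𝒟}
    {f f' : X ⟶ X'} {R : Res F X} {R' : InjRes F X'} (φ : R.Lift R' f) (h : f = f') :
    R.Lift R' f' where
  app := φ.app
  comm := φ.comm
  aug := h ▸ φ.aug

theorem comparison_comp_map (χ : (totRes I J).Lift E h) (χ' : E.Lift E' h') (n : ℕ) :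
    comparison ε χ n ≫ HochGr.map ε χ' n = comparison ε (χ.comp χ') n := by
  funext p
  refine (HomologicalComplex.homologyMap_comp _ _ n).symm.trans
    (congrArg (fun F : cotensorComplex I J p ⟶ bimodHomComplex ε E' p =>
      HomologicalComplex.homologyMap F n) ?_)
  exact HomologicalComplex.hom_ext _ _ fun n => rfl

variable {I' : InjRes (GrRComod.forget (dualGr 𝓐)) (M'.toComod hM')}
  {J' : InjRes (GrLComod.forget (dualGr 𝓐)) (N'.toComod hN')} {f : M ⟶ M'} {g : N ⟶ N'}
  (φ : I.Lift I' (GrLMod.toComodMap hM hM' f)) (ψ : J.Lift J' (GrRMod.toComodMap hN hN' g))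

theorem totBimodAug_totBimodMap :
    totBimodAug I J ≫ totBimodMap φ ψ 0 = tensorBimodMap f g ≫ totBimodAug I' J' := by
  refine GrBimod.hom_ext (LinearMap.ext fun t => totBimodZero_ext I' J' ?_)
  have hφ : (φ.app 0).lin ∘ₗ I.ι.lin = I'.ι.lin ∘ₗ f.lin := congrArg GrRComod.Hom.lin φ.aug
  have hψ : (ψ.app 0).lin ∘ₗ J.ι.lin = J'.ι.lin ∘ₗ g.lin := congrArg GrLComod.Hom.lin ψ.aug
  refine (congrArg (TensorProduct.map (φ.app 0).lin (ψ.app 0).lin)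
    (totBimodAug_apply I J t)).trans (Eq.trans ?_ (totBimodAug_apply I' J' _).symm)
  refine (LinearMap.congr_fun (TensorProduct.map_comp (φ.app 0).lin (ψ.app 0).lin I.ι.lin
    J.ι.lin) t).symm.trans ?_
  rw [hφ, hψ]
  exact LinearMap.congr_fun (TensorProduct.map_comp I'.ι.lin J'.ι.lin f.lin g.lin) t

/-- Precomposition with the morphism of total complexes given by morphisms of resolutions. -/
noncomputable def totLift {h : tensorBimod M' N' ⟶ B} (χ : (totRes I' J').Lift E h) :
    (totRes I J).Lift E (tensorBimodMap f g ≫ h) where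
  app n := totBimodMap φ ψ n ≫ χ.app n
  comm n := GrBimod.hom_ext (LinearMap.ext fun x => (congrArg (χ.app (n + 1)).lin
    (Subtype.ext (totMap_totD φ ψ x.1))).trans (LinearMap.congr_fun
      (congrArg GrBimod.Hom.lin (χ.comm n)) ((totBimodMap φ ψ n).lin x)))
  aug := GrBimod.hom_ext (LinearMap.ext fun t => (congrArg (χ.app 0).lin
    (LinearMap.congr_fun (congrArg GrBimod.Hom.lin (totBimodAug_totBimodMap φ ψ)) t)).trans
      (LinearMap.congr_fun (congrArg GrBimod.Hom.lin χ.aug) ((tensorBimodMap f g).lin t)))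

theorem map_comp_comparison {h : tensorBimod M' N' ⟶ B} (χ : (totRes I' J').Lift E h) (n : ℕ) :
    Cotor.map φ ψ n ≫ comparison ε χ n = comparison ε (totLift φ ψ χ) n := by
  funext p
  refine (HomologicalComplex.homologyMap_comp _ _ n).symm.trans
    (congrArg (fun F : cotensorComplex I J p ⟶ bimodHomComplex ε E p =>
      HomologicalComplex.homologyMap F n) ?_)
  refine HomologicalComplex.hom_ext _ _ fun n => ?_
  refine ModuleCat.hom_ext (LinearMap.ext fun x => Subtype.ext (LinearMap.ext fun a => ?_))
  refine congrArg (χ.app n).lin (Eq.trans ?_ ((totBimodMap φ ψ n).map_ract _ _).symm)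
  exact congrArg ((totBimod I' J' n).ract (MulOpposite.op a)) (totBimodMap_totTwist ε p I J φ ψ n ⟨x.1, x.2.2⟩).symm

/-- The comparison map is an isomorphism if the total complex is an injective resolution. -/
theorem comparison_isIso_of_isInjective {E : InjRes (GrBimod.forget 𝓐) (tensorBimod M N)}
    (hT : ∀ n, IsInjectiveObj (GrBimod.forget 𝓐) (totBimod I J n))
    (χ : (totRes I J).Lift E (𝟙 _)) (n : ℕ) : IsIso (comparison ε χ n) := by
  let T := (totRes I J).toInjRes hT
  let χ' : T.Lift E (𝟙 _) := ⟨χ.app, χ.comm, χ.aug⟩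
  -- When the total complex is itself an injective resolution `T`, the comparison map factors as the
  -- isomorphism onto the Hochschild cohomology computed by `T`, followed by the change of
  -- resolution from `T` to `E`.
  let Ψ : Cotor I J n ⟶ HochGr ε T n := fun p =>
    HomologicalComplex.homologyMap (cotensorToHomComplex ε p I J) n
  have hΨ : IsIso Ψ := by
    have : ∀ p, IsIso (Ψ p) := fun p =>
      inferInstanceAs (IsIso (HomologicalComplex.homologyMap (cotensorToHomComplex ε p I J) n))
    exact GradedObject.isIso_of_isIso_apply Ψ
  have hχ := HochGr.isIso_map ε χ' n
  have : comparison ε χ n = Ψ ≫ HochGr.map ε χ' n :=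
    funext fun p => HomologicalComplex.homologyMap_comp _ _ n
  rw [this]
  infer_instance

omit [GradedAlgebra 𝓐] [PosFiniteType 𝓐] in
theorem tensorBimodMap_id : tensorBimodMap (𝟙 M) (𝟙 N) = 𝟙 (tensorBimod M N) :=
  GrBimod.hom_ext TensorProduct.map_id

/-- The comparison map is an isomorphism. -/
theorem comparison_isIso {E : InjRes (GrBimod.forget 𝓐) (tensorBimod M N)}
    (χ : (totRes I J).Lift E (𝟙 _)) (n : ℕ) : IsIso (comparison ε χ n) := by
  -- The terms of `I` and `J` may be unbounded, so those of I ⊗ J are not known to be injective. The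
  -- comparison map is therefore related, through the isomorphism on Cotor, to the one for
  -- bounded-above cofree resolutions.
  obtain ⟨I₀, hI₀⟩ := GrRComod.exists_cofree_injRes (M.toComod hM) hM
  obtain ⟨J₀, hJ₀⟩ := GrLComod.exists_cofree_injRes (N.toComod hN) hN
  obtain ⟨χ₀⟩ := (totRes I₀ J₀).exists_lift E (𝟙 _)
  obtain ⟨φ⟩ := I.exists_lift I₀ (𝟙 _)
  obtain ⟨φ'⟩ := I₀.exists_lift I (𝟙 _)
  obtain ⟨ψ⟩ := J.exists_lift J₀ (𝟙 _)
  obtain ⟨ψ'⟩ := J₀.exists_lift J (𝟙 _)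
  have h₀ := comparison_isIso_of_isInjective ε (isInjectiveObj_totBimod hI₀ hJ₀) χ₀ n
  have h₁ := Cotor.isIso_map φ ψ φ' ψ' n
  let χ₁ : (totRes I J).Lift E (𝟙 _) :=
    -- The composite lifts the tensor product of two identities, which equals the identity of M ⊗ N
    -- only propositionally; `copy` changes the label and keeps the components.
    (totLift (f := 𝟙 M) (g := 𝟙 N) φ ψ χ₀).copy (by rw [tensorBimodMap_id, Category.comp_id])
  have h₂ : Cotor.map φ ψ n ≫ comparison ε χ₀ n = comparison ε χ₁ n :=
    map_comp_comparison ε (f := 𝟙 M) (g := 𝟙 N) φ ψ χ₀ n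
  rw [comparison_eq ε χ χ₁, ← h₂]
  infer_instance

variable (I J) in
/-- The isomorphism between `Cotor` and Hochschild cohomology. -/
noncomputable def comparisonIso (E : InjRes (GrBimod.forget 𝓐) (tensorBimod M N)) (n : ℕ) :
    Cotor I J n ≅ HochGr ε E n :=
  letI χ := Classical.choice ((totRes I J).exists_lift E (𝟙 _))
  letI := comparison_isIso ε χ n
  asIso (comparison ε χ n)

/-- Both composites are comparison maps attached to lifts of f ⊗ g from the total complex of I ⊗ J
to `E'`, so they agree by independence of the lift. This is why the arbitrary choice of lift in
`comparisonIso` does no harm. -/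
theorem comparisonIso_naturality {E : InjRes (GrBimod.forget 𝓐) (tensorBimod M N)}
    {E' : InjRes (GrBimod.forget 𝓐) (tensorBimod M' N')} (χ : E.Lift E' (tensorBimodMap f g))
    (n : ℕ) : (comparisonIso ε I J E n).hom ≫ HochGr.map ε χ n =
      Cotor.map φ ψ n ≫ (comparisonIso ε I' J' E' n).hom := by
  refine (comparison_comp_map ε _ χ n).trans (Eq.trans ?_ (map_comp_comparison ε φ ψ _ n).symm)
  exact comparison_eq ε (Res.Lift.copy (Res.Lift.comp _ χ) (Category.id_comp _))
    ((totLift φ ψ _).copy (Category.comp_id _)) n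

end Comparison

end GrCotor

theorem mainTheorem3 {k : Type u} [Field k] {A : Type u} [Ring A] [Algebra k A]
    (𝓐 : ℤ → Submodule k A) [GradedAlgebra 𝓐] [GrCotor.PosFiniteType 𝓐] :
    -- the resolutions that define both sides exist
    (∀ (M : GrCotor.GrLMod 𝓐) (hM : M.IsBddAbove),
      Nonempty (GrCotor.InjRes (GrCotor.GrRComod.forget (GrCotor.dualGr 𝓐)) (M.toComod hM))) ∧
    (∀ (N : GrCotor.GrRMod 𝓐) (hN : N.IsBddAbove),
      Nonempty (GrCotor.InjRes (GrCotor.GrLComod.forget (GrCotor.dualGr 𝓐)) (N.toComod hN))) ∧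
    (∀ (M : GrCotor.GrLMod 𝓐) (N : GrCotor.GrRMod 𝓐), M.IsBddAbove → N.IsBddAbove →
      Nonempty (GrCotor.InjRes (GrCotor.GrBimod.forget 𝓐) (GrCotor.tensorBimod M N))) ∧
    -- the natural isomorphism
    ∀ (ε : ℤˣ) (n : ℕ),
      ∃ θ : ∀ {M : GrCotor.GrLMod 𝓐} {N : GrCotor.GrRMod 𝓐} (hM : M.IsBddAbove)
          (hN : N.IsBddAbove)
          (I : GrCotor.InjRes (GrCotor.GrRComod.forget (GrCotor.dualGr 𝓐)) (M.toComod hM))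
          (J : GrCotor.InjRes (GrCotor.GrLComod.forget (GrCotor.dualGr 𝓐)) (N.toComod hN))
          (E : GrCotor.InjRes (GrCotor.GrBimod.forget 𝓐) (GrCotor.tensorBimod M N)),
          GrCotor.Cotor I J n ≅ GrCotor.HochGr ε E n,
        ∀ {M M' : GrCotor.GrLMod 𝓐} {N N' : GrCotor.GrRMod 𝓐}
          (hM : M.IsBddAbove) (hM' : M'.IsBddAbove) (hN : N.IsBddAbove) (hN' : N'.IsBddAbove)
          (f : M ⟶ M') (g : N ⟶ N')
          (I : GrCotor.InjRes (GrCotor.GrRComod.forget (GrCotor.dualGr 𝓐)) (M.toComod hM))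
          (I' : GrCotor.InjRes (GrCotor.GrRComod.forget (GrCotor.dualGr 𝓐)) (M'.toComod hM'))
          (J : GrCotor.InjRes (GrCotor.GrLComod.forget (GrCotor.dualGr 𝓐)) (N.toComod hN))
          (J' : GrCotor.InjRes (GrCotor.GrLComod.forget (GrCotor.dualGr 𝓐)) (N'.toComod hN'))
          (E : GrCotor.InjRes (GrCotor.GrBimod.forget 𝓐) (GrCotor.tensorBimod M N))
          (E' : GrCotor.InjRes (GrCotor.GrBimod.forget 𝓐) (GrCotor.tensorBimod M' N'))
          (φ : I.Lift I' (GrCotor.GrLMod.toComodMap hM hM' f))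
          (ψ : J.Lift J' (GrCotor.GrRMod.toComodMap hN hN' g))
          (χ : E.Lift E' (GrCotor.tensorBimodMap f g)),
          (θ hM hN I J E).hom ≫ GrCotor.HochGr.map ε χ n =
            GrCotor.Cotor.map φ ψ n ≫ (θ hM' hN' I' J' E').hom := by
  refine ⟨fun M hM => ?_, fun N hN => ?_, fun M N hM hN => ?_, fun ε n => ?_⟩
  · obtain ⟨I, -⟩ := GrCotor.GrRComod.exists_cofree_injRes (M.toComod hM) hM
    exact ⟨I⟩
  · obtain ⟨J, -⟩ := GrCotor.GrLComod.exists_cofree_injRes (N.toComod hN) hN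
    exact ⟨J⟩
  -- The injective bimodule resolution of M ⊗ N is the total complex of two bounded-above cofree
  -- resolutions.
  · obtain ⟨I, hI⟩ := GrCotor.GrRComod.exists_cofree_injRes (M.toComod hM) hM
    obtain ⟨J, hJ⟩ := GrCotor.GrLComod.exists_cofree_injRes (N.toComod hN) hN
    exact ⟨(GrCotor.totRes I J).toInjRes (GrCotor.isInjectiveObj_totBimod hI hJ)⟩
  · refine ⟨fun hM hN I J E => GrCotor.comparisonIso ε I J E n, ?_⟩
    intro M M' N N' hM hM' hN hN' f g I I' J J' E E' φ ψ χ
    exact GrCotor.comparisonIso_naturality ε φ ψ χ n
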